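/- Fix $e\in[0,1)$ and put $\sigma_e(r)=\frac{1-e}{4}r$ for $r\ge 0$. Let $\mathcal P(\mathbb R)$ be the set of Borel probability measures on $\mathbb R$, let $\Omega=\{(v,v_*)\in\mathbb R^2: v\ne v_*\}$, and let $\mathcal M(\Omega)$ be the set of finite signed Borel measures on $\Omega$. Let $\mathcal P_2^{\mathrm{cm}}(\mathbb R)$ be the set of $f\in\mathcal P(\mathbb R)$ with $\int v^2\,df<\infty$ and $\int v\,df=0$. For $f\in\mathcal P(\mathbb R)$ define the kinetic energy and the dissipation, with values in $[0,\infty]$, by $$\mathcal E(f)=\tfrac12\int_{\mathbb R} v^2\,df(v),\qquad \mathcal D(f)=\iint_\Omega |v-v_*|^2\sigma_e(|v-v_*|)\,d(f\otimes f)(v,v_*).$$ For $T>0$ and $\mu_0,\mu_T\in\mathcal P(\mathbb R)$ let $\mathrm{GCE}_T(\mu_0,\mu_T)$ be the set of pairs of families $f_t\in\mathcal P(\mathbb R)$, $U_t\in\mathcal M(\Omega)$, $t\in[0,T]$, measurable in $t$ for the weak-$*$ topology, with $t\mapsto f_t$ narrowly continuous, $f_0=\mu_0$, $f_T=\mu_T$,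 $\int_0^T\iint_\Omega\sigma_e(|v-v_*|)\,d|U_t|\,dt<\infty$, and $$\int_0^T\!\int_{\mathbb R}\partial_t\varphi_t(v)\,df_t(v)\,dt+\int_0^T\!\iint_\Omega \sigma_e(|v-v_*|)\,\bigl(\varphi_t'(v_*)-\varphi_t'(v)\bigr)\,dU_t(v,v_*)\,dt=0\qquad\text{for all }\varphi\in C^1_c((0,T)\times\mathbb R).$$ The action density is $$\mathcal A(f,U)=\iint_\Omega\alpha\Bigl(\frac{d(f\otimes f)}{d|\lambda|},\frac{dU}{d|\lambda|}\Bigr)\sigma_e(|v-v_*|)\,d|\lambda|,\qquad |\lambda|=f\otimes f+|U|,$$ where $\alpha(s,u)=u^2/s$ if $s>0$, $\alpha(0,0)=0$ and $\alpha(0,u)=+\infty$ if $u\neq0$. The collision transportation cost $d_{\mathcal A}(\mu_0,\mu_1)\in[0,\infty]$ is defined by $$d_{\mathcal A}(\mu_0,\mu_1)^2=\inf\Bigl\{\int_0^1\mathcal A(f_t,U_t)\,dt:(f,U)\in\mathrm{GCE}_1(\mu_0,\mu_1)\Bigr\},\qquad \inf\emptyset=+\infty.$$ Let $T>0$ and $1\le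 p\le\infty$, and let $f:[0,T]\to\mathcal P(\mathbb R)$ be $p$-absolutely continuous with respect to $d_{\mathcal A}$, i.e. there is a nonnegative $m\in L^p(0,T)$ with $d_{\mathcal A}(f_s,f_t)\le\int_s^t m(r)\,dr$ for all $0\le s\le t\le T$. Suppose that $f_0\in\mathcal P_2^{\mathrm{cm}}(\mathbb R)$. Then the metric derivative $|f'|(t)=\lim_{h\to0}d_{\mathcal A}(f_{t+h},f_t)/|h|$ exists for almost every $t\in(0,T)$, the function $r\mapsto\mathcal D(f_r)^{1/2}$ is Borel on $[0,T]$, and $$|\mathcal E(f_t)-\mathcal E(f_s)|\le\int_s^t\mathcal D(f_r)^{1/2}\,|f'|(r)\,dr\qquad\text{for all }0\le s\le t\le T .$$ Both sides take values in $[0,\infty]$, and the inequality means that $\mathcal E(f_t)\le\mathcal E(f_s)+\int_s^t\mathcal D(f_r)^{1/2}|f'|(r)\,dr$ and $\mathcal E(f_s)\le\mathcal E(f_t)+\int_s^t\mathcal D(f_r)^{1/2}|f'|(r)\,dr$ (with $0\cdot\infty=0$ under the integral). In other words, $\mathcal D^{1/2}$ is a strong upper gradient for the kinetic energy with respect to $d_{\mathcal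 A}$. -/

import Mathlib

open MeasureTheory Set Filter Topology
open scoped ENNReal NNReal ZeroAtInfty

noncomputable section

namespace CollisionMetric

/-- The edge set: pairs `(v, v_*)` of real velocities with `v ≠ v_*`. -/
abbrev OffDiag : Type := {p : ℝ × ℝ // p.1 ≠ p.2}

/-- The collision weight `σ_e(|v - v_*|) = (1 - e) / 4 * |v - v_*|`. -/
def sigma (e : ℝ) (p : OffDiag) : ℝ := (1 - e) / 4 * |p.1.1 - p.1.2|

/-- The measure `f ⊗ f` on the edge set. -/
def prodOffDiag (f : ProbabilityMeasure ℝ) : Measure OffDiag :=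
  ((f : Measure ℝ).prod (f : Measure ℝ)).comap Subtype.val

/-- The integral of a real function against a finite signed measure,
`∫ g dU = ∫ g dU⁺ - ∫ g dU⁻` with the Jordan decomposition `U = U⁺ - U⁻`. -/
def signedIntegral {X : Type*} [MeasurableSpace X] (U : SignedMeasure X) (g : X → ℝ) : ℝ :=
  ∫ x, g x ∂U.toJordanDecomposition.posPart - ∫ x, g x ∂U.toJordanDecomposition.negPart

/-- The kinetic energy `E(f) = 1/2 ∫ v² df(v)`, with values in `[0, ∞]`. -/
def energy (f : ProbabilityMeasure ℝ) : ℝ≥0∞ :=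
  2⁻¹ * ∫⁻ v, ENNReal.ofReal (v ^ 2) ∂(f : Measure ℝ)

/-- The dissipation `D(f) = ∬ |v - v_*|² σ_e(|v - v_*|) d(f ⊗ f)`, with values in `[0, ∞]`. -/
def dissipation (e : ℝ) (f : ProbabilityMeasure ℝ) : ℝ≥0∞ :=
  ∫⁻ p : OffDiag, ENNReal.ofReal (|p.1.1 - p.1.2| ^ 2 * sigma e p) ∂(prodOffDiag f)

/-- Probability measures with finite second moment and centre of mass zero. -/
def P2cm : Set (ProbabilityMeasure ℝ) :=
  {f | Integrable (fun v : ℝ => v ^ 2) (f : Measure ℝ) ∧ ∫ v, v ∂(f : Measure ℝ) = 0}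

/-- The function `α(s, u)`: `u² / s` if `s > 0`, `0` if `u = 0`, and `∞` if `u ≠ 0`, `s = 0`. -/
def alpha (s : ℝ≥0) (u : ℝ) : ℝ≥0∞ :=
  if u = 0 then 0 else if s = 0 then ⊤ else ENNReal.ofReal (u ^ 2 / s)

/-- The reference measure `|λ| = f ⊗ f + |U|` on the edge set. -/
def refMeasure (f : ProbabilityMeasure ℝ) (U : SignedMeasure OffDiag) : Measure OffDiag :=
  prodOffDiag f + U.totalVariation

/-- The action density
`A(f, U) = ∬ α(d(f ⊗ f)/d|λ|, dU/d|λ|) σ_e(|v - v_*|) d|λ|`. -/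
def action (e : ℝ) (f : ProbabilityMeasure ℝ) (U : SignedMeasure OffDiag) : ℝ≥0∞ :=
  ∫⁻ p : OffDiag,
    alpha ((prodOffDiag f).rnDeriv (refMeasure f U) p).toNNReal (U.rnDeriv (refMeasure f U) p)
      * ENNReal.ofReal (sigma e p) ∂(refMeasure f U)

/-- The nonlocal-local gradient `φ'(v_*) - φ'(v)`. -/
def nlGrad (φ : ℝ → ℝ) (p : OffDiag) : ℝ := deriv φ p.1.2 - deriv φ p.1.1

/-- Weak solutions `(f_t, U_t)`, `t ∈ [0, T]`, of the generalised continuity equation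
`∂_t f_t + ∇̃ · U_t = 0`. Measurability in time is with respect to the weak-* topology, that is,
tested against continuous functions vanishing at infinity (on the edge set, this includes vanishing
towards the diagonal). -/
structure IsGCESolution (e T : ℝ) (f : ℝ → ProbabilityMeasure ℝ)
    (U : ℝ → SignedMeasure OffDiag) : Prop where
  measurable_f : ∀ g : C₀(ℝ, ℝ), Measurable fun t : Icc (0 : ℝ) T => ∫ v, g v ∂(f t : Measure ℝ)
  measurable_U : ∀ g : C₀(OffDiag, ℝ), Measurable fun t : Icc (0 : ℝ) T => signedIntegral (U t) g
  integrability :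
    ∫⁻ t in Ioo (0 : ℝ) T, ∫⁻ p : OffDiag, ENNReal.ofReal (sigma e p) ∂(U t).totalVariation < ⊤
  weak_form : ∀ φ : ℝ × ℝ → ℝ, ContDiff ℝ 1 φ → HasCompactSupport φ →
    tsupport φ ⊆ Ioo (0 : ℝ) T ×ˢ univ →
    (∫ t in Ioo (0 : ℝ) T, ∫ v, deriv (fun r => φ (r, v)) t ∂(f t : Measure ℝ))
      + (∫ t in Ioo (0 : ℝ) T,
          signedIntegral (U t) (fun p => sigma e p * nlGrad (fun v => φ (t, v)) p)) = 0

/-- `GCE_T(μ₀, μ₁)`: weak solutions on `[0, T]` whose curve of measures is (represented by) a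
narrowly continuous curve which connects `μ₀` with `μ₁`. -/
structure GCE (e T : ℝ) (μ₀ μ₁ : ProbabilityMeasure ℝ) (f : ℝ → ProbabilityMeasure ℝ)
    (U : ℝ → SignedMeasure OffDiag) : Prop where
  sol : IsGCESolution e T f U
  cont : ContinuousOn f (Icc 0 T)
  left : f 0 = μ₀
  right : f T = μ₁

/-- The collision transportation cost
`d_A(μ₀, μ₁)² = inf { ∫₀¹ A(f_t, U_t) dt : (f, U) ∈ GCE_1(μ₀, μ₁) }`, with values in `[0, ∞]`. -/
def dA (e : ℝ) (μ₀ μ₁ : ProbabilityMeasure ℝ) : ℝ≥0∞ :=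
  (⨅ (f : ℝ → ProbabilityMeasure ℝ) (U : ℝ → SignedMeasure OffDiag) (_ : GCE e 1 μ₀ μ₁ f U),
    ∫⁻ t in Ioo (0 : ℝ) 1, action e (f t) (U t)) ^ (1 / 2 : ℝ)

/-- `p`-absolute continuity on `[0, T]` of a curve with respect to an extended distance `d`. -/
def IsAbsCont {X : Type*} (d : X → X → ℝ≥0∞) (p : ℝ≥0∞) (T : ℝ) (f : ℝ → X) : Prop :=
  ∃ m : ℝ → ℝ, (∀ t, 0 ≤ m t) ∧ MemLp m p (volume.restrict (Icc 0 T)) ∧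
    ∀ s t, 0 ≤ s → s ≤ t → t ≤ T → d (f s) (f t) ≤ ENNReal.ofReal (∫ r in s..t, m r)

/-- The difference quotient `d(f_{t+h}, f_t) / |h|`. -/
def diffQuot {X : Type*} (d : X → X → ℝ≥0∞) (f : ℝ → X) (t h : ℝ) : ℝ≥0∞ :=
  d (f (t + h)) (f t) / ENNReal.ofReal |h|

/-- The metric derivative `|f'|(t)`: the limit of the difference quotients as `h → 0`
(written as an upper limit, so that it has a value also where the limit does not exist). -/
def metricDeriv {X : Type*} (d : X → X → ℝ≥0∞) (f : ℝ → X) (t : ℝ) : ℝ≥0∞ :=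
  limsup (diffQuot d f t) (𝓝[≠] 0)

end CollisionMetric

end

/-! Formally, along a solution of the continuity equation, the energy changes at rate ∬ (v_* - v) σ
dU. Cauchy–Schwarz against the action density bounds this by the square root of `dissipation` times
the square root of the action. The difficulty is that v²/2 is not an admissible test function and
that nothing is known in advance about second moments or about continuity of the dissipation.

The remedy is to replace v²/2 by `truncEnergy r`, which has linear growth and whose derivative
`truncId r` is bounded, increasing and 1-Lipschitz. Only first moments, measured by `bracket`, then
have to be propagated. Along a path of total action at most c² they are controlled by the initial
moment and c (`IsRegularSol.integral_bracket_le`). For a test function ψ with bounded derivative,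
the weak formulation with boundary values (`IsRegularSol.boundary_formula`) and Young's inequality
for the action (`lintegral_totalVariation_le_action`) give |∫ψ df_1 - ∫ψ df_0| ≤ k c whenever k²
bounds `gradEnergy` of ψ along the path. Near-optimal paths turn this into an estimate by `dA`; no
minimiser is needed.

For ψ = `truncEnergy r` the quantity `gradEnergy` is the truncated dissipation, and this varies by
O(`dA`) because its integrand is C¹ in each variable with controlled derivative
(`abs_deriv_pairEnergy_le`). Hence the truncated energies of μ and ν differ by at most √(D_r(μ) +
O(d)) · d with d = `dA e μ ν`. Dividing by |h| along the curve bounds the derivative of the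
truncated energy by √D_r |f'| (`abs_deriv_truncEnergy_curve_le`). The truncated energy is absolutely
continuous in time, so this integrates. Since D_r ≤ D, the right-hand side no longer depends on r,
and Fatou's lemma on the left recovers the full energy.

Existence of the metric derivative uses only that `dA` is symmetric and satisfies the triangle
inequality, by time reversal and concatenation of paths; the classical argument with countably many
distance functions then applies (`ae_tendsto_diffQuot`). Borel measurability of the dissipation
holds because it is a liminf of truncated dissipations that are continuous in time. -/

namespace CollisionMetric

/-! ### Signed measures, the function α, and Young's inequality for the action -/

section SignedMeasures

variable {X : Type*} [MeasurableSpace X]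

instance isFiniteMeasure_totalVariation (U : SignedMeasure X) :
    IsFiniteMeasure U.totalVariation := by
  unfold SignedMeasure.totalVariation
  infer_instance

lemma enorm_signedIntegral_le (U : SignedMeasure X) (g : X → ℝ) :
    ‖signedIntegral U g‖ₑ ≤ ∫⁻ x, ‖g x‖ₑ ∂U.totalVariation := by
  unfold signedIntegral SignedMeasure.totalVariation
  rw [lintegral_add_measure]
  exact enorm_sub_le.trans
    (add_le_add (enorm_integral_le_lintegral_enorm _) (enorm_integral_le_lintegral_enorm _))

lemma signedIntegral_smul (c : ℝ) (U : SignedMeasure X) (g : X → ℝ) :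
    signedIntegral (c • U) g = c * signedIntegral U g := by
  unfold signedIntegral
  rw [SignedMeasure.toJordanDecomposition_smul_real]
  rcases le_or_gt 0 c with hc | hc
  · rw [JordanDecomposition.real_smul_posPart_nonneg _ _ hc,
      JordanDecomposition.real_smul_negPart_nonneg _ _ hc, integral_smul_nnreal_measure,
      integral_smul_nnreal_measure]
    simp only [NNReal.smul_def, Real.coe_toNNReal _ hc, smul_eq_mul]
    ring
  · rw [JordanDecomposition.real_smul_posPart_neg _ _ hc,
      JordanDecomposition.real_smul_negPart_neg _ _ hc, integral_smul_nnreal_measure,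
      integral_smul_nnreal_measure]
    simp only [NNReal.smul_def, Real.coe_toNNReal _ (neg_nonneg.2 hc.le), smul_eq_mul]
    ring

lemma totalVariation_smul (c : ℝ) (U : SignedMeasure X) :
    (c • U).totalVariation = ‖c‖₊ • U.totalVariation := by
  unfold SignedMeasure.totalVariation
  rw [SignedMeasure.toJordanDecomposition_smul_real]
  rcases le_or_gt 0 c with hc | hc
  · rw [JordanDecomposition.real_smul_posPart_nonneg _ _ hc,
      JordanDecomposition.real_smul_negPart_nonneg _ _ hc, ← smul_add,
      Real.toNNReal_eq_nnnorm_of_nonneg hc]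
  · rw [JordanDecomposition.real_smul_posPart_neg _ _ hc,
      JordanDecomposition.real_smul_negPart_neg _ _ hc, ← smul_add,
      Real.toNNReal_eq_nnnorm_of_nonneg (neg_nonneg.2 hc.le), nnnorm_neg, add_comm]

lemma lintegral_totalVariation_smul (c : ℝ) (U : SignedMeasure X) (g : X → ℝ≥0∞) :
    ∫⁻ x, g x ∂(c • U).totalVariation = ‖c‖ₑ * ∫⁻ x, g x ∂U.totalVariation := by
  rw [totalVariation_smul, lintegral_smul_measure]
  rfl

lemma measurable_alpha : Measurable fun z : ℝ≥0 × ℝ => alpha z.1 z.2 := by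
  unfold alpha
  refine Measurable.ite (measurable_snd (measurableSet_singleton 0)) measurable_const
    (Measurable.ite (measurable_fst (measurableSet_singleton 0)) measurable_const ?_)
  fun_prop

/-- In the nondegenerate case this is the square (δ s |w| - |u|)² ≥ 0 divided by 2δs. The parameter
δ stays free so that it can be optimised after integration in time. -/
lemma young_alpha (s : ℝ≥0) (u w δ : ℝ) (hδ : 0 < δ) :
    ENNReal.ofReal |u| * ‖w‖ₑ ≤
      ENNReal.ofReal (δ / 2) * (s * ENNReal.ofReal (w ^ 2)) +
        ENNReal.ofReal (1 / (2 * δ)) * alpha s u := by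
  unfold alpha
  split_ifs with hu hs
  · simp [hu]
  · rw [ENNReal.mul_top (by simpa using hδ)]
    simp
  · have hs' : (0 : ℝ) < s := by positivity
    rw [Real.enorm_eq_ofReal_abs, ← ENNReal.ofReal_coe_nnreal,
      ← ENNReal.ofReal_mul (abs_nonneg _), ← ENNReal.ofReal_mul hs'.le,
      ← ENNReal.ofReal_mul (by positivity), ← ENNReal.ofReal_mul (by positivity),
      ← ENNReal.ofReal_add (by positivity) (by positivity)]
    apply ENNReal.ofReal_le_ofReal
    have h : 0 ≤ (δ * s * |w| - |u|) ^ 2 / (2 * δ * s) := by positivity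
    have e : (δ * s * |w| - |u|) ^ 2 / (2 * δ * s) =
        δ / 2 * (s * |w| ^ 2) + 1 / (2 * δ) * (|u| ^ 2 / s) - |u| * |w| := by
      field_simp
      ring
    rw [e, sq_abs, sq_abs] at h
    linarith

/-- Joint homogeneity of degree one in (s, u) makes the action independent of the reference measure,
k being the ratio of two reference densities. Homogeneity of degree two in u gives the scaling in
the flux. -/
lemma alpha_mul (s k : ℝ≥0) (u c : ℝ) (hc : c ≠ 0) :
    alpha (s * k) (c * (u * k)) = ENNReal.ofReal (c ^ 2) * (k * alpha s u) := by
  unfold alpha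
  rcases eq_or_ne k 0 with rfl | hk
  · simp
  rcases eq_or_ne u 0 with rfl | hu
  · simp
  rcases eq_or_ne s 0 with rfl | hs
  · simp [hu, hc, hk, ENNReal.mul_top]
  · simp only [mul_eq_zero, hc, hu, hs, hk, NNReal.coe_eq_zero, or_self, if_false]
    rw [← ENNReal.ofReal_coe_nnreal, ← ENNReal.ofReal_mul (by positivity),
      ← ENNReal.ofReal_mul (by positivity)]
    congr 1
    push_cast
    have : (0 : ℝ) < s := by positivity
    have : (0 : ℝ) < k := by positivity
    field_simp

section Action

variable (μ : Measure X) (U : SignedMeasure X)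

lemma posPart_ac : U.toJordanDecomposition.posPart ≪ μ + U.totalVariation :=
  Measure.absolutelyContinuous_of_le
    ((Measure.le_add_right le_rfl).trans (Measure.le_add_left le_rfl))

lemma negPart_ac : U.toJordanDecomposition.negPart ≪ μ + U.totalVariation :=
  Measure.absolutelyContinuous_of_le
    ((Measure.le_add_left le_rfl).trans (Measure.le_add_left le_rfl))

/-- The two Jordan parts live on complementary sets, so their densities cannot both be nonzero.
Consequently the absolute value of the signed density is the sum of the two densities. -/
lemma rnDeriv_posPart_negPart (ν : Measure X) [IsFiniteMeasure ν] :
    ∀ᵐ x ∂ν, U.toJordanDecomposition.posPart.rnDeriv ν x = 0 ∨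
      U.toJordanDecomposition.negPart.rnDeriv ν x = 0 := by
  obtain ⟨S, hS, h1, h2⟩ := U.toJordanDecomposition.mutuallySingular
  have a1 : ∀ᵐ x ∂ν, x ∈ S → U.toJordanDecomposition.posPart.rnDeriv ν x = 0 := by
    rw [← ae_restrict_iff' hS]
    refine (lintegral_eq_zero_iff (Measure.measurable_rnDeriv _ _)).1 ?_
    exact le_antisymm ((Measure.setLIntegral_rnDeriv_le S).trans h1.le) zero_le
  have a2 : ∀ᵐ x ∂ν, x ∈ Sᶜ → U.toJordanDecomposition.negPart.rnDeriv ν x = 0 := by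
    rw [← ae_restrict_iff' hS.compl]
    refine (lintegral_eq_zero_iff (Measure.measurable_rnDeriv _ _)).1 ?_
    exact le_antisymm ((Measure.setLIntegral_rnDeriv_le Sᶜ).trans h2.le) zero_le
  filter_upwards [a1, a2] with x h1 h2
  by_cases hx : x ∈ S
  · exact Or.inl (h1 hx)
  · exact Or.inr (h2 hx)

variable [IsFiniteMeasure μ]

/-- Young's inequality for the flux against the action density. -/
lemma lintegral_totalVariation_le_action {w σ : X → ℝ} (hw : Measurable w) (hσ : Measurable σ)
    {δ : ℝ} (hδ : 0 < δ) :
    ∫⁻ x, ‖w x‖ₑ * ENNReal.ofReal (σ x) ∂U.totalVariation ≤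
      ENNReal.ofReal (δ / 2) * ∫⁻ x, ENNReal.ofReal (w x ^ 2) * ENNReal.ofReal (σ x) ∂μ +
      ENNReal.ofReal (1 / (2 * δ)) * ∫⁻ x, alpha (μ.rnDeriv (μ + U.totalVariation) x).toNNReal
        (U.rnDeriv (μ + U.totalVariation) x) * ENNReal.ofReal (σ x) ∂(μ + U.totalVariation) := by
  set l := μ + U.totalVariation with hl
  have hμ : μ ≪ l := Measure.absolutelyContinuous_of_le (Measure.le_add_right le_rfl)
  have e1 : ∫⁻ x, ‖w x‖ₑ * ENNReal.ofReal (σ x) ∂U.totalVariation =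
      ∫⁻ x, (U.toJordanDecomposition.posPart.rnDeriv l x +
        U.toJordanDecomposition.negPart.rnDeriv l x) * (‖w x‖ₑ * ENNReal.ofReal (σ x)) ∂l := by
    simp only [add_mul]
    rw [lintegral_add_left (by fun_prop), lintegral_rnDeriv_mul (posPart_ac μ U) (by fun_prop),
      lintegral_rnDeriv_mul (negPart_ac μ U) (by fun_prop), ← lintegral_add_measure]
    rfl
  rw [e1, ← lintegral_rnDeriv_mul hμ (by fun_prop), ← lintegral_const_mul _ (by fun_prop),
    ← lintegral_const_mul' _ _ (by simp), ← lintegral_add_left (by fun_prop)]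
  apply lintegral_mono_ae
  filter_upwards [rnDeriv_posPart_negPart U l,
    Measure.rnDeriv_lt_top U.toJordanDecomposition.posPart l,
    Measure.rnDeriv_lt_top U.toJordanDecomposition.negPart l, Measure.rnDeriv_lt_top μ l]
    with x h0 h1 h2 h3
  have key := young_alpha (μ.rnDeriv l x).toNNReal (U.rnDeriv l x) (w x) δ hδ
  rw [ENNReal.coe_toNNReal h3.ne] at key
  have e2 : U.toJordanDecomposition.posPart.rnDeriv l x +
      U.toJordanDecomposition.negPart.rnDeriv l x = ENNReal.ofReal |U.rnDeriv l x| := by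
    rw [SignedMeasure.rnDeriv_def]
    rcases h0 with h0 | h0
    · simp [h0, ENNReal.ofReal_toReal h2.ne]
    · simp [h0, ENNReal.ofReal_toReal h1.ne]
  rw [e2, ← mul_assoc]
  refine (mul_le_mul_left key (ENNReal.ofReal (σ x))).trans (le_of_eq ?_)
  ring

/-- Scaling the flux also changes the reference measure. Since c ≠ 0, the old one is absolutely
continuous with respect to the new one; the chain rule for densities and the homogeneity in
`alpha_mul` absorb the change. -/
lemma lintegral_alpha_smul {σ : X → ℝ} (hσ : Measurable σ) {c : ℝ} (hc : c ≠ 0) :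
    ∫⁻ x, alpha (μ.rnDeriv (μ + (c • U).totalVariation) x).toNNReal
        ((c • U).rnDeriv (μ + (c • U).totalVariation) x) * ENNReal.ofReal (σ x)
          ∂(μ + (c • U).totalVariation) =
      ENNReal.ofReal (c ^ 2) * ∫⁻ x, alpha (μ.rnDeriv (μ + U.totalVariation) x).toNNReal
        (U.rnDeriv (μ + U.totalVariation) x) * ENNReal.ofReal (σ x) ∂(μ + U.totalVariation) := by
  set l := μ + U.totalVariation with hl
  set l' := μ + (c • U).totalVariation with hl'
  have hμ : μ ≪ l := Measure.absolutelyContinuous_of_le (Measure.le_add_right le_rfl)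
  have hc' : ‖c‖₊ ≠ 0 := by simpa using hc
  have hll : l ≪ l' := by
    refine Measure.AbsolutelyContinuous.add_left (Measure.absolutelyContinuous_of_le
      (Measure.le_add_right le_rfl)) ?_
    rw [hl', totalVariation_smul]
    have h1 : U.totalVariation ≪ ‖c‖₊ • U.totalVariation := by
      have := (Measure.absolutelyContinuous_smul (μ := U.totalVariation)
        (c := (‖c‖₊ : ℝ≥0∞)) (by simpa using hc))
      exact this
    exact h1.trans (Measure.absolutelyContinuous_of_le (Measure.le_add_left le_rfl))
  rw [← lintegral_rnDeriv_mul hll]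
  · rw [← lintegral_const_mul' _ _ (by simp)]
    apply lintegral_congr_ae
    filter_upwards [Measure.rnDeriv_mul_rnDeriv (κ := l') hμ,
      Measure.rnDeriv_mul_rnDeriv (κ := l') (posPart_ac μ U),
      Measure.rnDeriv_mul_rnDeriv (κ := l') (negPart_ac μ U),
      SignedMeasure.rnDeriv_smul U l' c, Measure.rnDeriv_lt_top l l'] with x h1 h2 h3 h4 h5
    simp only [Pi.mul_apply, ← hl] at h1 h2 h3
    have e1 : (c • U).rnDeriv l' x = c * (U.rnDeriv l x * (l.rnDeriv l' x).toNNReal) := by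
      rw [h4, Pi.smul_apply, smul_eq_mul, SignedMeasure.rnDeriv_def, SignedMeasure.rnDeriv_def]
      simp only [← h2, ← h3, ENNReal.toReal_mul, ENNReal.coe_toNNReal_eq_toReal]
      ring
    rw [e1, ← h1, ENNReal.toNNReal_mul, alpha_mul _ _ _ _ hc, ENNReal.coe_toNNReal h5.ne]
    ring
  · refine ((measurable_alpha.comp (Measurable.prodMk ?_ ?_)).mul (by fun_prop)).aemeasurable
    · exact (Measure.measurable_rnDeriv _ _).ennreal_toNNReal
    · exact SignedMeasure.measurable_rnDeriv _ _

end Action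

end SignedMeasures

/-! ### The collision weight and the edge set -/

section Sigma

lemma measurable_sigma (e : ℝ) : Measurable (sigma e) := by
  unfold sigma
  fun_prop

lemma sigma_nonneg {e : ℝ} (he1 : e < 1) (p : OffDiag) : 0 ≤ sigma e p := by
  unfold sigma
  have : 0 < 1 - e := by linarith
  positivity

lemma measurableEmbedding_offDiag : MeasurableEmbedding (Subtype.val : OffDiag → ℝ × ℝ) :=
  MeasurableEmbedding.subtype_coe
    (measurableSet_eq_fun measurable_fst measurable_snd).compl

instance (f : ProbabilityMeasure ℝ) : IsFiniteMeasure (prodOffDiag f) := by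
  unfold prodOffDiag
  refine ⟨?_⟩
  rw [measurableEmbedding_offDiag.comap_apply]
  exact measure_lt_top _ _

instance : LocallyCompactSpace OffDiag :=
  (isOpen_ne_fun continuous_fst continuous_snd).locallyCompactSpace

lemma action_smul (e : ℝ) (f : ProbabilityMeasure ℝ) (U : SignedMeasure OffDiag) {c : ℝ}
    (hc : c ≠ 0) : action e f (c • U) = ENNReal.ofReal (c ^ 2) * action e f U :=
  lintegral_alpha_smul _ U (measurable_sigma e) hc

lemma lintegral_flux_le_action (e : ℝ) (f : ProbabilityMeasure ℝ) (U : SignedMeasure OffDiag)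
    {w : OffDiag → ℝ} (hw : Measurable w) {δ : ℝ} (hδ : 0 < δ) :
    ∫⁻ p, ‖w p‖ₑ * ENNReal.ofReal (sigma e p) ∂U.totalVariation ≤
      ENNReal.ofReal (δ / 2) *
        ∫⁻ p, ENNReal.ofReal (w p ^ 2) * ENNReal.ofReal (sigma e p) ∂(prodOffDiag f) +
      ENNReal.ofReal (1 / (2 * δ)) * action e f U :=
  lintegral_totalVariation_le_action _ U hw (measurable_sigma e) hδ

/-- Integrals over the edge set of functions vanishing on the diagonal. -/
lemma lintegral_prodOffDiag (f : ProbabilityMeasure ℝ) {F : ℝ × ℝ → ℝ≥0∞}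
    (hF : ∀ v, F (v, v) = 0) :
    ∫⁻ p : OffDiag, F p.1 ∂(prodOffDiag f) =
      ∫⁻ z, F z ∂((f : Measure ℝ).prod (f : Measure ℝ)) := by
  unfold prodOffDiag
  rw [← measurableEmbedding_offDiag.lintegral_map (fun z => F z),
    measurableEmbedding_offDiag.map_comap, Subtype.range_coe_subtype,
    ← lintegral_indicator (s := {z : ℝ × ℝ | z.1 ≠ z.2})
      (measurableSet_eq_fun measurable_fst measurable_snd).compl]
  congr 1
  ext ⟨v, w⟩
  by_cases h : v = w
  · simp [h, hF]
  · simp [h]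

end Sigma

/-! ### Measurability of weak-* measurable families of signed measures -/

section MeasurableFamilies

open ProbabilityTheory BoundedContinuousFunction
open scoped symmDiff

variable {α X : Type*} [MeasurableSpace α]

/-- The masses need not be uniformly bounded. Dividing by 1 + mass gives a finite kernel, from which
the original is recovered by a finite density. -/
lemma isSFiniteKernel_of_isFiniteMeasure [MeasurableSpace X] (κ : Kernel α X)
    (h : ∀ a, IsFiniteMeasure (κ a)) : IsSFiniteKernel κ := by
  have hm : Measurable fun a => 1 + κ a univ := (κ.measurable_coe MeasurableSet.univ).const_add 1
  have hne : ∀ a, 1 + κ a univ ≠ ⊤ := fun a => by simp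
  have hne0 : ∀ a, 1 + κ a univ ≠ 0 := fun a => by simp
  let κ' : Kernel α X := ⟨fun a => (1 + κ a univ)⁻¹ • κ a, by
    refine Measure.measurable_of_measurable_coe _ fun s hs => ?_
    simp only [Measure.smul_apply, smul_eq_mul]
    exact hm.inv.mul (κ.measurable_coe hs)⟩
  have hκ' : ∀ a, κ' a = (1 + κ a univ)⁻¹ • κ a := fun a => rfl
  have : IsFiniteKernel κ' := by
    refine ⟨1, ENNReal.one_lt_top, fun a => ?_⟩
    rw [hκ', Measure.smul_apply, smul_eq_mul, mul_comm, ← div_eq_mul_inv]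
    exact ENNReal.div_le_of_le_mul (by simp)
  have e : κ = κ'.withDensity fun a _ => 1 + κ a univ := by
    ext1 a
    rw [Kernel.withDensity_apply _ (by exact hm.comp measurable_fst), withDensity_const, hκ',
      smul_smul, ENNReal.mul_inv_cancel (hne0 a) (hne a), one_smul]
  rw [e]
  exact Kernel.IsSFiniteKernel.withDensity _ fun a _ => hne a

lemma signedIntegral_indicator_one [MeasurableSpace X] (U : SignedMeasure X) {A : Set X}
    (hA : MeasurableSet A) : signedIntegral U (A.indicator 1) = U A := by
  unfold signedIntegral
  rw [integral_indicator_one hA, integral_indicator_one hA,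
    SignedMeasure.apply_eq_posPart_real_sub_negPart_real U hA]

lemma tendsto_signedIntegral [MeasurableSpace X] (U : SignedMeasure X) {F : ℕ → X → ℝ} {g : X → ℝ}
    (b : X → ℝ) (hF : ∀ n, Measurable (F n)) (hb : Integrable b U.totalVariation)
    (hFb : ∀ n x, |F n x| ≤ b x) (hlim : ∀ x, Tendsto (fun n => F n x) atTop (𝓝 (g x))) :
    Tendsto (fun n => signedIntegral U (F n)) atTop (𝓝 (signedIntegral U g)) := by
  unfold SignedMeasure.totalVariation at hb
  refine Tendsto.sub ?_ ?_
  · exact tendsto_integral_of_dominated_convergence b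
      (fun n => (hF n).aestronglyMeasurable) (hb.mono_measure (Measure.le_add_right le_rfl))
      (fun n => ae_of_all _ (hFb n)) (ae_of_all _ hlim)
  · exact tendsto_integral_of_dominated_convergence b
      (fun n => (hF n).aestronglyMeasurable) (hb.mono_measure (Measure.le_add_left le_rfl))
      (fun n => ae_of_all _ (hFb n)) (ae_of_all _ hlim)

/-- U⁺ is concentrated on the Hahn set Sᶜ. Approximating Sᶜ by B ∈ 𝒜 in total variation makes U (A ∩
B) nearly U⁺(A). With 𝒜 countable, this writes the positive part as a countable supremum of setwise
values of U, hence measurable in a parameter. -/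
lemma posPart_eq_iSup [MeasurableSpace X] (U : SignedMeasure X) {𝒜 : Set (Set X)}
    (h𝒜 : ∀ μ : Measure X, IsFiniteMeasure μ → μ.MeasureDense 𝒜) {A : Set X}
    (hA : MeasurableSet A) :
    U.toJordanDecomposition.posPart A = ⨆ B ∈ 𝒜, ENNReal.ofReal (U (A ∩ B)) := by
  set P := U.toJordanDecomposition.posPart
  set N := U.toJordanDecomposition.negPart
  have hd := h𝒜 U.totalVariation inferInstance
  obtain ⟨S, hS, h1, h2⟩ := U.toJordanDecomposition.mutuallySingular
  apply le_antisymm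
  · refine ENNReal.le_of_forall_pos_le_add fun ε hε _ => ?_
    obtain ⟨B, hB, hBε⟩ := hd.approx Sᶜ hS.compl (measure_ne_top _ _) (ε : ℝ) hε
    have hBm := hd.measurable B hB
    refine le_trans ?_ (add_le_add_left (le_iSup₂_of_le B hB le_rfl) _)
    have hsd : U.totalVariation ((Sᶜ) ∆ B) = P (Sᶜ ∆ B) + N (Sᶜ ∆ B) := rfl
    rw [hsd] at hBε
    have hP : P A ≤ P (A ∩ B) + P (Sᶜ ∆ B) := by
      calc P A ≤ P ((A ∩ B) ∪ (Sᶜ ∆ B) ∪ S) := by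
            refine measure_mono fun x hx => ?_
            by_cases hxB : x ∈ B
            · exact Or.inl (Or.inl ⟨hx, hxB⟩)
            · by_cases hxS : x ∈ S
              · exact Or.inr hxS
              · exact Or.inl (Or.inr (Or.inl ⟨hxS, hxB⟩))
        _ ≤ P (A ∩ B) + P (Sᶜ ∆ B) + P S :=
            (measure_union_le _ _).trans (add_le_add_left (measure_union_le _ _) _)
        _ = _ := by rw [h1, add_zero]
    have hN : N (A ∩ B) ≤ N (Sᶜ ∆ B) := by
      calc N (A ∩ B) ≤ N ((Sᶜ ∆ B) ∪ Sᶜ) := by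
            refine measure_mono fun x hx => ?_
            by_cases hxS : x ∈ S
            · exact Or.inl (Or.inr ⟨hx.2, fun h => h hxS⟩)
            · exact Or.inr hxS
        _ ≤ N (Sᶜ ∆ B) + N Sᶜ := measure_union_le _ _
        _ = _ := by rw [h2, add_zero]
    rw [SignedMeasure.apply_eq_posPart_real_sub_negPart_real U (hA.inter hBm),
      ENNReal.ofReal_sub _ measureReal_nonneg, ofReal_measureReal, ofReal_measureReal]
    change P A ≤ P (A ∩ B) - N (A ∩ B) + ε
    rw [ENNReal.ofReal_coe_nnreal] at hBε
    calc P A ≤ P (A ∩ B) + P (Sᶜ ∆ B) := hP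
      _ ≤ (P (A ∩ B) - N (A ∩ B) + N (A ∩ B)) + P (Sᶜ ∆ B) := by
          gcongr
          exact le_tsub_add
      _ ≤ (P (A ∩ B) - N (A ∩ B) + N (Sᶜ ∆ B)) + P (Sᶜ ∆ B) := by gcongr
      _ = P (A ∩ B) - N (A ∩ B) + (P (Sᶜ ∆ B) + N (Sᶜ ∆ B)) := by ring
      _ ≤ _ := by gcongr
  · refine iSup₂_le fun B hB => ?_
    rw [SignedMeasure.apply_eq_posPart_real_sub_negPart_real U (hA.inter (hd.measurable B hB)),
      ENNReal.ofReal_sub _ measureReal_nonneg, ofReal_measureReal, ofReal_measureReal]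
    exact tsub_le_self.trans (measure_mono inter_subset_left)

lemma measurable_posPart [MeasurableSpace X] [MeasurableSpace.CountablyGenerated X]
    {U : α → SignedMeasure X} (h : ∀ A, MeasurableSet A → Measurable fun a => U a A) :
    Measurable fun a => (U a).toJordanDecomposition.posPart := by
  refine Measure.measurable_of_measurable_coe _ fun A hA => ?_
  set 𝒜 := generateSetAlgebra (MeasurableSpace.countableGeneratingSet X)
  have hc : 𝒜.Countable :=
    countable_generateSetAlgebra MeasurableSpace.countable_countableGeneratingSet
  have hd : ∀ μ : Measure X, IsFiniteMeasure μ → μ.MeasureDense 𝒜 := fun μ _ =>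
    Measure.MeasureDense.of_generateFrom_isSetAlgebra_finite μ isSetAlgebra_generateSetAlgebra
      (by rw [generateFrom_generateSetAlgebra_eq,
        MeasurableSpace.generateFrom_countableGeneratingSet])
  simp only [fun a => posPart_eq_iSup (U a) hd hA]
  refine Measurable.biSup 𝒜 hc fun B hB => ?_
  exact (h _ (hA.inter ((hd 0 inferInstance).measurable B hB))).ennreal_ofReal

lemma measurable_negPart [MeasurableSpace X] [MeasurableSpace.CountablyGenerated X]
    {U : α → SignedMeasure X} (h : ∀ A, MeasurableSet A → Measurable fun a => U a A) :
    Measurable fun a => (U a).toJordanDecomposition.negPart := by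
  have := measurable_posPart (U := fun a => - U a) fun A hA => (h A hA).neg
  simpa [SignedMeasure.toJordanDecomposition_neg] using this

variable [TopologicalSpace X] [R1Space X] [LocallyCompactSpace X] [SigmaCompactSpace X]
  [HasOuterApproxClosed X] [MeasurableSpace X] [BorelSpace X]

/-- A weak-* measurable family of signed measures is setwise measurable. -/
lemma measurable_apply_of_zeroAtInfty {U : α → SignedMeasure X}
    (hU : ∀ g : C₀(X, ℝ), Measurable fun a => signedIntegral (U a) g) (A : Set X)
    (hA : MeasurableSet A) : Measurable fun a => U a A := by
  let K := CompactExhaustion.choice X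
  choose χ hχ1 hχ2 hχ3 hχ4 using fun n => exists_continuousMap_one_of_isCompact_subset_isOpen
    (K.isCompact n) isOpen_univ (subset_univ _)
  -- Cutoffs equal to one on an exhaustion by compacts reduce bounded continuous functions to C₀;
  -- the dominating constant ‖g‖ is integrable because the total variation is finite.
  have hbc : ∀ g : X →ᵇ ℝ, Measurable fun a => signedIntegral (U a) g := by
    intro g
    have hcs : ∀ n, HasCompactSupport fun x => g x * χ n x := fun n =>
      HasCompactSupport.mul_left (f := fun x => g x) (f' := fun x => χ n x) (hχ2 n)
    let G : ℕ → C₀(X, ℝ) := fun n =>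
      ⟨⟨fun x => g x * χ n x, by fun_prop⟩, (hcs n).is_zero_at_infty⟩
    refine measurable_of_tendsto_metrizable (fun n => hU (G n)) (tendsto_pi_nhds.2 fun a => ?_)
    refine tendsto_signedIntegral (U a) (fun _ => ‖g‖) (fun n => (G n).continuous.measurable)
      (integrable_const _) (fun n x => ?_) fun x => ?_
    · change |g x * χ n x| ≤ ‖g‖
      rw [abs_mul, abs_of_nonneg (hχ4 n x).1]
      calc |g x| * χ n x ≤ |g x| * 1 :=
            mul_le_mul_of_nonneg_left (hχ4 n x).2 (abs_nonneg _)
        _ ≤ ‖g‖ := by rw [mul_one]; exact g.norm_coe_le_norm x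
    · refine tendsto_const_nhds.congr' ?_
      obtain ⟨n, hn⟩ := K.exists_mem x
      filter_upwards [eventually_ge_atTop n] with m hm
      have : χ m x = 1 := hχ1 m (K.subset hm hn)
      change g x = g x * χ m x
      rw [this, mul_one]
  -- Indicators of closed sets are pointwise limits of continuous functions bounded by one. Closed
  -- sets form a π-system generating the Borel sets, so the π-λ theorem finishes.
  have hcl : ∀ F : Set X, IsClosed F → Measurable fun a => U a F := by
    intro F hF
    let G : ℕ → X →ᵇ ℝ := fun n => BoundedContinuousFunction.ofNormedAddCommGroup
      (fun x => (hF.apprSeq n x : ℝ)) (by fun_prop) 1 (fun x => by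
        simpa using HasOuterApproxClosed.apprSeq_apply_le_one hF n x)
    refine measurable_of_tendsto_metrizable (fun n => hbc (G n)) (tendsto_pi_nhds.2 fun a => ?_)
    rw [← signedIntegral_indicator_one (U a) hF.measurableSet]
    refine tendsto_signedIntegral (U a) (fun _ => 1) (fun n => (G n).continuous.measurable)
      (integrable_const _) (fun n x => ?_) fun x => ?_
    · change |(hF.apprSeq n x : ℝ)| ≤ 1
      simpa using HasOuterApproxClosed.apprSeq_apply_le_one hF n x
    · have := tendsto_pi_nhds.1 (HasOuterApproxClosed.tendsto_apprSeq hF) x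
      have h2 := (NNReal.tendsto_coe.2 this)
      have e : F.indicator (1 : X → ℝ) x = ((F.indicator (fun _ => (1 : ℝ≥0)) x : ℝ≥0) : ℝ) := by
        by_cases hx : x ∈ F <;> simp [hx]
      rw [e]
      exact h2
  have huniv : Measurable fun a => U a univ := hcl _ isClosed_univ
  have hgen := (BorelSpace.measurable_eq (α := X)).trans borel_eq_generateFrom_isClosed
  induction A, hA using MeasurableSpace.induction_on_inter (h_eq := hgen)
    (h_inter := isPiSystem_isClosed) with
  | empty => simp
  | basic t ht => exact hcl t ht
  | compl t ht ih =>
    simp only [fun a => VectorMeasure.of_compl (v := U a) ht]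
    exact huniv.sub ih
  | iUnion f hd hm ih =>
    refine measurable_of_tendsto_metrizable (f := fun n a => ∑ i ∈ Finset.range n, U a (f i))
      (fun n => Finset.measurable_fun_sum _ fun i _ => ih i) (tendsto_pi_nhds.2 fun a => ?_)
    exact ((U a).m_iUnion hm hd).tendsto_sum_nat

variable [MeasurableSpace.CountablyGenerated X]

/-- A weak-* measurable family of signed measures has jointly measurable integrals. -/
lemma measurable_signedIntegral {U : α → SignedMeasure X}
    (hU : ∀ g : C₀(X, ℝ), Measurable fun a => signedIntegral (U a) g) {ζ : α → X → ℝ}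
    (hζ : Measurable (Function.uncurry ζ)) : Measurable fun a => signedIntegral (U a) (ζ a) := by
  have hA := measurable_apply_of_zeroAtInfty hU
  let κ : Kernel α X := ⟨_, measurable_posPart hA⟩
  let η : Kernel α X := ⟨_, measurable_negPart hA⟩
  have : IsSFiniteKernel κ := isSFiniteKernel_of_isFiniteMeasure κ fun a =>
    inferInstanceAs (IsFiniteMeasure (U a).toJordanDecomposition.posPart)
  have : IsSFiniteKernel η := isSFiniteKernel_of_isFiniteMeasure η fun a =>
    inferInstanceAs (IsFiniteMeasure (U a).toJordanDecomposition.negPart)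
  exact (StronglyMeasurable.integral_kernel_prod_right (κ := κ) hζ.stronglyMeasurable).measurable.sub
    (StronglyMeasurable.integral_kernel_prod_right (κ := η) hζ.stronglyMeasurable).measurable

lemma measurable_totalVariation {U : α → SignedMeasure X}
    (hU : ∀ g : C₀(X, ℝ), Measurable fun a => signedIntegral (U a) g) :
    Measurable fun a => (U a).totalVariation := by
  have hA := measurable_apply_of_zeroAtInfty hU
  refine Measure.measurable_of_measurable_coe _ fun A hA' => ?_
  exact ((Measure.measurable_coe hA').comp (measurable_posPart hA)).add
    ((Measure.measurable_coe hA').comp (measurable_negPart hA))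

end MeasurableFamilies

/-! ### Smooth cutoffs in time and recovery of boundary values -/

section Cutoff

open Real (smoothTransition)

lemma contDiff_smoothTransition : ContDiff ℝ 1 smoothTransition :=
  Real.smoothTransition.contDiff (n := 1)

lemma continuous_deriv_smoothTransition : Continuous (deriv smoothTransition) :=
  contDiff_smoothTransition.continuous_deriv le_rfl

lemma deriv_smoothTransition_of_nonpos {x : ℝ} (hx : x ≤ 0) : deriv smoothTransition x = 0 := by
  have h : ∀ y < 0, deriv smoothTransition y = 0 := fun y hy => by
    have : smoothTransition =ᶠ[𝓝 y] fun _ => 0 := by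
      filter_upwards [Iio_mem_nhds hy] with z hz
      exact Real.smoothTransition.zero_of_nonpos (le_of_lt hz)
    rw [this.deriv_eq, deriv_const]
  have hc : closure (Iio (0 : ℝ)) ⊆ {y | deriv smoothTransition y = 0} :=
    closure_minimal h (isClosed_eq continuous_deriv_smoothTransition continuous_const)
  rw [closure_Iio] at hc
  exact hc hx

lemma deriv_smoothTransition_of_one_le {x : ℝ} (hx : 1 ≤ x) : deriv smoothTransition x = 0 := by
  have h : ∀ y ∈ Ioi (1 : ℝ), deriv smoothTransition y = 0 := fun y hy => by
    have : smoothTransition =ᶠ[𝓝 y] fun _ => 1 := by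
      filter_upwards [Ioi_mem_nhds hy] with z hz
      exact Real.smoothTransition.one_of_one_le (le_of_lt hz)
    rw [this.deriv_eq, deriv_const]
  have hc : closure (Ioi (1 : ℝ)) ⊆ {y | deriv smoothTransition y = 0} :=
    closure_minimal h (isClosed_eq continuous_deriv_smoothTransition continuous_const)
  rw [closure_Ioi] at hc
  exact hc hx

lemma integrable_deriv_smoothTransition : Integrable (deriv smoothTransition) := by
  refine continuous_deriv_smoothTransition.integrable_of_hasCompactSupport
    (HasCompactSupport.intro (isCompact_Icc (a := (0 : ℝ)) (b := 1)) fun x hx => ?_)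
  rcases le_or_gt x 0 with h | h
  · exact deriv_smoothTransition_of_nonpos h
  · exact deriv_smoothTransition_of_one_le (le_of_not_ge fun h1 => hx ⟨h.le, h1⟩)

lemma integral_deriv_smoothTransition : ∫ x, deriv smoothTransition x = 1 := by
  have h := integral_of_hasDerivAt_of_tendsto (f := smoothTransition) (m := 0) (n := 1)
    (fun x => ((contDiff_smoothTransition.differentiable one_ne_zero) x).hasDerivAt)
    integrable_deriv_smoothTransition
    (tendsto_const_nhds.congr' (by
      filter_upwards [eventually_le_atBot 0] with x hx
      exact (Real.smoothTransition.zero_of_nonpos hx).symm))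
    (tendsto_const_nhds.congr' (by
      filter_upwards [eventually_ge_atTop 1] with x hx
      exact (Real.smoothTransition.one_of_one_le hx).symm))
  simpa using h

lemma abs_smoothTransition_le_one (x : ℝ) : |smoothTransition x| ≤ 1 := by
  rw [abs_of_nonneg (Real.smoothTransition.nonneg x)]
  exact Real.smoothTransition.le_one x

lemma eventually_smoothTransition_eq_one {c d : ℝ} (hc : 0 < c) :
    ∀ᶠ n : ℕ in atTop, smoothTransition (n * c - d) = 1 := by
  have : Tendsto (fun n : ℕ => (n : ℝ) * c - d) atTop atTop :=
    tendsto_atTop_add_const_right _ (-d) (tendsto_natCast_atTop_atTop.atTop_mul_const hc)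
  filter_upwards [this.eventually_ge_atTop 1] with n hn
  exact Real.smoothTransition.one_of_one_le hn

/-- The differentiated factor has mass one and concentrates just to the right of a, so it acts as an
approximate identity; the other factor tends to one there. The substitution u = n (t - a) - 1
reduces this to dominated convergence. -/
lemma tendsto_integral_cutoff_left {a b : ℝ} (hab : a < b) {G : ℝ → ℝ} (hG : Continuous G)
    {C : ℝ} (hC : ∀ x, |G x| ≤ C) :
    Tendsto (fun n : ℕ => ∫ t, n * deriv smoothTransition (n * (t - a) - 1) *
      smoothTransition (n * (b - t) - 1) * G t) atTop (𝓝 (G a)) := by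
  have key : ∀ᶠ n : ℕ in atTop, ∫ u, deriv smoothTransition u *
      smoothTransition (n * (b - a) - (u + 2)) * G (a + (u + 1) / n) =
      ∫ t, n * deriv smoothTransition (n * (t - a) - 1) *
      smoothTransition (n * (b - t) - 1) * G t := by
    filter_upwards [eventually_gt_atTop 0] with n hn
    have hn' : (0 : ℝ) < n := by exact_mod_cast hn
    set Φ : ℝ → ℝ := fun u => deriv smoothTransition u *
      smoothTransition (n * (b - a) - (u + 2)) * G (a + (u + 1) / n)
    have h1 := Measure.integral_comp_mul_left (fun s => Φ (s - (n * a + 1))) (n : ℝ)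
    rw [integral_sub_right_eq_self Φ, abs_of_pos (inv_pos.2 hn'), smul_eq_mul] at h1
    calc ∫ u, Φ u = n * ∫ t, Φ (n * t - (n * a + 1)) := by rw [h1]; field_simp
      _ = ∫ t, n * Φ (n * t - (n * a + 1)) := (integral_const_mul _ _).symm
      _ = _ := by
        congr 1
        ext t
        have e1 : (n : ℝ) * t - (n * a + 1) = n * (t - a) - 1 := by ring
        have e2 : (n : ℝ) * (b - a) - (n * (t - a) - 1 + 2) = n * (b - t) - 1 := by ring
        have e3 : a + (n * (t - a) - 1 + 1) / n = t := by field_simp; ring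
        simp only [Φ, e1, e2, e3]
        ring
  refine Tendsto.congr' key ?_
  have h0 : G a = ∫ u, deriv smoothTransition u * G a := by
    rw [integral_mul_const, integral_deriv_smoothTransition, one_mul]
  rw [h0]
  refine tendsto_integral_of_dominated_convergence (fun u => |deriv smoothTransition u| * C)
    (fun n => ?_) (integrable_deriv_smoothTransition.abs.mul_const C)
    (fun n => ae_of_all _ fun u => ?_) (ae_of_all _ fun u => ?_)
  · have := continuous_deriv_smoothTransition
    have h2 := Real.smoothTransition.continuous
    exact Continuous.aestronglyMeasurable (by fun_prop)
  · rw [Real.norm_eq_abs, abs_mul, abs_mul, mul_assoc]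
    refine mul_le_mul_of_nonneg_left ?_ (abs_nonneg _)
    calc _ ≤ 1 * C := mul_le_mul (abs_smoothTransition_le_one _) (hC _) (abs_nonneg _) zero_le_one
      _ = C := one_mul C
  · have h1 : Tendsto (fun n : ℕ => G (a + (u + 1) / n)) atTop (𝓝 (G a)) := by
      have : Tendsto (fun n : ℕ => a + (u + 1) / n) atTop (𝓝 (a + 0)) :=
        tendsto_const_nhds.add (tendsto_const_div_atTop_nhds_zero_nat (u + 1))
      rw [add_zero] at this
      exact (hG.tendsto a).comp this
    refine Tendsto.congr' ?_ (h1.const_mul (deriv smoothTransition u))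
    filter_upwards [eventually_smoothTransition_eq_one (d := u + 2) (sub_pos.2 hab)] with n hn
    rw [hn, mul_one]

lemma tendsto_integral_cutoff_right {a b : ℝ} (hab : a < b) {G : ℝ → ℝ} (hG : Continuous G)
    {C : ℝ} (hC : ∀ x, |G x| ≤ C) :
    Tendsto (fun n : ℕ => ∫ t, n * smoothTransition (n * (t - a) - 1) *
      deriv smoothTransition (n * (b - t) - 1) * G t) atTop (𝓝 (G b)) := by
  have h := tendsto_integral_cutoff_left (neg_lt_neg hab) (G := fun x => G (-x)) (by fun_prop)
    (fun x => hC (-x))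
  rw [neg_neg] at h
  refine h.congr fun n => ?_
  rw [← integral_neg_eq_self]
  congr 1
  ext t
  rw [neg_neg, show -t - -b = b - t by ring, show -a - -t = t - a by ring]
  ring

/-- Passing from test functions supported inside an interval to boundary values. -/
lemma sub_eq_integral_of_weak {a b : ℝ} (hab : a < b) {G k : ℝ → ℝ}
    (hG : Continuous G) {C : ℝ} (hC : ∀ x, |G x| ≤ C) (hk : IntegrableOn k (Ioo a b))
    (h : ∀ η : ℝ → ℝ, ContDiff ℝ 1 η → HasCompactSupport η → tsupport η ⊆ Ioo a b →
      ∫ t in Ioo a b, (deriv η t * G t + η t * k t) = 0) :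
    G b - G a = ∫ t in Ioo a b, k t := by
  have hS := continuous_deriv_smoothTransition
  have hS' := Real.smoothTransition.continuous
  -- The shift by -1 confines the support to [a + 1/n, b - 1/n], a compact subset of the open
  -- interval.
  let η : ℕ → ℝ → ℝ := fun n t =>
    smoothTransition (n * (t - a) - 1) * smoothTransition (n * (b - t) - 1)
  have hηc : ∀ n, ContDiff ℝ 1 (η n) := fun n =>
    (contDiff_smoothTransition.comp (by fun_prop)).mul
      (contDiff_smoothTransition.comp (by fun_prop))
  have hη1 : ∀ n t, |η n t| ≤ 1 := fun n t => by
    rw [abs_mul]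
    exact mul_le_one₀ (abs_smoothTransition_le_one _) (abs_nonneg _)
      (abs_smoothTransition_le_one _)
  have hηd : ∀ (n : ℕ) t, deriv (η n) t =
      n * deriv smoothTransition (n * (t - a) - 1) * smoothTransition (n * (b - t) - 1) -
      n * smoothTransition (n * (t - a) - 1) * deriv smoothTransition (n * (b - t) - 1) := by
    intro n t
    have hd : ∀ x, HasDerivAt smoothTransition (deriv smoothTransition x) x := fun x =>
      ((contDiff_smoothTransition.differentiable one_ne_zero) x).hasDerivAt
    have h1 : HasDerivAt (fun t : ℝ => (n : ℝ) * (t - a) - 1) n t := by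
      simpa using (((hasDerivAt_id t).sub_const a).const_mul (n : ℝ)).sub_const 1
    have h2 : HasDerivAt (fun t : ℝ => (n : ℝ) * (b - t) - 1) (-n) t := by
      simpa using (((hasDerivAt_id t).const_sub b).const_mul (n : ℝ)).sub_const 1
    have h3 := ((hd _).comp t h1).mul ((hd _).comp t h2)
    have h4 : HasDerivAt (η n) _ t := h3
    rw [h4.deriv]
    simp only [Function.comp]
    ring
  have hηs : ∀ᶠ n : ℕ in atTop, HasCompactSupport (η n) ∧ tsupport (η n) ⊆ Ioo a b := by
    filter_upwards [eventually_gt_atTop 0] with n hn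
    have hn' : (0 : ℝ) < n := by exact_mod_cast hn
    have hs : tsupport (η n) ⊆ Icc (a + 1 / n) (b - 1 / n) := by
      refine closure_minimal (fun t ht => ?_) isClosed_Icc
      rw [Function.mem_support] at ht
      have h1 : 0 < (n : ℝ) * (t - a) - 1 := by
        by_contra hcon
        exact ht (by simp only [η, Real.smoothTransition.zero_of_nonpos (not_lt.1 hcon), zero_mul])
      have h2 : 0 < (n : ℝ) * (b - t) - 1 := by
        by_contra hcon
        exact ht (by simp only [η, Real.smoothTransition.zero_of_nonpos (not_lt.1 hcon), mul_zero])
      have h3 : 1 / (n : ℝ) < t - a := by rw [div_lt_iff₀ hn']; linarith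
      have h4 : 1 / (n : ℝ) < b - t := by rw [div_lt_iff₀ hn']; linarith
      constructor <;> linarith
    refine ⟨isCompact_Icc.of_isClosed_subset (isClosed_tsupport _) hs, hs.trans fun t ht => ?_⟩
    have : 0 < 1 / (n : ℝ) := by positivity
    exact ⟨by linarith [ht.1], by linarith [ht.2]⟩
  have hk' : Tendsto (fun n => ∫ t in Ioo a b, η n t * k t) atTop (𝓝 (∫ t in Ioo a b, k t)) := by
    refine tendsto_integral_of_dominated_convergence (fun t => |k t|) (fun n => ?_) hk.abs
      (fun n => ae_of_all _ fun t => ?_) ?_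
    · exact (hηc n).continuous.aestronglyMeasurable.mul hk.aestronglyMeasurable
    · rw [Real.norm_eq_abs, abs_mul]
      exact mul_le_of_le_one_left (abs_nonneg _) (hη1 n t)
    · filter_upwards [ae_restrict_mem measurableSet_Ioo] with t ht
      refine tendsto_const_nhds.congr' ?_
      filter_upwards [eventually_smoothTransition_eq_one (d := 1) (sub_pos.2 ht.1),
        eventually_smoothTransition_eq_one (d := 1) (sub_pos.2 ht.2)] with n h1 h2
      simp only [η, h1, h2, one_mul]
  have hI : ∀ F : ℝ → ℝ, Continuous F → IntegrableOn F (Ioo a b) := fun F hF =>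
    (hF.integrableOn_Icc).mono_set Ioo_subset_Icc_self
  -- η' is an approximate Dirac mass at a minus one at b.
  have hG' : Tendsto (fun n => ∫ t in Ioo a b, deriv (η n) t * G t) atTop (𝓝 (G a - G b)) := by
    refine ((tendsto_integral_cutoff_left hab hG hC).sub
      (tendsto_integral_cutoff_right hab hG hC)).congr fun n => ?_
    have z1 : ∀ t ∉ Ioo a b, (n : ℝ) * deriv smoothTransition (n * (t - a) - 1) *
        smoothTransition (n * (b - t) - 1) * G t = 0 := fun t ht => by
      rcases le_or_gt t a with h1 | h1
      · rw [deriv_smoothTransition_of_nonpos (by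
          nlinarith [mul_nonneg (Nat.cast_nonneg n : (0 : ℝ) ≤ n) (sub_nonneg.2 h1)])]
        ring
      · have h2 : b ≤ t := le_of_not_gt fun h2 => ht ⟨h1, h2⟩
        rw [Real.smoothTransition.zero_of_nonpos (by
          nlinarith [mul_nonneg (Nat.cast_nonneg n : (0 : ℝ) ≤ n) (sub_nonneg.2 h2)])]
        ring
    have z2 : ∀ t ∉ Ioo a b, (n : ℝ) * smoothTransition (n * (t - a) - 1) *
        deriv smoothTransition (n * (b - t) - 1) * G t = 0 := fun t ht => by
      rcases le_or_gt t a with h1 | h1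
      · rw [Real.smoothTransition.zero_of_nonpos (by
          nlinarith [mul_nonneg (Nat.cast_nonneg n : (0 : ℝ) ≤ n) (sub_nonneg.2 h1)])]
        ring
      · have h2 : b ≤ t := le_of_not_gt fun h2 => ht ⟨h1, h2⟩
        rw [deriv_smoothTransition_of_nonpos (by
          nlinarith [mul_nonneg (Nat.cast_nonneg n : (0 : ℝ) ≤ n) (sub_nonneg.2 h2)])]
        ring
    rw [← setIntegral_eq_integral_of_forall_compl_eq_zero z1,
      ← setIntegral_eq_integral_of_forall_compl_eq_zero z2,
      ← integral_sub (hI _ (by fun_prop)) (hI _ (by fun_prop))]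
    congr 1
    ext t
    rw [hηd]
    ring
  have h0 : ∀ᶠ n in atTop, (∫ t in Ioo a b, deriv (η n) t * G t) +
      ∫ t in Ioo a b, η n t * k t = 0 := by
    filter_upwards [hηs] with n hn
    rw [← integral_add, h (η n) (hηc n) hn.1 hn.2]
    · exact hI _ (((hηc n).continuous_deriv le_rfl).mul hG)
    · exact Integrable.bdd_mul hk (hηc n).continuous.aestronglyMeasurable (c := 1)
        (ae_of_all _ (hη1 n))
  have h1 := tendsto_nhds_unique ((hG'.add hk').congr' h0) tendsto_const_nhds
  linarith

end Cutoff

/-! ### Space-time test functions -/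

section TestFunctions

variable {φ : ℝ × ℝ → ℝ}

lemma hasDerivAt_time (hφ : ContDiff ℝ 1 φ) (t v : ℝ) :
    HasDerivAt (fun r => φ (r, v)) (fderiv ℝ φ (t, v) (1, 0)) t := by
  have h1 := ((hφ.differentiable one_ne_zero) (t, v)).hasFDerivAt
  exact h1.comp_hasDerivAt t ((hasDerivAt_id t).prodMk (hasDerivAt_const t v))

lemma hasDerivAt_velocity (hφ : ContDiff ℝ 1 φ) (t v : ℝ) :
    HasDerivAt (fun w => φ (t, w)) (fderiv ℝ φ (t, v) (0, 1)) v := by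
  have h1 := ((hφ.differentiable one_ne_zero) (t, v)).hasFDerivAt
  exact h1.comp_hasDerivAt v ((hasDerivAt_const v t).prodMk (hasDerivAt_id v))

lemma deriv_time_eq (hφ : ContDiff ℝ 1 φ) :
    (fun z : ℝ × ℝ => deriv (fun r => φ (r, z.2)) z.1) = fun z => fderiv ℝ φ z (1, 0) :=
  funext fun z => (hasDerivAt_time hφ z.1 z.2).deriv

lemma deriv_velocity_eq (hφ : ContDiff ℝ 1 φ) :
    (fun z : ℝ × ℝ => deriv (fun w => φ (z.1, w)) z.2) = fun z => fderiv ℝ φ z (0, 1) :=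
  funext fun z => (hasDerivAt_velocity hφ z.1 z.2).deriv

lemma continuous_deriv_time (hφ : ContDiff ℝ 1 φ) :
    Continuous fun z : ℝ × ℝ => deriv (fun r => φ (r, z.2)) z.1 := by
  rw [deriv_time_eq hφ]
  exact (hφ.continuous_fderiv one_ne_zero).clm_apply continuous_const

lemma continuous_deriv_velocity (hφ : ContDiff ℝ 1 φ) :
    Continuous fun z : ℝ × ℝ => deriv (fun w => φ (z.1, w)) z.2 := by
  rw [deriv_velocity_eq hφ]
  exact (hφ.continuous_fderiv one_ne_zero).clm_apply continuous_const

lemma hasCompactSupport_deriv_time (hφ : ContDiff ℝ 1 φ) (hc : HasCompactSupport φ) :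
    HasCompactSupport fun z : ℝ × ℝ => deriv (fun r => φ (r, z.2)) z.1 := by
  rw [deriv_time_eq hφ]
  exact hc.fderiv_apply (𝕜 := ℝ) (1, 0)

lemma hasCompactSupport_deriv_velocity (hφ : ContDiff ℝ 1 φ) (hc : HasCompactSupport φ) :
    HasCompactSupport fun z : ℝ × ℝ => deriv (fun w => φ (z.1, w)) z.2 := by
  rw [deriv_velocity_eq hφ]
  exact hc.fderiv_apply (𝕜 := ℝ) (0, 1)

lemma continuous_nlGrad (hφ : ContDiff ℝ 1 φ) :
    Continuous fun z : ℝ × OffDiag => nlGrad (fun v => φ (z.1, v)) z.2 := by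
  have h := continuous_deriv_velocity hφ
  exact (h.comp (f := fun z : ℝ × OffDiag => (z.1, z.2.1.2)) (by fun_prop)).sub
    (h.comp (f := fun z : ℝ × OffDiag => (z.1, z.2.1.1)) (by fun_prop))

lemma exists_nlGrad_bound (hφ : ContDiff ℝ 1 φ) (hc : HasCompactSupport φ) :
    ∃ C, 0 ≤ C ∧ ∀ t p, |nlGrad (fun v => φ (t, v)) p| ≤ C := by
  obtain ⟨C, hC⟩ := (hasCompactSupport_deriv_velocity hφ hc).exists_bound_of_continuous
    (continuous_deriv_velocity hφ)
  refine ⟨C + C, ?_, fun t p => (abs_sub _ _).trans (add_le_add (hC (t, p.1.2)) (hC (t, p.1.1)))⟩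
  have := (norm_nonneg _).trans (hC (0, 0))
  linarith

/-- Integrals of compactly supported space-time functions along a narrowly continuous curve. -/
lemma continuous_integral_curve {f : ℝ → ProbabilityMeasure ℝ} (hf : Continuous f)
    {k : ℝ × ℝ → ℝ} (hk : Continuous k) (hc : HasCompactSupport k) :
    Continuous fun t => ∫ v, k (t, v) ∂(f t : Measure ℝ) := by
  obtain ⟨C, hC⟩ := hc.exists_bound_of_continuous hk
  have hkt : ∀ t, Continuous fun v => k (t, v) := fun t => by fun_prop
  have hint : ∀ s t, Integrable (fun v => k (s, v)) (f t : Measure ℝ) := fun s t =>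
    Integrable.of_bound (hkt s).aestronglyMeasurable C (ae_of_all _ fun v => hC (s, v))
  have huc : UniformContinuous k := hk.uniformContinuous_of_tendsto_cocompact hc.is_zero_at_infty
  rw [continuous_iff_continuousAt]
  intro t₀
  have h1 : Tendsto (fun t => ∫ v, k (t₀, v) ∂(f t : Measure ℝ)) (𝓝 t₀)
      (𝓝 (∫ v, k (t₀, v) ∂(f t₀ : Measure ℝ))) := by
    have := ProbabilityMeasure.tendsto_iff_forall_integral_tendsto.1 (hf.tendsto t₀)
      (BoundedContinuousFunction.ofNormedAddCommGroup _ (hkt t₀) C fun v => hC (t₀, v))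
    exact this
  -- The integrand moves together with the measure: uniform continuity of k makes the difference
  -- small uniformly in v, and f t has mass one.
  have h2 : Tendsto (fun t => ∫ v, (k (t, v) - k (t₀, v)) ∂(f t : Measure ℝ)) (𝓝 t₀) (𝓝 0) := by
    rw [Metric.tendsto_nhds]
    intro ε hε
    obtain ⟨δ, hδ, hd⟩ := Metric.uniformContinuous_iff.1 huc (ε / 2) (half_pos hε)
    filter_upwards [Metric.ball_mem_nhds t₀ hδ] with t ht
    rw [dist_zero_right]
    have : ‖∫ v, (k (t, v) - k (t₀, v)) ∂(f t : Measure ℝ)‖ ≤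
        ε / 2 * (f t : Measure ℝ).real univ := by
      refine norm_integral_le_of_norm_le_const (ae_of_all _ fun v => ?_)
      have := hd (a := (t, v)) (b := (t₀, v)) (by
        rw [Prod.dist_eq, dist_self, max_eq_left dist_nonneg]
        exact ht)
      rw [Real.dist_eq] at this
      exact this.le
    rw [probReal_univ, mul_one] at this
    linarith
  have h3 := h2.add h1
  rw [zero_add] at h3
  refine h3.congr fun t => ?_
  rw [integral_sub (hint t t) (hint t₀ t)]
  ring

end TestFunctions

/-- Solutions which are narrowly continuous and measurable on the whole line. -/
structure IsRegularSol (e T : ℝ) (f : ℝ → ProbabilityMeasure ℝ)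
    (U : ℝ → SignedMeasure OffDiag) : Prop where
  cont : Continuous f
  meas : ∀ g : C₀(OffDiag, ℝ), Measurable fun t : ℝ => signedIntegral (U t) g
  sol : IsGCESolution e T f U

/-! ### Regular solutions and the weak formulation with boundary terms -/

section Regular

variable {e T : ℝ} {f : ℝ → ProbabilityMeasure ℝ} {U : ℝ → SignedMeasure OffDiag}

/-- Freezing the path at its endpoint values outside [0, T] changes nothing in the equation, and
makes continuity and measurability global in time. -/
lemma GCE.regularize (hT : 0 ≤ T) {μ₀ μ₁ : ProbabilityMeasure ℝ} (h : GCE e T μ₀ μ₁ f U) :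
    GCE e T μ₀ μ₁ (fun t => f (projIcc 0 T hT t)) (fun t => U (projIcc 0 T hT t)) ∧
      IsRegularSol e T (fun t => f (projIcc 0 T hT t)) (fun t => U (projIcc 0 T hT t)) := by
  have hc : ∀ t ∈ Icc 0 T, (projIcc 0 T hT t : ℝ) = t := fun t ht => by rw [projIcc_of_mem hT ht]
  have hp : ∀ t ∈ Ioo 0 T, (projIcc 0 T hT t : ℝ) = t := fun t ht => hc t (Ioo_subset_Icc_self ht)
  have hsol : IsGCESolution e T (fun t => f (projIcc 0 T hT t))
      (fun t => U (projIcc 0 T hT t)) := by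
    constructor
    · intro g
      convert h.sol.measurable_f g using 2 with t
      rw [hc t t.2]
    · intro g
      convert h.sol.measurable_U g using 2 with t
      rw [hc t t.2]
    · convert h.sol.integrability using 1
      exact setLIntegral_congr_fun measurableSet_Ioo fun t ht => by simp only [hp t ht]
    · intro φ h1 h2 h3
      refine Eq.trans ?_ (h.sol.weak_form φ h1 h2 h3)
      congr 1
      · exact setIntegral_congr_fun measurableSet_Ioo fun t ht => by simp only [hp t ht]
      · exact setIntegral_congr_fun measurableSet_Ioo fun t ht => by simp only [hp t ht]
  have hcont : Continuous fun t => f (projIcc 0 T hT t) :=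
    (continuousOn_iff_continuous_domRestrict.1 h.cont).comp continuous_projIcc
  refine ⟨⟨hsol, hcont.continuousOn, ?_, ?_⟩, hcont, fun g => ?_, hsol⟩
  · rw [hc 0 ⟨le_rfl, hT⟩, h.left]
  · rw [hc T ⟨hT, le_rfl⟩, h.right]
  · exact (h.sol.measurable_U g).comp continuous_projIcc.measurable

lemma enorm_flux_le (he1 : e < 1) (V : SignedMeasure OffDiag) (ζ : OffDiag → ℝ) :
    ‖signedIntegral V fun p => sigma e p * ζ p‖ₑ ≤
      ∫⁻ p, ‖ζ p‖ₑ * ENNReal.ofReal (sigma e p) ∂V.totalVariation := by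
  refine (enorm_signedIntegral_le V _).trans (le_of_eq (lintegral_congr fun p => ?_))
  rw [enorm_mul, mul_comm, Real.enorm_eq_ofReal (sigma_nonneg he1 p)]

variable (he1 : e < 1) (h : IsRegularSol e T f U)
include h

omit h in
lemma enorm_flux_le_const (he1 : e < 1) (V : SignedMeasure OffDiag) {ζ : OffDiag → ℝ} {C : ℝ}
    (hC : ∀ p, |ζ p| ≤ C) :
    ‖signedIntegral V fun p => sigma e p * ζ p‖ₑ ≤
      ENNReal.ofReal C * ∫⁻ p, ENNReal.ofReal (sigma e p) ∂V.totalVariation := by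
  refine (enorm_flux_le he1 V ζ).trans ?_
  rw [← lintegral_const_mul' _ _ ENNReal.ofReal_ne_top]
  gcongr with p
  rw [Real.enorm_eq_ofReal_abs]
  exact ENNReal.ofReal_le_ofReal (hC p)

lemma IsRegularSol.measurable_flux {ζ : ℝ → OffDiag → ℝ} (hζ : Measurable (Function.uncurry ζ)) :
    Measurable fun t => signedIntegral (U t) fun p => sigma e p * ζ t p :=
  measurable_signedIntegral (ζ := fun t p => sigma e p * ζ t p) h.meas
    (((measurable_sigma e).comp measurable_snd).mul hζ)

include he1

lemma IsRegularSol.integrableOn_flux {ζ : ℝ → OffDiag → ℝ}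
    (hζ : Measurable (Function.uncurry ζ)) {C : ℝ} (hC : ∀ t p, |ζ t p| ≤ C) :
    IntegrableOn (fun t => signedIntegral (U t) fun p => sigma e p * ζ t p) (Ioo 0 T) := by
  refine ⟨(h.measurable_flux hζ).aestronglyMeasurable, ?_⟩
  rw [hasFiniteIntegral_iff_enorm]
  calc _ ≤ ∫⁻ t in Ioo 0 T,
        ENNReal.ofReal C * ∫⁻ p, ENNReal.ofReal (sigma e p) ∂(U t).totalVariation := by
        gcongr with t
        exact enorm_flux_le_const he1 (U t) (hC t)
    _ = ENNReal.ofReal C *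
        ∫⁻ t in Ioo 0 T, ∫⁻ p, ENNReal.ofReal (sigma e p) ∂(U t).totalVariation :=
        lintegral_const_mul' _ _ ENNReal.ofReal_ne_top
    _ < ⊤ := ENNReal.mul_lt_top ENNReal.ofReal_lt_top h.sol.integrability

lemma IsRegularSol.integrableOn_flux_nlGrad {φ : ℝ × ℝ → ℝ} (hφ : ContDiff ℝ 1 φ)
    (hc : HasCompactSupport φ) :
    IntegrableOn (fun t => signedIntegral (U t)
      fun p => sigma e p * nlGrad (fun v => φ (t, v)) p) (Ioo 0 T) := by
  obtain ⟨C, -, hC⟩ := exists_nlGrad_bound hφ hc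
  exact h.integrableOn_flux he1 (continuous_nlGrad hφ).measurable hC

/-- The weak formulation with boundary terms. -/
theorem IsRegularSol.boundary_formula {a b : ℝ} (ha : 0 ≤ a) (hab : a < b) (hb : b ≤ T)
    {φ : ℝ × ℝ → ℝ} (hφ : ContDiff ℝ 1 φ) (hc : HasCompactSupport φ) :
    ∫ v, φ (b, v) ∂(f b : Measure ℝ) - ∫ v, φ (a, v) ∂(f a : Measure ℝ) =
      (∫ t in Ioo a b, ∫ v, deriv (fun r => φ (r, v)) t ∂(f t : Measure ℝ)) +
      ∫ t in Ioo a b, signedIntegral (U t)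
        fun p => sigma e p * nlGrad (fun v => φ (t, v)) p := by
  set G : ℝ → ℝ := fun t => ∫ v, φ (t, v) ∂(f t : Measure ℝ)
  set D : ℝ → ℝ := fun t => ∫ v, deriv (fun r => φ (r, v)) t ∂(f t : Measure ℝ)
  set H : ℝ → ℝ := fun t => signedIntegral (U t)
    fun p => sigma e p * nlGrad (fun v => φ (t, v)) p
  have hG : Continuous G := continuous_integral_curve h.cont hφ.continuous hc
  have hD : Continuous D := continuous_integral_curve h.cont
    (k := fun z => deriv (fun r => φ (r, z.2)) z.1) (continuous_deriv_time hφ)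
    (hasCompactSupport_deriv_time hφ hc)
  obtain ⟨C, hC⟩ := hc.exists_bound_of_continuous hφ.continuous
  obtain ⟨C', hC'⟩ := (hasCompactSupport_deriv_time hφ hc).exists_bound_of_continuous
    (continuous_deriv_time hφ)
  have hGb : ∀ t, |G t| ≤ C := fun t => by
    have := norm_integral_le_of_norm_le_const (μ := (f t : Measure ℝ)) (f := fun v => φ (t, v))
      (C := C) (ae_of_all _ fun v => hC (t, v))
    rwa [probReal_univ, mul_one] at this
  have hsub : Ioo a b ⊆ Ioo 0 T := Ioo_subset_Ioo ha hb
  have hH : IntegrableOn H (Ioo 0 T) := h.integrableOn_flux_nlGrad he1 hφ hc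
  have hI : ∀ (c d : ℝ) (F : ℝ → ℝ), Continuous F → IntegrableOn F (Ioo c d) := fun c d F hF =>
    (hF.integrableOn_Icc).mono_set Ioo_subset_Icc_self
  rw [← integral_add (hI _ _ D hD) (hH.mono_set hsub)]
  refine sub_eq_integral_of_weak hab hG hGb ((hI _ _ D hD).add (hH.mono_set hsub))
    fun η hη hηc hηs => ?_
  obtain ⟨B, hB⟩ := hηc.exists_bound_of_continuous hη.continuous
  have hηd : ∀ t, HasDerivAt η (deriv η t) t := fun t =>
    ((hη.differentiable one_ne_zero) t).hasDerivAt
  -- φ need not vanish at times a and b; the product with a time cutoff η is admissible. The product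
  -- rule in time and linearity of the flux term turn the weak form into the one-dimensional
  -- statement that the weak derivative of G is D + H.
  have hΦ : ContDiff ℝ 1 fun z : ℝ × ℝ => η z.1 * φ z := (hη.comp contDiff_fst).mul hφ
  have hΦc : HasCompactSupport fun z : ℝ × ℝ => η z.1 * φ z :=
    HasCompactSupport.mul_left (f := fun z : ℝ × ℝ => η z.1) hc
  have hΦs : tsupport (fun z : ℝ × ℝ => η z.1 * φ z) ⊆ Ioo 0 T ×ˢ univ := by
    have hcl : IsClosed (Prod.fst ⁻¹' tsupport η : Set (ℝ × ℝ)) :=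
      (isClosed_tsupport η).preimage continuous_fst
    refine (closure_minimal (fun z hz => ?_) hcl).trans fun z hz => ⟨hsub (hηs hz), mem_univ _⟩
    exact subset_tsupport η fun h0 => hz (by simp [h0])
  have hw := h.sol.weak_form _ hΦ hΦc hΦs
  have e1 : ∀ t, ∫ v, deriv (fun r => η r * φ (r, v)) t ∂(f t : Measure ℝ) =
      deriv η t * G t + η t * D t := by
    intro t
    have hd : ∀ v, deriv (fun r => η r * φ (r, v)) t =
        deriv η t * φ (t, v) + η t * deriv (fun r => φ (r, v)) t := fun v =>
      ((hηd t).mul (hasDerivAt_time hφ t v).differentiableAt.hasDerivAt).deriv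
    simp only [hd]
    rw [integral_add, integral_const_mul, integral_const_mul]
    · refine Integrable.const_mul (Integrable.of_bound
        (Continuous.aestronglyMeasurable ?_) C (ae_of_all _ fun v => hC (t, v))) _
      have := hφ.continuous
      fun_prop
    · refine Integrable.const_mul (Integrable.of_bound
        (Continuous.aestronglyMeasurable ?_) C' (ae_of_all _ fun v => hC' (t, v))) _
      exact (continuous_deriv_time hφ).comp (f := fun v => (t, v)) (by fun_prop)
  have e2 : ∀ t, (signedIntegral (U t)
      fun p => sigma e p * nlGrad (fun v => η t * φ (t, v)) p) = η t * H t := by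
    intro t
    have : ∀ p : OffDiag, sigma e p * nlGrad (fun v => η t * φ (t, v)) p =
        η t * (sigma e p * nlGrad (fun v => φ (t, v)) p) := fun p => by
      unfold nlGrad
      rw [deriv_const_mul _ (hasDerivAt_velocity hφ _ _).differentiableAt,
        deriv_const_mul _ (hasDerivAt_velocity hφ _ _).differentiableAt]
      ring
    simp only [this]
    unfold H signedIntegral
    rw [integral_const_mul, integral_const_mul]
    ring
  simp only [e1, e2] at hw
  have hηH : IntegrableOn (fun t => η t * H t) (Ioo 0 T) :=
    Integrable.bdd_mul hH hη.continuous.aestronglyMeasurable (c := B) (ae_of_all _ hB)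
  have hd' : Continuous (deriv η) := hη.continuous_deriv le_rfl
  rw [← integral_add (hI _ _ (fun t => deriv η t * G t + η t * D t) (by fun_prop)) hηH] at hw
  rw [← hw]
  have hz : ∀ t ∈ Ioo 0 T \ Ioo a b,
      deriv η t * G t + η t * D t + η t * H t = 0 := fun t ht => by
    have h0 : η t = 0 := image_eq_zero_of_notMem_tsupport fun h' => ht.2 (hηs h')
    have h1 : deriv η t = 0 := by
      by_contra hne
      exact ht.2 (hηs (support_deriv_subset hne))
    rw [h0, h1]
    ring
  rw [setIntegral_eq_of_subset_of_forall_sdiff_eq_zero measurableSet_Ioo hsub hz]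
  congr 1
  ext t
  ring

end Regular

/-! ### Affine changes of the time variable -/

section Affine

variable {a L : ℝ}

lemma measurableEmbedding_affine (hL : L ≠ 0) : MeasurableEmbedding fun t : ℝ => (t - a) / L :=
by
  have h := ((Homeomorph.subRight a).trans
    (Homeomorph.mulRight₀ L⁻¹ (inv_ne_zero hL))).measurableEmbedding
  simp only [div_eq_mul_inv]
  exact h

lemma map_affine_restrict (hL : L ≠ 0) (s : Set ℝ) :
    Measure.map (fun t : ℝ => (t - a) / L) (volume.restrict ((fun t : ℝ => (t - a) / L) ⁻¹' s)) =
      ENNReal.ofReal |L| • volume.restrict s := by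
  rw [← (measurableEmbedding_affine hL).restrict_map, ← Measure.restrict_smul]
  congr 1
  have e1 : (fun t : ℝ => (t - a) / L) = (fun t => t * L⁻¹) ∘ fun t => t - a := by
    ext t
    simp [div_eq_mul_inv]
  rw [e1, ← Measure.map_map (by fun_prop) (by fun_prop), map_sub_right_eq_self,
    Real.map_volume_mul_right (inv_ne_zero hL), inv_inv]

lemma setLIntegral_comp_affine (hL : L ≠ 0) (s : Set ℝ) (F : ℝ → ℝ≥0∞) :
    ∫⁻ t in (fun t : ℝ => (t - a) / L) ⁻¹' s, F ((t - a) / L) =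
      ENNReal.ofReal |L| * ∫⁻ t in s, F t := by
  rw [← (measurableEmbedding_affine hL).lintegral_map, map_affine_restrict hL,
    lintegral_smul_measure, smul_eq_mul]

lemma setIntegral_comp_affine (hL : L ≠ 0) (s : Set ℝ) (F : ℝ → ℝ) :
    ∫ t in (fun t : ℝ => (t - a) / L) ⁻¹' s, F ((t - a) / L) = |L| * ∫ t in s, F t := by
  rw [← (measurableEmbedding_affine hL).integral_map, map_affine_restrict hL,
    integral_smul_measure, ENNReal.toReal_ofReal (abs_nonneg L), smul_eq_mul]

lemma integrableOn_comp_affine (hL : L ≠ 0) {s : Set ℝ} {F : ℝ → ℝ} (hF : IntegrableOn F s) :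
    IntegrableOn (fun t => F ((t - a) / L)) ((fun t : ℝ => (t - a) / L) ⁻¹' s) := by
  have := (measurableEmbedding_affine (a := a) hL).integrable_map_iff (g := F)
    (μ := volume.restrict ((fun t : ℝ => (t - a) / L) ⁻¹' s))
  refine this.1 ?_
  rw [map_affine_restrict hL]
  exact Integrable.smul_measure hF ENNReal.ofReal_ne_top

end Affine

/-! ### Behaviour of solutions and of the action under reparametrisation -/

section Reparametrisation

variable {e : ℝ} {f : ℝ → ProbabilityMeasure ℝ} {U : ℝ → SignedMeasure OffDiag}

lemma lintegral_sigma_reparam {a L : ℝ} (hL : L ≠ 0) :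
    ∫⁻ t in (fun t : ℝ => (t - a) / L) ⁻¹' Ioo 0 1,
      ∫⁻ p, ENNReal.ofReal (sigma e p) ∂(L⁻¹ • U ((t - a) / L)).totalVariation =
    ∫⁻ t in Ioo 0 1, ∫⁻ p, ENNReal.ofReal (sigma e p) ∂(U t).totalVariation := by
  simp only [lintegral_totalVariation_smul]
  rw [setLIntegral_comp_affine hL _
    fun s => ‖L⁻¹‖ₑ * ∫⁻ p, ENNReal.ofReal (sigma e p) ∂(U s).totalVariation,
    lintegral_const_mul' _ _ enorm_ne_top, ← mul_assoc, ← Real.enorm_eq_ofReal_abs, ← enorm_mul,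
    mul_inv_cancel₀ hL, enorm_one, one_mul]

/-- The action is quadratic in the flux, giving L⁻², while dt contributes |L|. The resulting |L|⁻¹
is what makes the square root of the minimal action satisfy the triangle inequality. -/
lemma lintegral_action_reparam {a L : ℝ} (hL : L ≠ 0) :
    ∫⁻ t in (fun t : ℝ => (t - a) / L) ⁻¹' Ioo 0 1,
      action e (f ((t - a) / L)) (L⁻¹ • U ((t - a) / L)) =
    ENNReal.ofReal |L|⁻¹ * ∫⁻ t in Ioo 0 1, action e (f t) (U t) := by
  simp only [action_smul e _ _ (inv_ne_zero hL)]
  rw [setLIntegral_comp_affine hL _ fun s => ENNReal.ofReal (L⁻¹ ^ 2) * action e (f s) (U s),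
    lintegral_const_mul' _ _ ENNReal.ofReal_ne_top, ← mul_assoc,
    ← ENNReal.ofReal_mul (abs_nonneg L)]
  congr 2
  have : |L| ≠ 0 := abs_ne_zero.2 hL
  rw [inv_pow, ← sq_abs]
  field_simp

variable (h : IsRegularSol e 1 f U) (he1 : e < 1)
include h he1

/-- The weak formulation for an affine reparametrisation of a solution on `[0, 1]`. -/
lemma IsRegularSol.reparam {a L : ℝ} (hL : L ≠ 0) {φ : ℝ × ℝ → ℝ} (hφ : ContDiff ℝ 1 φ)
    (hc : HasCompactSupport φ) :
    IntegrableOn (fun t => ∫ v, deriv (fun r => φ (r, v)) t ∂(f ((t - a) / L) : Measure ℝ))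
      ((fun t : ℝ => (t - a) / L) ⁻¹' Ioo 0 1) ∧
    IntegrableOn (fun t => signedIntegral (L⁻¹ • U ((t - a) / L))
      fun p => sigma e p * nlGrad (fun v => φ (t, v)) p)
      ((fun t : ℝ => (t - a) / L) ⁻¹' Ioo 0 1) ∧
    (∫ t in (fun t : ℝ => (t - a) / L) ⁻¹' Ioo 0 1,
      ∫ v, deriv (fun r => φ (r, v)) t ∂(f ((t - a) / L) : Measure ℝ)) +
    (∫ t in (fun t : ℝ => (t - a) / L) ⁻¹' Ioo 0 1, signedIntegral (L⁻¹ • U ((t - a) / L))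
      fun p => sigma e p * nlGrad (fun v => φ (t, v)) p) =
    |L| * L⁻¹ * (∫ v, φ (a + L, v) ∂(f 1 : Measure ℝ) - ∫ v, φ (a, v) ∂(f 0 : Measure ℝ)) := by
  -- The test function is pulled back to the original time scale, where the boundary formula on [0,
  -- 1] applies. The prefactor |L| L⁻¹ is the sign of L: reversing time exchanges the roles of the
  -- boundary terms.
  let Ψ : ℝ × ℝ ≃ₜ ℝ × ℝ :=
    ((Homeomorph.mulLeft₀ L hL).trans (Homeomorph.addLeft a)).prodCongr (Homeomorph.refl ℝ)
  have hΨ : ∀ z : ℝ × ℝ, Ψ z = (a + L * z.1, z.2) := fun z => rfl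
  obtain ⟨ψ, hψ⟩ : ∃ ψ : ℝ × ℝ → ℝ, ψ = fun z => φ (a + L * z.1, z.2) := ⟨_, rfl⟩
  have hψ' : ∀ r v, ψ (r, v) = φ (a + L * r, v) := fun r v => by rw [hψ]
  have hφ' : ContDiff ℝ 1 ψ := by
    rw [hψ]
    exact hφ.comp (by fun_prop)
  have hc' : HasCompactSupport ψ := by
    rw [hψ]
    exact hc.comp_homeomorph Ψ
  set D : ℝ → ℝ := fun s => ∫ v, deriv (fun r => ψ (r, v)) s ∂(f s : Measure ℝ) with hD
  set H : ℝ → ℝ := fun s => signedIntegral (U s)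
    fun p => sigma e p * nlGrad (fun v => ψ (s, v)) p with hH
  have hback : ∀ t, a + L * ((t - a) / L) = t := fun t => by field_simp; ring
  have e1 : ∀ t, ∫ v, deriv (fun r => φ (r, v)) t ∂(f ((t - a) / L) : Measure ℝ) =
      L⁻¹ * D ((t - a) / L) := by
    intro t
    simp only [hD, hψ']
    rw [← integral_const_mul]
    congr 1
    ext v
    have h1 : HasDerivAt (fun r : ℝ => a + L * r) L ((t - a) / L) := by
      simpa using ((hasDerivAt_id ((t - a) / L)).const_mul L).const_add a
    have h2 := hasDerivAt_time hφ (a + L * ((t - a) / L)) v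
    have h3 := (h2.comp ((t - a) / L) h1).deriv
    have h4 : deriv (fun r => φ (a + L * r, v)) ((t - a) / L) = _ := h3
    rw [h4, hback, (hasDerivAt_time hφ t v).deriv]
    field_simp
  have e2 : ∀ t, (signedIntegral (L⁻¹ • U ((t - a) / L))
      fun p => sigma e p * nlGrad (fun v => φ (t, v)) p) = L⁻¹ * H ((t - a) / L) := by
    intro t
    rw [signedIntegral_smul, hH]
    simp only [hψ', hback]
  have hDint : IntegrableOn D (Ioo 0 1) := by
    have : Continuous D := continuous_integral_curve h.cont
      (k := fun z => deriv (fun r => ψ (r, z.2)) z.1) (continuous_deriv_time hφ')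
      (hasCompactSupport_deriv_time hφ' hc')
    exact this.integrableOn_Icc.mono_set Ioo_subset_Icc_self
  have hHint : IntegrableOn H (Ioo 0 1) := h.integrableOn_flux_nlGrad he1 hφ' hc'
  have hb := h.boundary_formula he1 le_rfl zero_lt_one le_rfl hφ' hc'
  simp only [hψ', mul_one, mul_zero, add_zero] at hb
  have hb' : (∫ t in Ioo 0 1, D t) + ∫ t in Ioo 0 1, H t =
      ∫ v, φ (a + L, v) ∂(f 1 : Measure ℝ) - ∫ v, φ (a, v) ∂(f 0 : Measure ℝ) := by
    rw [hb]
    simp only [hD, hH, hψ']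
  rw [← hb']
  simp only [e1, e2]
  clear_value D H
  have i1 := (integrableOn_comp_affine (a := a) hL hDint).const_mul L⁻¹
  have i2 := (integrableOn_comp_affine (a := a) hL hHint).const_mul L⁻¹
  refine ⟨i1, i2, ?_⟩
  rw [integral_const_mul, integral_const_mul, setIntegral_comp_affine hL, setIntegral_comp_affine hL]
  ring

end Reparametrisation

/-! ### Symmetry and triangle inequality for the transportation cost -/

section PseudoDistance

variable {e : ℝ}

lemma continuous_integral_zeroAtInfty {f : ℝ → ProbabilityMeasure ℝ} (hf : Continuous f)
    (g : C₀(ℝ, ℝ)) : Continuous fun t => ∫ v, g v ∂(f t : Measure ℝ) :=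
  (ProbabilityMeasure.continuous_integral_boundedContinuousFunction g.toBCF).comp hf

lemma affine_preimage_Ioo {a L : ℝ} (hL : 0 < L) :
    (fun t : ℝ => (t - a) / L) ⁻¹' Ioo 0 1 = Ioo a (a + L) := by
  ext t
  simp only [mem_preimage, mem_Ioo, div_pos_iff_of_pos_right hL, div_lt_one hL]
  constructor <;> rintro ⟨h1, h2⟩ <;> constructor <;> linarith

lemma reflection_preimage_Ioo :
    (fun t : ℝ => (t - 1) / (-1)) ⁻¹' Ioo 0 1 = Ioo 0 1 := by
  ext t
  simp only [mem_preimage, mem_Ioo, div_neg, div_one]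
  constructor <;> rintro ⟨h1, h2⟩ <;> constructor <;> linarith

lemma restrict_Ioo_split {a b c : ℝ} (hab : a < b) (hbc : b < c) :
    (volume : Measure ℝ).restrict (Ioo a c) =
      volume.restrict (Ioo a b) + volume.restrict (Ioo b c) := by
  rw [← Measure.restrict_union (disjoint_left.2 fun t h1 h2 => lt_asymm h1.2 h2.1)
    measurableSet_Ioo]
  refine Measure.restrict_congr_set ?_
  have hne : ∀ᵐ t : ℝ, t ≠ b := by simp [ae_iff, measure_singleton]
  filter_upwards [hne] with t ht
  apply propext
  change (a < t ∧ t < c) ↔ ((a < t ∧ t < b) ∨ (b < t ∧ t < c))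
  constructor
  · rintro ⟨h1, h2⟩
    rcases lt_or_gt_of_ne ht with h | h
    · exact Or.inl ⟨h1, h⟩
    · exact Or.inr ⟨h, h2⟩
  · rintro (⟨h1, h2⟩ | ⟨h1, h2⟩)
    · exact ⟨h1, h2.trans hbc⟩
    · exact ⟨hab.trans h1, h2⟩

/-- Reparametrisation with L = -1 runs the path backwards and changes the sign of the flux; the
boundary terms vanish because test functions are supported in the open time interval. -/
lemma GCE.reverse (he1 : e < 1) {μ ν : ProbabilityMeasure ℝ} {f : ℝ → ProbabilityMeasure ℝ}
    {U : ℝ → SignedMeasure OffDiag} (h : IsRegularSol e 1 f U) (h0 : f 0 = μ) (h1 : f 1 = ν) :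
    GCE e 1 ν μ (fun t => f ((t - 1) / (-1))) (fun t => (-1 : ℝ)⁻¹ • U ((t - 1) / (-1))) := by
  have hc : Continuous fun t : ℝ => f ((t - 1) / (-1)) := h.cont.comp (by fun_prop)
  refine ⟨⟨fun g => ?_, fun g => ?_, ?_, fun φ hφ hφc hφs => ?_⟩, hc.continuousOn, ?_, ?_⟩
  · exact (continuous_integral_zeroAtInfty hc g).measurable.comp measurable_subtype_coe
  · simp only [signedIntegral_smul]
    exact (((h.meas g).comp (by fun_prop : Measurable fun t : ℝ => (t - 1) / (-1))).const_mul
      _).comp measurable_subtype_coe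
  · have := lintegral_sigma_reparam (e := e) (U := U) (a := 1) (L := -1) (by norm_num)
    rw [reflection_preimage_Ioo] at this
    rw [this]
    exact h.sol.integrability
  · have := (h.reparam he1 (a := 1) (L := -1) (by norm_num) hφ hφc).2.2
    rw [reflection_preimage_Ioo] at this
    rw [this]
    have hz : ∀ t ∉ Ioo (0 : ℝ) 1, ∀ v, φ (t, v) = 0 := fun t ht v =>
      image_eq_zero_of_notMem_tsupport fun hmem => ht (hφs hmem).1
    have e1 : ∀ v, φ (1 + -1, v) = 0 := hz _ (by norm_num)
    have e2 : ∀ v, φ (1, v) = 0 := hz _ (by norm_num)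
    simp only [e1, e2, integral_zero, sub_zero, mul_zero]
  · rw [← h1]
    norm_num
  · rw [← h0]
    norm_num

/-- The first path is run on [0, θ] and the second on [θ, 1]. Test functions need not vanish at θ,
but the two boundary terms there cancel since f₁ 1 = f₂ 0. The weights in the action come from the
rescaling of time. -/
lemma GCE.concat (he1 : e < 1) {f₁ f₂ : ℝ → ProbabilityMeasure ℝ}
    {U₁ U₂ : ℝ → SignedMeasure OffDiag} (h₁ : IsRegularSol e 1 f₁ U₁)
    (h₂ : IsRegularSol e 1 f₂ U₂) (h : f₁ 1 = f₂ 0) {θ : ℝ} (hθ0 : 0 < θ) (hθ1 : θ < 1) :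
    ∃ f U, GCE e 1 (f₁ 0) (f₂ 1) f U ∧
      ∫⁻ t in Ioo (0 : ℝ) 1, action e (f t) (U t) =
        ENNReal.ofReal θ⁻¹ * (∫⁻ t in Ioo (0 : ℝ) 1, action e (f₁ t) (U₁ t)) +
        ENNReal.ofReal (1 - θ)⁻¹ * ∫⁻ t in Ioo (0 : ℝ) 1, action e (f₂ t) (U₂ t) := by
  have hθ' : 0 < 1 - θ := sub_pos.2 hθ1
  set g₁ : ℝ → ProbabilityMeasure ℝ := fun t => f₁ ((t - 0) / θ) with hg₁
  set g₂ : ℝ → ProbabilityMeasure ℝ := fun t => f₂ ((t - θ) / (1 - θ)) with hg₂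
  set V₁ : ℝ → SignedMeasure OffDiag := fun t => θ⁻¹ • U₁ ((t - 0) / θ) with hV₁
  set V₂ : ℝ → SignedMeasure OffDiag := fun t => (1 - θ)⁻¹ • U₂ ((t - θ) / (1 - θ)) with hV₂
  have p1 : (fun t : ℝ => (t - 0) / θ) ⁻¹' Ioo 0 1 = Ioo 0 θ := by
    rw [affine_preimage_Ioo hθ0, zero_add]
  have p2 : (fun t : ℝ => (t - θ) / (1 - θ)) ⁻¹' Ioo 0 1 = Ioo θ 1 := by
    rw [affine_preimage_Ioo hθ', add_sub_cancel]
  set f : ℝ → ProbabilityMeasure ℝ := fun t => if t ≤ θ then g₁ t else g₂ t with hf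
  set U : ℝ → SignedMeasure OffDiag := fun t => if t ≤ θ then V₁ t else V₂ t with hU
  have f1 : ∀ t ∈ Ioo 0 θ, f t = g₁ t := fun t ht => if_pos ht.2.le
  have f2 : ∀ t ∈ Ioo θ 1, f t = g₂ t := fun t ht => if_neg (not_le.2 ht.1)
  have u1 : ∀ t ∈ Ioo 0 θ, U t = V₁ t := fun t ht => if_pos ht.2.le
  have u2 : ∀ t ∈ Ioo θ 1, U t = V₂ t := fun t ht => if_neg (not_le.2 ht.1)
  have hc : Continuous f := by
    refine Continuous.if_le (h₁.cont.comp (by fun_prop)) (h₂.cont.comp (by fun_prop))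
      continuous_id continuous_const fun t ht => ?_
    change t = θ at ht
    subst ht
    simp only [hg₁, hg₂, sub_zero, div_self hθ0.ne', sub_self, zero_div, h]
  have hsplit := restrict_Ioo_split hθ0 hθ1
  refine ⟨f, U, ⟨⟨fun g => ?_, fun g => ?_, ?_, fun φ hφ hφc hφs => ?_⟩, hc.continuousOn, ?_, ?_⟩, ?_⟩
  · exact (continuous_integral_zeroAtInfty hc g).measurable.comp measurable_subtype_coe
  · have e1 : ∀ t, signedIntegral (U t) g = if t ≤ θ then θ⁻¹ * signedIntegral (U₁ ((t - 0) / θ)) g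
        else (1 - θ)⁻¹ * signedIntegral (U₂ ((t - θ) / (1 - θ))) g := fun t => by
      simp only [hU]
      split_ifs
      · rw [hV₁, signedIntegral_smul]
      · rw [hV₂, signedIntegral_smul]
    have e2 : Measurable fun t => signedIntegral (U t) g := by
      simp only [e1]
      exact Measurable.ite measurableSet_Iic
        (((h₁.meas g).comp (by fun_prop : Measurable fun t : ℝ => (t - 0) / θ)).const_mul _)
        (((h₂.meas g).comp (by fun_prop : Measurable fun t : ℝ => (t - θ) / (1 - θ))).const_mul _)
    exact e2.comp measurable_subtype_coe
  · have q1 : ∫⁻ t in Ioo 0 θ, ∫⁻ p, ENNReal.ofReal (sigma e p) ∂(U t).totalVariation =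
        ∫⁻ t in Ioo 0 θ, ∫⁻ p, ENNReal.ofReal (sigma e p) ∂(V₁ t).totalVariation :=
      setLIntegral_congr_fun measurableSet_Ioo fun t ht => by simp only [u1 t ht]
    have q2 : ∫⁻ t in Ioo θ 1, ∫⁻ p, ENNReal.ofReal (sigma e p) ∂(U t).totalVariation =
        ∫⁻ t in Ioo θ 1, ∫⁻ p, ENNReal.ofReal (sigma e p) ∂(V₂ t).totalVariation :=
      setLIntegral_congr_fun measurableSet_Ioo fun t ht => by simp only [u2 t ht]
    rw [hsplit, lintegral_add_measure, q1, q2,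
      ← p1, ← p2, lintegral_sigma_reparam hθ0.ne', lintegral_sigma_reparam hθ'.ne']
    exact ENNReal.add_lt_top.2 ⟨h₁.sol.integrability, h₂.sol.integrability⟩
  · obtain ⟨d1, d2, d3⟩ := h₁.reparam he1 (a := 0) hθ0.ne' hφ hφc
    obtain ⟨k1, k2, k3⟩ := h₂.reparam he1 (a := θ) hθ'.ne' hφ hφc
    rw [p1] at d1 d2 d3
    rw [p2] at k1 k2 k3
    have i1 : IntegrableOn (fun t => ∫ v, deriv (fun r => φ (r, v)) t ∂(f t : Measure ℝ))
        (Ioo 0 θ) := d1.congr_fun (fun t ht => by simp only [f1 t ht, hg₁]) measurableSet_Ioo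
    have i2 : IntegrableOn (fun t => ∫ v, deriv (fun r => φ (r, v)) t ∂(f t : Measure ℝ))
        (Ioo θ 1) := k1.congr_fun (fun t ht => by simp only [f2 t ht, hg₂]) measurableSet_Ioo
    have i3 : IntegrableOn (fun t => signedIntegral (U t)
        fun p => sigma e p * nlGrad (fun v => φ (t, v)) p) (Ioo 0 θ) :=
      d2.congr_fun (fun t ht => by simp only [u1 t ht, hV₁]) measurableSet_Ioo
    have i4 : IntegrableOn (fun t => signedIntegral (U t)
        fun p => sigma e p * nlGrad (fun v => φ (t, v)) p) (Ioo θ 1) :=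
      k2.congr_fun (fun t ht => by simp only [u2 t ht, hV₂]) measurableSet_Ioo
    rw [hsplit, integral_add_measure i1 i2, integral_add_measure i3 i4]
    have j1 : ∫ t in Ioo 0 θ, ∫ v, deriv (fun r => φ (r, v)) t ∂(f t : Measure ℝ) =
        ∫ t in Ioo 0 θ, ∫ v, deriv (fun r => φ (r, v)) t ∂(f₁ ((t - 0) / θ) : Measure ℝ) :=
      setIntegral_congr_fun measurableSet_Ioo fun t ht => by simp only [f1 t ht, hg₁]
    have j2 : ∫ t in Ioo θ 1, ∫ v, deriv (fun r => φ (r, v)) t ∂(f t : Measure ℝ) =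
        ∫ t in Ioo θ 1, ∫ v, deriv (fun r => φ (r, v)) t ∂(f₂ ((t - θ) / (1 - θ)) : Measure ℝ) :=
      setIntegral_congr_fun measurableSet_Ioo fun t ht => by simp only [f2 t ht, hg₂]
    have j3 : (∫ t in Ioo 0 θ, signedIntegral (U t)
        fun p => sigma e p * nlGrad (fun v => φ (t, v)) p) = ∫ t in Ioo 0 θ,
          signedIntegral (θ⁻¹ • U₁ ((t - 0) / θ))
            fun p => sigma e p * nlGrad (fun v => φ (t, v)) p :=
      setIntegral_congr_fun measurableSet_Ioo fun t ht => by simp only [u1 t ht, hV₁]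
    have j4 : (∫ t in Ioo θ 1, signedIntegral (U t)
        fun p => sigma e p * nlGrad (fun v => φ (t, v)) p) = ∫ t in Ioo θ 1,
          signedIntegral ((1 - θ)⁻¹ • U₂ ((t - θ) / (1 - θ)))
            fun p => sigma e p * nlGrad (fun v => φ (t, v)) p :=
      setIntegral_congr_fun measurableSet_Ioo fun t ht => by simp only [u2 t ht, hV₂]
    rw [j1, j2, j3, j4]
    have hz : ∀ t ∉ Ioo (0 : ℝ) 1, ∀ v, φ (t, v) = 0 := fun t ht v =>
      image_eq_zero_of_notMem_tsupport fun hmem => ht (hφs hmem).1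
    have e1 : ∀ v, φ (0, v) = 0 := hz _ (by norm_num)
    have e2 : ∀ v, φ (1, v) = 0 := hz _ (by norm_num)
    rw [abs_of_pos hθ0, mul_inv_cancel₀ hθ0.ne', zero_add, one_mul] at d3
    rw [abs_of_pos hθ', mul_inv_cancel₀ hθ'.ne', add_sub_cancel, one_mul] at k3
    simp only [e1, integral_zero, sub_zero] at d3
    simp only [e2, integral_zero, zero_sub] at k3
    rw [h] at d3
    simp only [sub_zero]
    linarith
  · simp only [hf, hg₁, if_pos hθ0.le, sub_zero, zero_div]
  · simp only [hf, hg₂, if_neg (not_le.2 hθ1), div_self hθ'.ne']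
  · have q1 : ∫⁻ t in Ioo 0 θ, action e (f t) (U t) = ∫⁻ t in Ioo 0 θ, action e (g₁ t) (V₁ t) :=
      setLIntegral_congr_fun measurableSet_Ioo fun t ht => by simp only [u1 t ht, f1 t ht]
    have q2 : ∫⁻ t in Ioo θ 1, action e (f t) (U t) = ∫⁻ t in Ioo θ 1, action e (g₂ t) (V₂ t) :=
      setLIntegral_congr_fun measurableSet_Ioo fun t ht => by simp only [u2 t ht, f2 t ht]
    have q3 := lintegral_action_reparam (e := e) (f := f₁) (U := U₁) (a := 0) hθ0.ne'
    have q4 := lintegral_action_reparam (e := e) (f := f₂) (U := U₂) (a := θ) hθ'.ne'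
    rw [p1, abs_of_pos hθ0] at q3
    rw [p2, abs_of_pos hθ'] at q4
    rw [hsplit, lintegral_add_measure, q1, q2, ← hsplit, q3, q4]

lemma dA_le {μ ν : ProbabilityMeasure ℝ} {f : ℝ → ProbabilityMeasure ℝ}
    {U : ℝ → SignedMeasure OffDiag} (h : GCE e 1 μ ν f U) :
    dA e μ ν ≤ (∫⁻ t in Ioo (0 : ℝ) 1, action e (f t) (U t)) ^ (1 / 2 : ℝ) :=
  ENNReal.rpow_le_rpow (iInf_le_of_le f (iInf₂_le U h)) (by norm_num)

lemma rpow_half_ofReal_sq {c : ℝ} (hc : 0 ≤ c) :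
    ENNReal.ofReal (c ^ 2) ^ (1 / 2 : ℝ) = ENNReal.ofReal c := by
  rw [ENNReal.ofReal_rpow_of_nonneg (by positivity) (by norm_num), ← Real.sqrt_eq_rpow,
    Real.sqrt_sq hc]

/-- Near-minimisers replace minimisers throughout, so neither compactness nor lower semicontinuity
of the action is needed. -/
lemma exists_path_of_dA_lt {μ ν : ProbabilityMeasure ℝ} {c : ℝ} (hc : 0 ≤ c)
    (h : dA e μ ν < ENNReal.ofReal c) :
    ∃ f U, IsRegularSol e 1 f U ∧ f 0 = μ ∧ f 1 = ν ∧
      ∫⁻ t in Ioo (0 : ℝ) 1, action e (f t) (U t) < ENNReal.ofReal (c ^ 2) := by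
  rw [← rpow_half_ofReal_sq hc, dA, ENNReal.rpow_lt_rpow_iff (by norm_num)] at h
  simp only [iInf_lt_iff] at h
  obtain ⟨f, U, hfU, hlt⟩ := h
  obtain ⟨hg, hr⟩ := hfU.regularize zero_le_one
  refine ⟨_, _, hr, hg.left, hg.right, lt_of_eq_of_lt ?_ hlt⟩
  refine setLIntegral_congr_fun measurableSet_Ioo fun t ht => ?_
  simp only [projIcc_of_mem zero_le_one (Ioo_subset_Icc_self ht)]

lemma dA_comm_le (he1 : e < 1) (μ ν : ProbabilityMeasure ℝ) : dA e ν μ ≤ dA e μ ν := by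
  refine ENNReal.le_of_forall_pos_le_add fun ε hε hlt => ?_
  have h1 : dA e μ ν < ENNReal.ofReal ((dA e μ ν).toReal + ε) := by
    rw [ENNReal.ofReal_add ENNReal.toReal_nonneg ε.coe_nonneg, ENNReal.ofReal_toReal hlt.ne]
    exact ENNReal.lt_add_right hlt.ne (by simpa using hε.ne')
  obtain ⟨f, U, hr, h0, h1', hact⟩ := exists_path_of_dA_lt (by positivity) h1
  refine (dA_le (GCE.reverse he1 hr h0 h1')).trans ?_
  have := lintegral_action_reparam (e := e) (f := f) (U := U) (a := 1) (L := -1) (by norm_num)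
  rw [reflection_preimage_Ioo] at this
  rw [this]
  calc _ ≤ ENNReal.ofReal (((dA e μ ν).toReal + ε) ^ 2) ^ (1 / 2 : ℝ) := by
        refine ENNReal.rpow_le_rpow ?_ (by norm_num)
        simpa using hact.le
    _ = _ := by
        rw [rpow_half_ofReal_sq (by positivity), ENNReal.ofReal_add ENNReal.toReal_nonneg ε.coe_nonneg,
          ENNReal.ofReal_toReal hlt.ne, ENNReal.ofReal_coe_nnreal]

lemma dA_comm (he1 : e < 1) (μ ν : ProbabilityMeasure ℝ) : dA e μ ν = dA e ν μ :=
  le_antisymm (dA_comm_le he1 ν μ) (dA_comm_le he1 μ ν)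

lemma dA_triangle (he1 : e < 1) (μ ν ρ : ProbabilityMeasure ℝ) :
    dA e μ ρ ≤ dA e μ ν + dA e ν ρ := by
  refine ENNReal.le_of_forall_pos_le_add fun ε hε hlt => ?_
  obtain ⟨hlt1, hlt2⟩ := ENNReal.add_lt_top.1 hlt
  set a := (dA e μ ν).toReal + ε / 2 with ha
  set b := (dA e ν ρ).toReal + ε / 2 with hb
  have hε' : (0 : ℝ) < ε := hε
  have ha0 : 0 < a := by positivity
  have hb0 : 0 < b := by positivity
  have h1 : dA e μ ν < ENNReal.ofReal a := by
    rw [ENNReal.lt_ofReal_iff_toReal_lt hlt1.ne]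
    linarith
  have h2 : dA e ν ρ < ENNReal.ofReal b := by
    rw [ENNReal.lt_ofReal_iff_toReal_lt hlt2.ne]
    linarith
  obtain ⟨f₁, U₁, r1, s1, t1, c1⟩ := exists_path_of_dA_lt ha0.le h1
  obtain ⟨f₂, U₂, r2, s2, t2, c2⟩ := exists_path_of_dA_lt hb0.le h2
  -- Time is split in proportion to length: θ = a / (a + b) minimises a²/θ + b²/(1 - θ), with
  -- minimum (a + b)².
  have hθ : 0 < a / (a + b) := by positivity
  have hθ' : a / (a + b) < 1 := by rw [div_lt_one (by positivity)]; linarith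
  obtain ⟨f, U, hg, hact⟩ := GCE.concat he1 r1 r2 (t1.trans s2.symm) hθ hθ'
  rw [s1, t2] at hg
  refine (dA_le hg).trans ?_
  have e1 : ENNReal.ofReal (a / (a + b))⁻¹ * ENNReal.ofReal (a ^ 2) +
      ENNReal.ofReal (1 - a / (a + b))⁻¹ * ENNReal.ofReal (b ^ 2) =
      ENNReal.ofReal ((a + b) ^ 2) := by
    have hpos : 0 < 1 - a / (a + b) := sub_pos.2 hθ'
    rw [← ENNReal.ofReal_mul (by positivity), ← ENNReal.ofReal_mul (by positivity),
      ← ENNReal.ofReal_add (by positivity) (by positivity)]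
    congr 1
    have : 1 - a / (a + b) = b / (a + b) := by field_simp; ring
    rw [this]
    field_simp
  calc _ ≤ ENNReal.ofReal ((a + b) ^ 2) ^ (1 / 2 : ℝ) := by
        refine ENNReal.rpow_le_rpow ?_ (by norm_num)
        rw [hact, ← e1]
        gcongr
    _ = ENNReal.ofReal (a + b) := rpow_half_ofReal_sq (by positivity)
    _ = _ := by
        have : a + b = (dA e μ ν).toReal + (dA e ν ρ).toReal + ε := by
          rw [ha, hb]
          ring
        rw [this, ENNReal.ofReal_add (by positivity) ε.coe_nonneg,
          ENNReal.ofReal_add (by positivity) (by positivity), ENNReal.ofReal_toReal hlt1.ne,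
          ENNReal.ofReal_toReal hlt2.ne, ENNReal.ofReal_coe_nnreal]

end PseudoDistance

/-! ### Metric derivative of absolutely continuous curves -/

section MetricDerivative

lemma absolutelyContinuousOnInterval_of_dist_le {g I : ℝ → ℝ} {a b : ℝ}
    (hI : AbsolutelyContinuousOnInterval I a b)
    (h : ∀ s ∈ uIcc a b, ∀ t ∈ uIcc a b, dist (g s) (g t) ≤ dist (I s) (I t)) :
    AbsolutelyContinuousOnInterval g a b := by
  refine squeeze_zero' (Eventually.of_forall fun E => Finset.sum_nonneg fun _ _ => dist_nonneg)
    ?_ hI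
  filter_upwards [mem_inf_of_right (mem_principal_self _)] with E hE
  exact Finset.sum_le_sum fun i hi => h _ (hE.1 i hi).1 _ (hE.1 i hi).2

lemma abs_integral_le_integral_of_le {m : ℝ → ℝ} (hm : ∀ t, 0 ≤ m t) (s t : ℝ) :
    |∫ r in s..t, m r| = ∫ r in min s t..max s t, m r := by
  rcases le_total s t with h | h
  · rw [min_eq_left h, max_eq_right h,
      abs_of_nonneg (intervalIntegral.integral_nonneg h fun x _ => hm x)]
  · rw [min_eq_right h, max_eq_left h, intervalIntegral.integral_symm, abs_neg,
      abs_of_nonneg (intervalIntegral.integral_nonneg h fun x _ => hm x)]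

variable {X : Type*} {d : X → X → ℝ≥0∞} (dcomm : ∀ x y, d x y = d y x)
  (dtri : ∀ x y z, d x z ≤ d x y + d y z) {f : ℝ → X} {T : ℝ} (hT : 0 < T) {m : ℝ → ℝ}
  (hm : ∀ t, 0 ≤ m t) (hmi : IntegrableOn m (Icc 0 T))
  (hd : ∀ s t, 0 ≤ s → s ≤ t → t ≤ T → d (f s) (f t) ≤ ENNReal.ofReal (∫ r in s..t, m r))

include dcomm hm hd in
lemma toReal_dist_le {s t : ℝ} (hs : s ∈ Icc 0 T) (ht : t ∈ Icc 0 T) :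
    d (f s) (f t) ≠ ⊤ ∧ (d (f s) (f t)).toReal ≤ |∫ r in s..t, m r| := by
  have key : d (f s) (f t) ≤ ENNReal.ofReal |∫ r in s..t, m r| := by
    rw [abs_integral_le_integral_of_le hm]
    rcases le_total s t with h | h
    · rw [min_eq_left h, max_eq_right h]
      exact hd s t hs.1 h ht.2
    · rw [min_eq_right h, max_eq_left h, dcomm]
      exact hd t s ht.1 h hs.2
  refine ⟨ne_top_of_le_ne_top ENNReal.ofReal_ne_top key, ?_⟩
  exact ENNReal.toReal_le_of_le_ofReal (abs_nonneg _) key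

include dcomm dtri hm hd in
lemma abs_toReal_dist_sub_le {q s t : ℝ} (hq : q ∈ Icc 0 T) (hs : s ∈ Icc 0 T)
    (ht : t ∈ Icc 0 T) :
    |(d (f q) (f t)).toReal - (d (f q) (f s)).toReal| ≤ (d (f s) (f t)).toReal := by
  have fin := fun {s t : ℝ} (hs : s ∈ Icc 0 T) (ht : t ∈ Icc 0 T) =>
    (toReal_dist_le dcomm hm hd hs ht).1
  have h1 := ENNReal.toReal_mono (ENNReal.add_ne_top.2 ⟨fin hq hs, fin hs ht⟩)
    (dtri (f q) (f s) (f t))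
  have h2 := ENNReal.toReal_mono (ENNReal.add_ne_top.2 ⟨fin hq ht, fin ht hs⟩)
    (dtri (f q) (f t) (f s))
  rw [ENNReal.toReal_add (fin hq hs) (fin hs ht)] at h1
  rw [ENNReal.toReal_add (fin hq ht) (fin ht hs), dcomm (f t) (f s)] at h2
  rw [abs_le]
  constructor <;> linarith

include hmi in
lemma intervalIntegrable_of_mem {s t : ℝ} (hs : s ∈ Icc 0 T) (ht : t ∈ Icc 0 T) :
    IntervalIntegrable m volume s t := by
  have h : uIcc s t ⊆ Icc 0 T := uIcc_subset_Icc hs ht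
  exact (hmi.mono_set h).intervalIntegrable

include hT hmi in
lemma absolutelyContinuous_of_le_integral {g : ℝ → ℝ} {C : ℝ}
    (hg : ∀ s ∈ Icc 0 T, ∀ t ∈ Icc 0 T, |g s - g t| ≤ C * |∫ r in s..t, m r|) :
    AbsolutelyContinuousOnInterval g 0 T := by
  have hi : IntervalIntegrable (fun t => C * m t) volume 0 T :=
    (intervalIntegrable_of_mem hmi ⟨le_rfl, hT.le⟩ ⟨hT.le, le_rfl⟩).const_mul C
  refine absolutelyContinuousOnInterval_of_dist_le
    (hi.absolutelyContinuousOnInterval_intervalIntegral (c := 0) left_mem_uIcc) ?_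
  rw [uIcc_of_le hT.le]
  intro s hs t ht
  have hi' : ∀ {s t}, s ∈ Icc 0 T → t ∈ Icc 0 T →
      IntervalIntegrable (fun t => C * m t) volume s t := fun hs ht =>
    (intervalIntegrable_of_mem hmi hs ht).const_mul C
  have h0 : (0 : ℝ) ∈ Icc 0 T := ⟨le_rfl, hT.le⟩
  rw [Real.dist_eq, Real.dist_eq, intervalIntegral.integral_interval_sub_left (hi' h0 hs)
    (hi' h0 ht), intervalIntegral.integral_const_mul, abs_mul, intervalIntegral.integral_symm,
    abs_neg]
  exact (hg s hs t ht).trans (mul_le_mul_of_nonneg_right (le_abs_self C) (abs_nonneg _))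

lemma tendsto_abs_slope {g : ℝ → ℝ} {g' t : ℝ} (h : HasDerivAt g g' t) :
    Tendsto (fun h => |g (t + h) - g t| / |h|) (𝓝[≠] 0) (𝓝 |g'|) := by
  have := (hasDerivAt_iff_tendsto_slope_zero.1 h).abs
  refine this.congr fun h => ?_
  rw [smul_eq_mul, abs_mul, abs_inv]
  ring

lemma eventually_add_mem_Icc {t : ℝ} (ht : t ∈ Ioo 0 T) :
    ∀ᶠ h in 𝓝[≠] (0 : ℝ), t + h ∈ Icc 0 T ∧ h ≠ 0 := by
  have h1 : Tendsto (fun h : ℝ => t + h) (𝓝 0) (𝓝 (t + 0)) := tendsto_const_nhds.add tendsto_id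
  rw [add_zero] at h1
  exact (((h1.eventually (Ioo_mem_nhds ht.1 ht.2)).filter_mono nhdsWithin_le_nhds).and
    self_mem_nhdsWithin).mono fun h hh => ⟨Ioo_subset_Icc_self hh.1, hh.2⟩

include dcomm dtri hT hm hmi hd in
/-- Absolutely continuous curves in extended pseudo-distance spaces have a metric derivative. -/
theorem ae_tendsto_diffQuot :
    ∀ᵐ t ∂(volume.restrict (Ioo 0 T)),
      Tendsto (diffQuot d f t) (𝓝[≠] 0) (𝓝 (metricDeriv d f t)) ∧
        metricDeriv d f t ≤ ENNReal.ofReal (m t) := by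
  have h0 : (0 : ℝ) ∈ Icc 0 T := ⟨le_rfl, hT.le⟩
  have hTT : T ∈ Icc 0 T := ⟨hT.le, le_rfl⟩
  have hmono : ∀ᵐ t : ℝ, t ∈ Ioo 0 T → t ∈ uIcc 0 T := ae_of_all _ fun t ht => by
    rw [uIcc_of_le hT.le]
    exact Ioo_subset_Icc_self ht
  have hne : Nonempty (Icc (0 : ℝ) T) := ⟨⟨0, h0⟩⟩
  let q : ℕ → Icc (0 : ℝ) T := TopologicalSpace.denseSeq _
  have hq : DenseRange q := TopologicalSpace.denseRange_denseSeq _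
  let D : ℝ → ℝ → ℝ := fun s t => (d (f s) (f t)).toReal
  have hDfin := fun {s t : ℝ} (hs : s ∈ Icc 0 T) (ht : t ∈ Icc 0 T) =>
    toReal_dist_le dcomm hm hd hs ht
  -- Distances to the curve at a dense sequence of times. By the triangle inequality each is
  -- dominated by the primitive of m, hence absolutely continuous and differentiable almost
  -- everywhere.
  let g : ℕ → ℝ → ℝ := fun n t => D (q n) t
  have hg : ∀ n, ∀ s ∈ Icc 0 T, ∀ t ∈ Icc 0 T, |g n s - g n t| ≤ D s t := fun n s hs t ht => by
    rw [abs_sub_comm]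
    exact abs_toReal_dist_sub_le dcomm dtri hm hd (q n).2 hs ht
  have hgac : ∀ n, AbsolutelyContinuousOnInterval (g n) 0 T := fun n =>
    absolutelyContinuous_of_le_integral hT hmi (C := 1) fun s hs t ht => by
      rw [one_mul]
      exact (hg n s hs t ht).trans (hDfin hs ht).2
  have hI := (intervalIntegrable_of_mem hmi h0 hTT).ae_hasDerivAt_integral
  have hgd : ∀ᵐ t : ℝ, ∀ n, t ∈ uIcc 0 T → DifferentiableAt ℝ (g n) t :=
    ae_all_iff.2 fun n => (hgac n).ae_differentiableAt
  -- The candidate for the metric derivative. The family is bounded by m almost everywhere; where it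
  -- is unbounded the real supremum is zero by convention, which affects only a null set.
  let W : ℝ → ℝ := fun t => ⨆ n, |deriv (g n) t|
  have hWm : Measurable W := Measurable.iSup fun n => (measurable_deriv (g n)).abs
  have hbound : ∀ᵐ t : ℝ, t ∈ Ioo 0 T → ∀ n, |deriv (g n) t| ≤ m t := by
    filter_upwards [hI, hgd, hmono] with t h1 h2 h3 ht n
    have e1 := tendsto_abs_slope ((h2 n (h3 ht)).hasDerivAt)
    have e2 := tendsto_abs_slope (h1 (h3 ht) 0 left_mem_uIcc)
    rw [abs_of_nonneg (hm t)] at e2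
    refine le_of_tendsto_of_tendsto e1 e2 ?_
    filter_upwards [eventually_add_mem_Icc ht] with h hh
    have ht' := Ioo_subset_Icc_self ht
    refine div_le_div_of_nonneg_right ?_ (abs_nonneg h)
    rw [intervalIntegral.integral_interval_sub_left (intervalIntegrable_of_mem hmi h0 hh.1)
      (intervalIntegrable_of_mem hmi h0 ht'), intervalIntegral.integral_symm, abs_neg]
    exact (hg n _ hh.1 _ ht').trans (hDfin hh.1 ht').2
  have hW0 : ∀ t, 0 ≤ W t := fun t => Real.iSup_nonneg fun n => abs_nonneg _
  have hWle : ∀ᵐ t : ℝ, t ∈ Ioo 0 T → W t ≤ m t := by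
    filter_upwards [hbound] with t ht hmem
    exact ciSup_le (ht hmem)
  have hWi' : IntegrableOn W (Ioo 0 T) := by
    refine Integrable.mono' (hmi.mono_set Ioo_subset_Icc_self) hWm.aestronglyMeasurable ?_
    rw [ae_restrict_iff' measurableSet_Ioo]
    filter_upwards [hWle] with t ht hmem
    rw [Real.norm_eq_abs, abs_of_nonneg (hW0 t)]
    exact ht hmem
  have hWi : IntegrableOn W (Icc 0 T) := (integrableOn_Icc_iff_integrableOn_Ioo (by simp) (by simp)).2 hWi'
  have hgW : ∀ n, ∀ s ∈ Icc 0 T, ∀ t ∈ Icc 0 T, s ≤ t → |g n t - g n s| ≤ ∫ r in s..t, W r := by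
    intro n s hs t ht hst
    have hsub : uIcc s t ⊆ uIcc 0 T := by
      rw [uIcc_of_le hT.le]
      exact uIcc_subset_Icc hs ht
    rw [← ((hgac n).mono hsub).integral_deriv_eq_sub]
    refine intervalIntegral.abs_integral_le_integral_abs hst |>.trans ?_
    refine intervalIntegral.integral_mono_ae_restrict hst ?_
      (intervalIntegrable_of_mem hWi hs ht) ?_
    · exact ((hgac n).mono hsub).intervalIntegrable_deriv.abs
    · rw [Filter.EventuallyLE, ae_restrict_iff' measurableSet_Icc]
      have hn0 : ∀ᵐ r : ℝ, r ≠ 0 := by simp [ae_iff, measure_singleton]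
      have hnT : ∀ᵐ r : ℝ, r ≠ T := by simp [ae_iff, measure_singleton]
      filter_upwards [hbound, hn0, hnT] with r hr h0' hT' hrm
      have hr' : r ∈ Ioo 0 T := ⟨lt_of_le_of_ne (hs.1.trans hrm.1) (Ne.symm h0'),
        lt_of_le_of_ne (hrm.2.trans ht.2) hT'⟩
      exact le_ciSup (f := fun n => |deriv (g n) r|)
        ⟨m r, by rintro _ ⟨k, rfl⟩; exact hr hr' k⟩ n
  -- Choosing q n close to s makes D s t differ little from g n t - g n s, which is at most the
  -- integral of W.
  have hDW : ∀ s ∈ Icc 0 T, ∀ t ∈ Icc 0 T, s ≤ t → D s t ≤ ∫ r in s..t, W r := by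
    intro s hs t ht hst
    refine le_of_forall_pos_le_add fun ε hε => ?_
    have hc : Continuous fun x : Icc (0 : ℝ) T => |∫ r in s..x, m r| := by
      have h1 : ContinuousOn (fun x => ∫ r in s..x, m r) (Icc 0 T) := by
        have := intervalIntegral.continuousOn_primitive_interval' (b₁ := 0) (b₂ := T) (a := s)
          (intervalIntegrable_of_mem hmi h0 hTT) (by rwa [uIcc_of_le hT.le])
        rwa [uIcc_of_le hT.le] at this
      exact (h1.domRestrict).abs
    obtain ⟨n, hn⟩ := hq.exists_mem_open (isOpen_Iio.preimage hc : IsOpen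
      ((fun x : Icc (0 : ℝ) T => |∫ r in s..x, m r|) ⁻¹' Iio (ε / 2))) ⟨⟨s, hs⟩, by
        simpa using half_pos hε⟩
    have e1 := (hDfin hs (q n).2).2
    have e2 : D s t ≤ D s (q n) + D (q n) t := by
      have := ENNReal.toReal_mono (ENNReal.add_ne_top.2 ⟨(hDfin hs (q n).2).1,
        (hDfin (q n).2 ht).1⟩) (dtri (f s) (f (q n)) (f t))
      rwa [ENNReal.toReal_add (hDfin hs (q n).2).1 (hDfin (q n).2 ht).1] at this
    have e3 : D (q n) s = D s (q n) := by
      simp only [D]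
      rw [dcomm]
    have e4 := (le_abs_self _).trans (hgW n s hs t ht hst)
    have e5 : |∫ r in s..(q n), m r| < ε / 2 := hn
    change D (q n) t - D (q n) s ≤ _ at e4
    change D s (q n) ≤ _ at e1
    linarith
  have hJ := (intervalIntegrable_of_mem hWi h0 hTT).ae_hasDerivAt_integral
  rw [ae_restrict_iff' measurableSet_Ioo]
  filter_upwards [hJ, hgd, hbound, hWle, hmono] with t h1 h2 h3 h4 h5 ht
  have ht' := Ioo_subset_Icc_self ht
  -- The lower bound holds because D dominates the increments of every g n; the upper bound is `hDW`
  -- together with Lebesgue differentiation of the primitive of W.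
  have hr : Tendsto (fun h => D (t + h) t / |h|) (𝓝[≠] 0) (𝓝 (W t)) := by
    rw [tendsto_order]
    constructor
    · intro a ha
      obtain ⟨n, hn⟩ := exists_lt_of_lt_ciSup ha
      have e1 := tendsto_abs_slope ((h2 n (h5 ht)).hasDerivAt)
      filter_upwards [e1.eventually (lt_mem_nhds hn), eventually_add_mem_Icc ht] with h e2 e3
      refine e2.trans_le ?_
      refine div_le_div_of_nonneg_right ?_ (abs_nonneg h)
      exact hg n _ e3.1 _ ht'
    · intro a ha
      have e1 := tendsto_abs_slope (h1 (h5 ht) 0 left_mem_uIcc)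
      rw [abs_of_nonneg (hW0 t)] at e1
      filter_upwards [e1.eventually (gt_mem_nhds ha), eventually_add_mem_Icc ht] with h e2 e3
      refine lt_of_le_of_lt ?_ e2
      refine div_le_div_of_nonneg_right ?_ (abs_nonneg h)
      rw [intervalIntegral.integral_interval_sub_left (intervalIntegrable_of_mem hWi h0 e3.1)
        (intervalIntegrable_of_mem hWi h0 ht'), abs_integral_le_integral_of_le hW0]
      rcases le_total t (t + h) with hle | hle
      · rw [min_eq_left hle, max_eq_right hle]
        refine le_trans (le_of_eq ?_) (hDW _ ht' _ e3.1 hle)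
        simp only [D]
        rw [dcomm]
      · rw [min_eq_right hle, max_eq_left hle]
        exact hDW _ e3.1 _ ht' hle
  have hlim : Tendsto (diffQuot d f t) (𝓝[≠] 0) (𝓝 (ENNReal.ofReal (W t))) := by
    refine ((ENNReal.continuous_ofReal.tendsto _).comp hr).congr' ?_
    filter_upwards [eventually_add_mem_Icc ht] with h hh
    simp only [Function.comp, D, diffQuot]
    rw [ENNReal.ofReal_div_of_pos (abs_pos.2 hh.2), ENNReal.ofReal_toReal (hDfin hh.1 ht').1]
  have e : metricDeriv d f t = ENNReal.ofReal (W t) := hlim.limsup_eq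
  rw [e]
  exact ⟨hlim, ENNReal.ofReal_le_ofReal (h4 ht)⟩

end MetricDerivative

/-- The weight `√(1 + v²)` measuring first moments. -/
noncomputable def bracket (v : ℝ) : ℝ := √(1 + v ^ 2)

/-- The weighted square integral of the nonlocal gradient of `ψ` against `f ⊗ f`. -/
noncomputable def gradEnergy (e : ℝ) (ψ : ℝ → ℝ) (f : ProbabilityMeasure ℝ) : ℝ≥0∞ :=
  ∫⁻ p, ENNReal.ofReal (nlGrad ψ p ^ 2) * ENNReal.ofReal (sigma e p) ∂(prodOffDiag f)

/-! ### Functions of linear growth and their compactly supported approximations -/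

section Bracket

lemma one_le_bracket (v : ℝ) : 1 ≤ bracket v := by
  rw [bracket, Real.one_le_sqrt]
  nlinarith [sq_nonneg v]

lemma abs_le_bracket (v : ℝ) : |v| ≤ bracket v :=
  Real.abs_le_sqrt (by linarith)

lemma bracket_nonneg (v : ℝ) : 0 ≤ bracket v := Real.sqrt_nonneg _

lemma hasDerivAt_bracket (v : ℝ) : HasDerivAt bracket (v / bracket v) v := by
  have h1 : HasDerivAt (fun v : ℝ => 1 + v ^ 2) (2 * v) v := by
    simpa using (hasDerivAt_pow 2 v).const_add 1
  have h2 := h1.sqrt (by positivity)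
  have h3 : v / bracket v = 2 * v / (2 * √(1 + v ^ 2)) := by
    rw [mul_div_mul_left _ _ two_ne_zero]
    rfl
  rw [h3]
  exact h2

lemma contDiff_bracket : ContDiff ℝ 1 bracket :=
  ContDiff.sqrt (by fun_prop) fun v => by positivity

lemma continuous_bracket : Continuous bracket := contDiff_bracket.continuous

lemma abs_deriv_bracket_le (v : ℝ) : |deriv bracket v| ≤ 1 := by
  rw [(hasDerivAt_bracket v).deriv, abs_div, abs_of_nonneg (bracket_nonneg v)]
  exact div_le_one_of_le₀ (abs_le_bracket v) (bracket_nonneg v)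

variable {ψ : ℝ → ℝ} (hψ : ContDiff ℝ 1 ψ) {L : ℝ} (hL : ∀ v, |deriv ψ v| ≤ L)
include hψ hL

lemma abs_sub_le_of_deriv_le (v w : ℝ) : |ψ v - ψ w| ≤ L * |v - w| :=
  Convex.norm_image_sub_le_of_norm_deriv_le (𝕜 := ℝ) (s := univ)
    (fun x _ => (hψ.differentiable one_ne_zero) x) (fun x _ => hL x) convex_univ
    (mem_univ w) (mem_univ v)

lemma abs_le_bracket_of_deriv_le (v : ℝ) : |ψ v| ≤ (|ψ 0| + L) * bracket v := by
  have h1 := abs_sub_le_of_deriv_le hψ hL v 0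
  have h2 := one_le_bracket v
  have h3 := abs_le_bracket v
  have h4 : 0 ≤ L := (abs_nonneg _).trans (hL 0)
  have h5 : |ψ v| ≤ |ψ v - ψ 0| + |ψ 0| := by
    simpa using abs_add_le (ψ v - ψ 0) (ψ 0)
  rw [sub_zero] at h1
  nlinarith [abs_nonneg (ψ 0), mul_le_mul_of_nonneg_left h3 h4,
    mul_le_mul_of_nonneg_left h2 (abs_nonneg (ψ 0))]

lemma integrable_of_deriv_le {μ : Measure ℝ} (hμ : Integrable bracket μ) : Integrable ψ μ :=
  Integrable.mono' (hμ.const_mul (|ψ 0| + L)) hψ.continuous.aestronglyMeasurable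
    (ae_of_all _ (abs_le_bracket_of_deriv_le hψ hL))

/-- Approximation by compactly supported functions with uniformly bounded derivatives. -/
lemma exists_cutoff_seq : ∃ (F : ℕ → ℝ → ℝ) (L' : ℝ), (∀ n, ContDiff ℝ 1 (F n)) ∧
    (∀ n, HasCompactSupport (F n)) ∧ (∀ n v, |deriv (F n) v| ≤ L') ∧
    (∀ n v, |F n v| ≤ |ψ v|) ∧ (∀ n v, 0 ≤ ψ v → 0 ≤ F n v) ∧
    (∀ v, ∀ᶠ n in atTop, F n v = ψ v) ∧ (∀ v, ∀ᶠ n in atTop, deriv (F n) v = deriv ψ v) := by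
  let χ : ContDiffBump (0 : ℝ) := ⟨1, 2, one_pos, one_lt_two⟩
  have hχ : ContDiff ℝ 1 χ := χ.contDiff
  have hχd : ∀ x, HasDerivAt χ (deriv χ x) x := fun x =>
    ((hχ.differentiable one_ne_zero) x).hasDerivAt
  obtain ⟨K, hK⟩ := χ.hasCompactSupport.deriv.exists_bound_of_continuous
    (hχ.continuous_deriv le_rfl)
  have hK0 : 0 ≤ K := (norm_nonneg _).trans (hK 0)
  have hL0 : 0 ≤ L := (abs_nonneg _).trans (hL 0)
  have hχ0 : ∀ x : ℝ, 2 < |x| → deriv χ x = 0 := fun x hx => by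
    by_contra hne
    have := support_deriv_subset (f := χ) hne
    rw [χ.tsupport_eq, Metric.mem_closedBall, dist_zero_right, Real.norm_eq_abs] at this
    exact absurd this (not_le.2 hx)
  have hn : ∀ n : ℕ, (0 : ℝ) < n + 1 := fun n => by positivity
  let F : ℕ → ℝ → ℝ := fun n v => χ (v / (n + 1)) * ψ v
  have hFd : ∀ (n : ℕ) v, HasDerivAt (F n)
      (deriv χ (v / (n + 1)) * (1 / (n + 1)) * ψ v + χ (v / (n + 1)) * deriv ψ v) v := fun n v =>
    ((hχd _).comp v ((hasDerivAt_id v).div_const _)).mul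
      ((hψ.differentiable one_ne_zero) v).hasDerivAt
  have hlim : ∀ v : ℝ, ∀ᶠ n : ℕ in atTop, |v| < n + 1 := fun v => by
    filter_upwards [eventually_ge_atTop ⌈|v|⌉₊] with n hn
    have := (Nat.le_ceil |v|).trans (Nat.cast_le.2 hn)
    linarith
  have hone : ∀ (n : ℕ) (v : ℝ), |v| < n + 1 → χ =ᶠ[𝓝 (v / (n + 1))] 1 := fun n v hv => by
    refine χ.eventuallyEq_one_of_mem_ball ?_
    rw [Metric.mem_ball, dist_zero_right, Real.norm_eq_abs, abs_div, abs_of_pos (hn n),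
      div_lt_iff₀ (hn n)]
    simpa [χ] using hv
  -- The derivative of the cutoff is at most K/(n + 1) and vanishes for |v| > 2(n + 1). Where it is
  -- nonzero, |ψ v| ≤ |ψ 0| + 2L(n + 1), so the product is bounded uniformly in n; L comes from the
  -- derivative of ψ.
  refine ⟨F, K * (|ψ 0| + 2 * L) + L, fun n => (hχ.comp (by fun_prop)).mul hψ, fun n => ?_,
    fun n v => ?_, fun n v => ?_, fun n v hv => mul_nonneg χ.nonneg hv, fun v => ?_, fun v => ?_⟩
  · refine HasCompactSupport.intro (isCompact_closedBall (0 : ℝ) (2 * (n + 1))) fun v hv => ?_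
    have h1 : χ (v / (n + 1)) = 0 := by
      apply χ.zero_of_le_dist
      rw [dist_zero_right, Real.norm_eq_abs, abs_div, abs_of_pos (hn n), le_div_iff₀ (hn n)]
      rw [Metric.mem_closedBall, dist_zero_right, Real.norm_eq_abs, not_le] at hv
      exact hv.le
    simp only [F, h1, zero_mul]
  · rw [(hFd n v).deriv]
    have h2 : |χ (v / (n + 1)) * deriv ψ v| ≤ L := by
      rw [abs_mul, abs_of_nonneg χ.nonneg]
      calc _ ≤ 1 * |deriv ψ v| := mul_le_mul_of_nonneg_right χ.le_one (abs_nonneg _)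
        _ ≤ L := by rw [one_mul]; exact hL v
    have h1 : |deriv χ (v / (n + 1)) * (1 / (n + 1)) * ψ v| ≤ K * (|ψ 0| + 2 * L) := by
      rcases lt_or_ge 2 |v / ((n : ℝ) + 1)| with h | h
      · rw [hχ0 _ h]
        simp only [zero_mul, abs_zero]
        positivity
      · rw [abs_div, abs_of_pos (hn n), div_le_iff₀ (hn n)] at h
        rw [mul_assoc, abs_mul]
        refine mul_le_mul (hK _) ?_ (abs_nonneg _) hK0
        rw [abs_mul, abs_of_pos (one_div_pos.2 (hn n)), one_div, inv_mul_le_iff₀ (hn n)]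
        have h3 := abs_sub_le_of_deriv_le hψ hL v 0
        have h5 : |ψ v| ≤ |ψ v - ψ 0| + |ψ 0| := by
          simpa using abs_add_le (ψ v - ψ 0) (ψ 0)
        rw [sub_zero] at h3
        have h6 : L * |v| ≤ L * (2 * (n + 1)) := mul_le_mul_of_nonneg_left h hL0
        have h7 : |ψ 0| ≤ (n + 1) * |ψ 0| :=
          le_mul_of_one_le_left (abs_nonneg _) (by linarith [(Nat.cast_nonneg n : (0 : ℝ) ≤ n)])
        nlinarith
    exact (abs_add_le _ _).trans (add_le_add h1 h2)
  · simp only [F]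
    rw [abs_mul, abs_of_nonneg χ.nonneg]
    exact mul_le_of_le_one_left (abs_nonneg _) χ.le_one
  · filter_upwards [hlim v] with n hv
    have := (hone n v hv).eq_of_nhds
    simp only [F, this, Pi.one_apply, one_mul]
  · filter_upwards [hlim v] with n hv
    rw [(hFd n v).deriv, (hone n v hv).deriv_eq, (hone n v hv).eq_of_nhds]
    simp

end Bracket

/-! ### Evolution of integrals and first moments along solutions -/

section Evolution

lemma continuous_nlGrad_of_contDiff {ψ : ℝ → ℝ} (hψ : ContDiff ℝ 1 ψ) : Continuous (nlGrad ψ) := by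
  have := hψ.continuous_deriv le_rfl
  unfold nlGrad
  fun_prop

lemma abs_nlGrad_le {ψ : ℝ → ℝ} {L : ℝ} (hL : ∀ v, |deriv ψ v| ≤ L) (p : OffDiag) :
    |nlGrad ψ p| ≤ 2 * L := by
  rw [two_mul]
  exact (abs_sub _ _).trans (add_le_add (hL _) (hL _))

variable {e : ℝ} {f : ℝ → ProbabilityMeasure ℝ} {U : ℝ → SignedMeasure OffDiag}
  (he1 : e < 1) (h : IsRegularSol e 1 f U)

include h he1 in
-- Test with χ(t) ψ(v), where χ has compact support and equals one near [0, 1]; the time derivative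
-- disappears and only the flux remains.
lemma IsRegularSol.evolution_compact {b : ℝ} (hb0 : 0 < b) (hb1 : b ≤ 1) {ψ : ℝ → ℝ}
    (hψ : ContDiff ℝ 1 ψ) (hc : HasCompactSupport ψ) :
    ‖∫ v, ψ v ∂(f b : Measure ℝ) - ∫ v, ψ v ∂(f 0 : Measure ℝ)‖ₑ ≤
      ∫⁻ t in Ioo 0 b, ∫⁻ p, ‖nlGrad ψ p‖ₑ * ENNReal.ofReal (sigma e p) ∂(U t).totalVariation := by
  let χ : ContDiffBump (0 : ℝ) := ⟨2, 3, two_pos, by norm_num⟩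
  have hχ : ContDiff ℝ 1 χ := χ.contDiff
  have hone : ∀ t : ℝ, t ∈ Icc 0 1 → χ =ᶠ[𝓝 t] 1 := fun t ht => by
    refine χ.eventuallyEq_one_of_mem_ball ?_
    rw [Metric.mem_ball, dist_zero_right, Real.norm_eq_abs, abs_of_nonneg ht.1]
    exact lt_of_le_of_lt ht.2 one_lt_two
  have hone' : ∀ t : ℝ, t ∈ Icc 0 1 → χ t = 1 := fun t ht => (hone t ht).eq_of_nhds
  have hφ : ContDiff ℝ 1 fun z : ℝ × ℝ => χ z.1 * ψ z.2 :=
    (hχ.comp contDiff_fst).mul (hψ.comp contDiff_snd)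
  have hφc : HasCompactSupport fun z : ℝ × ℝ => χ z.1 * ψ z.2 := by
    refine HasCompactSupport.intro (χ.hasCompactSupport.isCompact.prod hc.isCompact) fun z hz => ?_
    by_contra hne
    exact hz ⟨subset_tsupport _ (left_ne_zero_of_mul hne),
      subset_tsupport _ (right_ne_zero_of_mul hne)⟩
  have hbf := h.boundary_formula he1 le_rfl hb0 hb1 hφ hφc
  have hsub : ∀ t ∈ Ioo 0 b, t ∈ Icc (0 : ℝ) 1 := fun t ht => ⟨ht.1.le, ht.2.le.trans hb1⟩
  have e1 : ∫ t in Ioo 0 b, ∫ v, deriv (fun r => χ r * ψ v) t ∂(f t : Measure ℝ) = 0 := by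
    refine setIntegral_eq_zero_of_forall_eq_zero fun t ht => ?_
    have : ∀ v, deriv (fun r => χ r * ψ v) t = 0 := fun v => by
      have : (fun r => χ r * ψ v) =ᶠ[𝓝 t] fun _ => ψ v := by
        filter_upwards [hone t (hsub t ht)] with r hr
        rw [hr, Pi.one_apply, one_mul]
      rw [this.deriv_eq, deriv_const]
    simp only [this, integral_zero]
  simp only [hone' 0 ⟨le_rfl, zero_le_one⟩, hone' b ⟨hb0.le, hb1⟩, one_mul] at hbf
  rw [hbf, e1, zero_add]
  refine (enorm_integral_le_lintegral_enorm _).trans (setLIntegral_mono' measurableSet_Ioo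
    fun t ht => ?_)
  simp only [hone' t (hsub t ht), one_mul]
  exact enorm_flux_le he1 _ _

include h in
-- Merging the fluxes over time into a single measure on the edge set allows a single dominated
-- convergence for the iterated integral.
lemma IsRegularSol.lintegral_bind_flux (s : Set ℝ) {F : OffDiag → ℝ≥0∞} (hF : Measurable F) :
    ∫⁻ p, F p ∂((volume.restrict s).bind fun t => (U t).totalVariation) =
      ∫⁻ t in s, ∫⁻ p, F p ∂(U t).totalVariation :=
  Measure.lintegral_bind (measurable_totalVariation h.meas).aemeasurable hF.aemeasurable

/-- First moments stay bounded along solutions. -/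
lemma IsRegularSol.exists_moment_bound (he1 : e < 1) (h : IsRegularSol e 1 f U)
    (h0 : Integrable bracket (f 0 : Measure ℝ)) :
    ∃ C : ℝ, ∀ b ∈ Icc (0 : ℝ) 1, Integrable bracket (f b : Measure ℝ) ∧
      ∫ v, bracket v ∂(f b : Measure ℝ) ≤ C := by
  obtain ⟨F, L, hF1, hF2, hF3, hF4, hF5, hF6, hF7⟩ :=
    exists_cutoff_seq contDiff_bracket abs_deriv_bracket_le
  set S₀ := ∫⁻ t in Ioo (0 : ℝ) 1, ∫⁻ p, ENNReal.ofReal (sigma e p) ∂(U t).totalVariation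
  have hS : S₀ < ⊤ := h.sol.integrability
  -- The truncations of `bracket` have derivatives bounded by L uniformly in n, so their nonlocal
  -- gradients are at most 2L. This bound depends on the flux of the path and serves only to make
  -- moments finite.
  set C := ∫ v, bracket v ∂(f 0 : Measure ℝ) + 2 * L * S₀.toReal
  have hL0 : 0 ≤ L := (abs_nonneg _).trans (hF3 0 0)
  have hN0 : 0 ≤ ∫ v, bracket v ∂(f 0 : Measure ℝ) := integral_nonneg bracket_nonneg
  have hFb : ∀ n v, 0 ≤ F n v := fun n v => hF5 n v (bracket_nonneg v)
  have hFi : ∀ n b, Integrable (F n) (f b : Measure ℝ) := fun n b => by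
    obtain ⟨K, hK⟩ := (hF2 n).exists_bound_of_continuous (hF1 n).continuous
    exact Integrable.of_bound (hF1 n).continuous.aestronglyMeasurable K (ae_of_all _ hK)
  have key : ∀ b ∈ Icc (0 : ℝ) 1, ∀ n, ∫ v, F n v ∂(f b : Measure ℝ) ≤ C := by
    intro b hb n
    have e0 : ∫ v, F n v ∂(f 0 : Measure ℝ) ≤ ∫ v, bracket v ∂(f 0 : Measure ℝ) :=
      integral_mono (hFi n 0) h0 fun v => by
        have := hF4 n v
        rwa [abs_of_nonneg (hFb n v), abs_of_nonneg (bracket_nonneg v)] at this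
    rcases hb.1.eq_or_lt with rfl | hb0
    · have : 0 ≤ 2 * L * S₀.toReal := by positivity
      simp only [C]
      linarith
    · have e1 := h.evolution_compact he1 hb0 hb.2 (hF1 n) (hF2 n)
      have e2 : ∫⁻ t in Ioo 0 b, ∫⁻ p, ‖nlGrad (F n) p‖ₑ * ENNReal.ofReal (sigma e p)
          ∂(U t).totalVariation ≤ ENNReal.ofReal (2 * L) * S₀ := by
        rw [← lintegral_const_mul' _ _ ENNReal.ofReal_ne_top]
        refine (lintegral_mono_set (Ioo_subset_Ioo_right hb.2)).trans (lintegral_mono fun t => ?_)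
        rw [← lintegral_const_mul' _ _ ENNReal.ofReal_ne_top]
        gcongr with p
        rw [Real.enorm_eq_ofReal_abs]
        exact ENNReal.ofReal_le_ofReal (abs_nlGrad_le (hF3 n) p)
      have e3 := e1.trans e2
      rw [Real.enorm_eq_ofReal_abs, ← ENNReal.ofReal_toReal hS.ne,
        ← ENNReal.ofReal_mul (by positivity), ENNReal.ofReal_le_ofReal_iff (by positivity)] at e3
      have e4 := (le_abs_self _).trans e3
      simp only [C]
      linarith
  have hfat : ∀ b ∈ Icc (0 : ℝ) 1,
      ∫⁻ v, ENNReal.ofReal (bracket v) ∂(f b : Measure ℝ) ≤ ENNReal.ofReal C := by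
    intro b hb
    calc ∫⁻ v, ENNReal.ofReal (bracket v) ∂(f b : Measure ℝ)
        = ∫⁻ v, liminf (fun n => ENNReal.ofReal (F n v)) atTop ∂(f b : Measure ℝ) := by
          congr 1
          ext v
          refine (Tendsto.liminf_eq (tendsto_const_nhds.congr' ?_)).symm
          filter_upwards [hF6 v] with n hn
          rw [hn]
      _ ≤ liminf (fun n => ∫⁻ v, ENNReal.ofReal (F n v) ∂(f b : Measure ℝ)) atTop :=
          lintegral_liminf_le fun n => (hF1 n).continuous.measurable.ennreal_ofReal
      _ ≤ ENNReal.ofReal C := by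
          refine liminf_le_of_le ?_ fun x hx => ?_
          · isBoundedDefault
          · obtain ⟨n, hn⟩ := hx.exists
            refine hn.trans ?_
            rw [← ofReal_integral_eq_lintegral_ofReal (hFi n b) (ae_of_all _ (hFb n))]
            exact ENNReal.ofReal_le_ofReal (key b hb n)
  refine ⟨C, fun b hb => ?_⟩
  have hint : Integrable bracket (f b : Measure ℝ) := by
    refine ⟨continuous_bracket.aestronglyMeasurable, ?_⟩
    rw [hasFiniteIntegral_iff_ofReal (ae_of_all _ bracket_nonneg)]
    exact (hfat b hb).trans_lt ENNReal.ofReal_lt_top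
  refine ⟨hint, ?_⟩
  have := hfat b hb
  rw [← ofReal_integral_eq_lintegral_ofReal hint (ae_of_all _ bracket_nonneg),
    ENNReal.ofReal_le_ofReal_iff] at this
  · exact this
  · have : 0 ≤ 2 * L * S₀.toReal := by positivity
    simp only [C]
    linarith

/-- The evolution inequality for test functions with bounded derivative. -/
lemma IsRegularSol.evolution (he1 : e < 1) (h : IsRegularSol e 1 f U)
    (h0 : Integrable bracket (f 0 : Measure ℝ)) {b : ℝ} (hb0 : 0 < b) (hb1 : b ≤ 1) {ψ : ℝ → ℝ}
    (hψ : ContDiff ℝ 1 ψ) {L : ℝ} (hL : ∀ v, |deriv ψ v| ≤ L) :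
    ‖∫ v, ψ v ∂(f b : Measure ℝ) - ∫ v, ψ v ∂(f 0 : Measure ℝ)‖ₑ ≤
      ∫⁻ t in Ioo 0 b, ∫⁻ p, ‖nlGrad ψ p‖ₑ * ENNReal.ofReal (sigma e p) ∂(U t).totalVariation := by
  obtain ⟨F, L', hF1, hF2, hF3, hF4, hF5, hF6, hF7⟩ := exists_cutoff_seq hψ hL
  obtain ⟨C, hC⟩ := h.exists_moment_bound he1 h0
  have hlim : ∀ a ∈ Icc (0 : ℝ) 1, Tendsto (fun n => ∫ v, F n v ∂(f a : Measure ℝ)) atTop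
      (𝓝 (∫ v, ψ v ∂(f a : Measure ℝ))) := fun a ha =>
    tendsto_integral_of_dominated_convergence (fun v => |ψ v|)
      (fun n => (hF1 n).continuous.aestronglyMeasurable)
      (integrable_of_deriv_le hψ hL (hC a ha).1).abs (fun n => ae_of_all _ (hF4 n))
      (ae_of_all _ fun v => tendsto_const_nhds.congr' ((hF6 v).mono fun n hn => hn.symm))
  have hl := ((hlim b ⟨hb0.le, hb1⟩).sub (hlim 0 ⟨le_rfl, zero_le_one⟩)).enorm
  have hmeas : ∀ {ψ : ℝ → ℝ}, ContDiff ℝ 1 ψ →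
      Measurable fun p : OffDiag => ‖nlGrad ψ p‖ₑ * ENNReal.ofReal (sigma e p) := fun hψ =>
    (continuous_nlGrad_of_contDiff hψ).measurable.enorm.mul (measurable_sigma e).ennreal_ofReal
  rw [← h.lintegral_bind_flux _ (hmeas hψ)]
  set M := (volume.restrict (Ioo 0 b)).bind fun t => (U t).totalVariation
  have hr : Tendsto (fun n => ∫⁻ p, ‖nlGrad (F n) p‖ₑ * ENNReal.ofReal (sigma e p) ∂M) atTop
      (𝓝 (∫⁻ p, ‖nlGrad ψ p‖ₑ * ENNReal.ofReal (sigma e p) ∂M)) := by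
    refine tendsto_lintegral_of_dominated_convergence
      (fun p => ENNReal.ofReal (2 * L') * ENNReal.ofReal (sigma e p)) (fun n => hmeas (hF1 n))
      (fun n => ae_of_all _ fun p => ?_) ?_ (ae_of_all _ fun p => ?_)
    · simp only
      gcongr
      rw [Real.enorm_eq_ofReal_abs]
      exact ENNReal.ofReal_le_ofReal (abs_nlGrad_le (hF3 n) p)
    · rw [lintegral_const_mul' _ _ ENNReal.ofReal_ne_top,
        h.lintegral_bind_flux _ (measurable_sigma e).ennreal_ofReal]
      refine ENNReal.mul_ne_top ENNReal.ofReal_ne_top (ne_of_lt ?_)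
      exact (lintegral_mono_set (Ioo_subset_Ioo_right hb1)).trans_lt h.sol.integrability
    · refine tendsto_const_nhds.congr' ?_
      filter_upwards [hF7 p.1.1, hF7 p.1.2] with n h1 h2
      simp only [nlGrad, h1, h2]
  refine le_of_tendsto_of_tendsto hl hr (Eventually.of_forall fun n => ?_)
  have := h.evolution_compact he1 hb0 hb1 (hF1 n) (hF2 n)
  rw [← h.lintegral_bind_flux _ (hmeas (hF1 n))] at this
  exact this

end Evolution

/-! ### The weighted square integral of the nonlocal gradient -/

section GradEnergy

variable {e : ℝ} {ψ : ℝ → ℝ} (f : ProbabilityMeasure ℝ)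

lemma gradEnergy_eq_lintegral_prod : gradEnergy e ψ f =
    ∫⁻ z : ℝ × ℝ, ENNReal.ofReal ((deriv ψ z.2 - deriv ψ z.1) ^ 2) *
      ENNReal.ofReal ((1 - e) / 4 * |z.1 - z.2|) ∂((f : Measure ℝ).prod (f : Measure ℝ)) :=
  lintegral_prodOffDiag (F := fun z : ℝ × ℝ => ENNReal.ofReal ((deriv ψ z.2 - deriv ψ z.1) ^ 2) *
      ENNReal.ofReal ((1 - e) / 4 * |z.1 - z.2|)) f fun v => by simp

/-- The squared gradient is at most 4L², and the weight at most one quarter of the sum of the two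
brackets. First moments therefore suffice for test functions with bounded derivative. -/
lemma gradEnergy_le (he0 : 0 ≤ e) (he1 : e < 1) {L : ℝ} (hL : ∀ v, |deriv ψ v| ≤ L)
    (hf : Integrable bracket (f : Measure ℝ)) :
    gradEnergy e ψ f ≤ ENNReal.ofReal (2 * L ^ 2 * ∫ v, bracket v ∂(f : Measure ℝ)) := by
  have hL0 : 0 ≤ L := (abs_nonneg _).trans (hL 0)
  have hi : Integrable (fun z : ℝ × ℝ => L ^ 2 * (bracket z.1 + bracket z.2))
      ((f : Measure ℝ).prod (f : Measure ℝ)) := ((hf.comp_fst _).add (hf.comp_snd _)).const_mul _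
  have h1 : ∫ z : ℝ × ℝ, L ^ 2 * (bracket z.1 + bracket z.2)
      ∂((f : Measure ℝ).prod (f : Measure ℝ)) = 2 * L ^ 2 * ∫ v, bracket v ∂(f : Measure ℝ) := by
    rw [integral_const_mul, integral_add (hf.comp_fst _) (hf.comp_snd _),
      integral_fun_fst, integral_fun_snd]
    simp
    ring
  rw [gradEnergy_eq_lintegral_prod, ← h1, ofReal_integral_eq_lintegral_ofReal hi
    (ae_of_all _ fun z => mul_nonneg (sq_nonneg _)
      (add_nonneg (bracket_nonneg _) (bracket_nonneg _)))]
  refine lintegral_mono fun z => ?_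
  rw [← ENNReal.ofReal_mul (sq_nonneg _)]
  refine ENNReal.ofReal_le_ofReal ?_
  have h2 : |deriv ψ z.2 - deriv ψ z.1| ≤ 2 * L := by
    rw [two_mul]
    exact (abs_sub _ _).trans (add_le_add (hL _) (hL _))
  have h3 : (deriv ψ z.2 - deriv ψ z.1) ^ 2 ≤ 4 * L ^ 2 := by
    rw [← sq_abs]
    calc _ ≤ (2 * L) ^ 2 := pow_le_pow_left₀ (abs_nonneg _) h2 2
      _ = _ := by ring
  have h4 : |z.1 - z.2| ≤ bracket z.1 + bracket z.2 :=
    (abs_sub _ _).trans (add_le_add (abs_le_bracket _) (abs_le_bracket _))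
  have h5 : (1 - e) / 4 * |z.1 - z.2| ≤ 1 / 4 * (bracket z.1 + bracket z.2) :=
    mul_le_mul (by linarith) h4 (abs_nonneg _) (by norm_num)
  calc _ ≤ 4 * L ^ 2 * (1 / 4 * (bracket z.1 + bracket z.2)) :=
        mul_le_mul h3 h5 (mul_nonneg (by linarith) (abs_nonneg _)) (by positivity)
    _ = _ := by ring

end GradEnergy

/-! ### Estimates along a path of bounded action -/

section PathEstimates

variable {e : ℝ} {f : ℝ → ProbabilityMeasure ℝ} {U : ℝ → SignedMeasure OffDiag}
  (he1 : e < 1) (h : IsRegularSol e 1 f U) (h0 : Integrable bracket (f 0 : Measure ℝ))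
  {c : ℝ} (hc : ∫⁻ t in Ioo (0 : ℝ) 1, action e (f t) (U t) ≤ ENNReal.ofReal (c ^ 2))

include he1 h h0 hc

/-- Using one δ for all times keeps the first Young term constant in time, so measurability of the
action density in time is not needed, as it would be for Cauchy–Schwarz. -/
lemma IsRegularSol.abs_integral_sub_le_young {b : ℝ} (hb : b ∈ Icc (0 : ℝ) 1) {ψ : ℝ → ℝ}
    (hψ : ContDiff ℝ 1 ψ) {L : ℝ} (hL : ∀ v, |deriv ψ v| ≤ L) {K : ℝ} (hK0 : 0 ≤ K)
    (hK : ∀ t ∈ Icc (0 : ℝ) 1, gradEnergy e ψ (f t) ≤ ENNReal.ofReal K) {δ : ℝ} (hδ : 0 < δ) :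
    |∫ v, ψ v ∂(f b : Measure ℝ) - ∫ v, ψ v ∂(f 0 : Measure ℝ)| ≤
      δ / 2 * K + 1 / (2 * δ) * c ^ 2 := by
  have hr : 0 ≤ δ / 2 * K + 1 / (2 * δ) * c ^ 2 := by positivity
  rcases hb.1.eq_or_lt with rfl | hb0
  · simpa using hr
  rw [← ENNReal.ofReal_le_ofReal_iff hr, ← Real.enorm_eq_ofReal_abs]
  refine (h.evolution he1 h0 hb0 hb.2 hψ hL).trans ?_
  calc _ ≤ ∫⁻ t in Ioo (0 : ℝ) 1, ∫⁻ p, ‖nlGrad ψ p‖ₑ * ENNReal.ofReal (sigma e p)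
        ∂(U t).totalVariation := lintegral_mono_set (Ioo_subset_Ioo_right hb.2)
    _ ≤ ∫⁻ t in Ioo (0 : ℝ) 1, (ENNReal.ofReal (δ / 2) * ENNReal.ofReal K +
        ENNReal.ofReal (1 / (2 * δ)) * action e (f t) (U t)) := by
      refine setLIntegral_mono' measurableSet_Ioo fun t ht => ?_
      refine (lintegral_flux_le_action e (f t) (U t)
        (continuous_nlGrad_of_contDiff hψ).measurable hδ).trans ?_
      gcongr
      exact hK t ⟨ht.1.le, ht.2.le⟩
    _ = ENNReal.ofReal (δ / 2) * ENNReal.ofReal K + ENNReal.ofReal (1 / (2 * δ)) *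
        ∫⁻ t in Ioo (0 : ℝ) 1, action e (f t) (U t) := by
      rw [lintegral_add_left measurable_const, lintegral_const, lintegral_const_mul' _ _ ENNReal.ofReal_ne_top]
      simp
    _ ≤ ENNReal.ofReal (δ / 2) * ENNReal.ofReal K + ENNReal.ofReal (1 / (2 * δ)) *
        ENNReal.ofReal (c ^ 2) := by gcongr
    _ = _ := by
      rw [← ENNReal.ofReal_mul (by positivity), ← ENNReal.ofReal_mul (by positivity),
        ← ENNReal.ofReal_add (by positivity) (by positivity)]

lemma IsRegularSol.abs_integral_sub_le_mul (hc0 : 0 < c) {b : ℝ} (hb : b ∈ Icc (0 : ℝ) 1)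
    {ψ : ℝ → ℝ} (hψ : ContDiff ℝ 1 ψ) {L : ℝ} (hL : ∀ v, |deriv ψ v| ≤ L) {k : ℝ} (hk0 : 0 < k)
    (hk : ∀ t ∈ Icc (0 : ℝ) 1, gradEnergy e ψ (f t) ≤ ENNReal.ofReal (k ^ 2)) :
    |∫ v, ψ v ∂(f b : Measure ℝ) - ∫ v, ψ v ∂(f 0 : Measure ℝ)| ≤ k * c := by
  -- δ = c/k makes the two Young terms equal, each being kc/2.
  refine (h.abs_integral_sub_le_young he1 h0 hc hb hψ hL (sq_nonneg k) hk
    (div_pos hc0 hk0)).trans_eq ?_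
  field_simp
  ring

/-- An absorption argument. With S the supremum of the first moments, `gradEnergy` of `bracket` is
at most 2S, and Young with δ = 1/2 gives N(b) ≤ N(0) + S/2 + c². Taking the supremum absorbs S/2,
which is legitimate since S is finite by `IsRegularSol.exists_moment_bound`. The new bound depends
on the path only through its initial moment and its action. -/
lemma IsRegularSol.integral_bracket_le (he0 : 0 ≤ e) {b : ℝ} (hb : b ∈ Icc (0 : ℝ) 1) :
    Integrable bracket (f b : Measure ℝ) ∧
    ∫ v, bracket v ∂(f b : Measure ℝ) ≤ 2 * ∫ v, bracket v ∂(f 0 : Measure ℝ) + 2 * c ^ 2 := by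
  obtain ⟨C, hC⟩ := h.exists_moment_bound he1 h0
  refine ⟨(hC b hb).1, ?_⟩
  let N : ℝ → ℝ := fun b => ∫ v, bracket v ∂(f b : Measure ℝ)
  set S := sSup (N '' Icc 0 1)
  have hbdd : BddAbove (N '' Icc 0 1) := ⟨C, by rintro _ ⟨b, hb, rfl⟩; exact (hC b hb).2⟩
  have hN : ∀ b ∈ Icc (0 : ℝ) 1, N b ≤ S := fun b hb => le_csSup hbdd ⟨b, hb, rfl⟩
  have hN0 : ∀ b, 0 ≤ N b := fun b => integral_nonneg bracket_nonneg
  have hS0 : 0 ≤ S := (hN0 b).trans (hN b hb)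
  have key : ∀ b ∈ Icc (0 : ℝ) 1, N b ≤ N 0 + S / 2 + c ^ 2 := fun b hb => by
    have := h.abs_integral_sub_le_young he1 h0 hc hb contDiff_bracket abs_deriv_bracket_le
      (K := 2 * S) (by positivity) (fun t ht => (gradEnergy_le (f t) he0 he1 abs_deriv_bracket_le
        (hC t ht).1).trans (ENNReal.ofReal_le_ofReal (by
          have := hN t ht
          simp only [N] at this
          linarith))) (δ := 1 / 2) (by norm_num)
    have h2 := (le_abs_self _).trans this
    simp only [N]
    norm_num at h2
    linarith
  have hS : S ≤ N 0 + S / 2 + c ^ 2 :=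
    csSup_le ⟨_, 0, ⟨le_rfl, zero_le_one⟩, rfl⟩ (by rintro _ ⟨b, hb, rfl⟩; exact key b hb)
  have := hN b hb
  simp only [N] at this hS
  linarith

lemma IsRegularSol.abs_integral_sub_le_of_deriv_le (he0 : 0 ≤ e) (hc0 : 0 < c) {b : ℝ}
    (hb : b ∈ Icc (0 : ℝ) 1) {ψ : ℝ → ℝ} (hψ : ContDiff ℝ 1 ψ) {L : ℝ} (hL0 : 0 < L)
    (hL : ∀ v, |deriv ψ v| ≤ L) :
    |∫ v, ψ v ∂(f b : Measure ℝ) - ∫ v, ψ v ∂(f 0 : Measure ℝ)| ≤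
      L * √(2 * (2 * ∫ v, bracket v ∂(f 0 : Measure ℝ) + 2 * c ^ 2)) * c := by
  have hN0 : 0 ≤ ∫ v, bracket v ∂(f 0 : Measure ℝ) := integral_nonneg bracket_nonneg
  refine h.abs_integral_sub_le_mul he1 h0 hc hc0 hb hψ hL (by positivity) fun t ht => ?_
  obtain ⟨h1, h2⟩ := h.integral_bracket_le he1 h0 hc he0 ht
  refine (gradEnergy_le (f t) he0 he1 hL h1).trans (ENNReal.ofReal_le_ofReal ?_)
  rw [mul_pow, Real.sq_sqrt (by positivity)]
  nlinarith [mul_le_mul_of_nonneg_left h2 (sq_nonneg L)]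

end PathEstimates

/-- A bounded increasing truncation of the identity at height `r`. -/
noncomputable def truncId (r v : ℝ) : ℝ := v / bracket (v / r)

/-- A truncation of `v² / 2` of linear growth, with derivative `truncId r`. -/
noncomputable def truncEnergy (r v : ℝ) : ℝ := r ^ 2 * (bracket (v / r) - 1)

/-- The integrand of the truncated dissipation. -/
noncomputable def pairEnergy (r v w : ℝ) : ℝ := |v - w| * (truncId r v - truncId r w) ^ 2

/-- The truncated dissipation. -/
noncomputable def truncDissipation (e r : ℝ) (f : ProbabilityMeasure ℝ) : ℝ :=
  (1 - e) / 4 * ∫ z, pairEnergy r z.1 z.2 ∂((f : Measure ℝ).prod (f : Measure ℝ))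

lemma bracket_pos (v : ℝ) : 0 < bracket v := one_pos.trans_le (one_le_bracket v)

lemma sq_bracket (v : ℝ) : bracket v ^ 2 = 1 + v ^ 2 := Real.sq_sqrt (by positivity)

lemma hasDerivAt_mul_abs_self (x : ℝ) : HasDerivAt (fun x : ℝ => x * |x|) (2 * |x|) x := by
  rcases lt_trichotomy x 0 with hx | rfl | hx
  · have h := (hasDerivAt_id x).mul (hasDerivAt_abs_neg hx)
    refine h.congr_deriv ?_
    simp only [id, abs_of_neg hx]
    ring
  · rw [hasDerivAt_iff_tendsto_slope]
    simp only [abs_zero, mul_zero]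
    have h : Tendsto (fun x : ℝ => |x|) (𝓝[≠] 0) (𝓝 0) :=
      tendsto_nhdsWithin_of_tendsto_nhds (by simpa using (continuous_abs.tendsto (0 : ℝ)))
    refine h.congr' ?_
    filter_upwards [self_mem_nhdsWithin] with y hy
    simp only [slope_def_field, mul_zero, abs_zero, sub_zero]
    exact (mul_div_cancel_left₀ _ hy).symm
  · have h := (hasDerivAt_id x).mul (hasDerivAt_abs_pos hx)
    refine h.congr_deriv ?_
    simp only [id, abs_of_pos hx]
    ring

lemma contDiff_mul_abs_self : ContDiff ℝ 1 fun x : ℝ => x * |x| := by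
  rw [contDiff_one_iff_deriv]
  refine ⟨fun x => (hasDerivAt_mul_abs_self x).differentiableAt, ?_⟩
  rw [funext fun x => (hasDerivAt_mul_abs_self x).deriv]
  fun_prop

/-! ### The truncated energy and its pair integrand -/

section Trunc

variable {r : ℝ} (hr : 0 < r)

lemma hasDerivAt_bracket_div (v : ℝ) :
    HasDerivAt (fun v => bracket (v / r)) (v / r / bracket (v / r) * (1 / r)) v :=
  HasDerivAt.comp (h₂ := bracket) (h := fun v => v / r) v (hasDerivAt_bracket (v / r))
    ((hasDerivAt_id v).div_const r)

include hr

lemma hasDerivAt_truncEnergy (v : ℝ) : HasDerivAt (truncEnergy r) (truncId r v) v := by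
  refine (((hasDerivAt_bracket_div v).sub_const 1).const_mul (r ^ 2)).congr_deriv ?_
  have := bracket_pos (v / r)
  rw [truncId]
  field_simp

lemma deriv_truncEnergy : deriv (truncEnergy r) = truncId r :=
  funext fun v => (hasDerivAt_truncEnergy hr v).deriv

lemma hasDerivAt_truncId (v : ℝ) : HasDerivAt (truncId r) (1 / bracket (v / r) ^ 3) v := by
  have hb := bracket_pos (v / r)
  refine ((hasDerivAt_id v).div (hasDerivAt_bracket_div v) hb.ne').congr_deriv ?_
  have h2 := sq_bracket (v / r)
  simp only [id]
  field_simp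
  field_simp at h2
  linear_combination h2

omit hr in
lemma contDiff_truncId : ContDiff ℝ 1 (truncId r) :=
  contDiff_id.div (contDiff_bracket.comp (by fun_prop)) fun v => (bracket_pos _).ne'

omit hr in
lemma continuous_truncId : Continuous (truncId r) := contDiff_truncId.continuous

omit hr in
lemma contDiff_truncEnergy : ContDiff ℝ 1 (truncEnergy r) :=
  contDiff_const.mul ((contDiff_bracket.comp (by fun_prop)).sub contDiff_const)

lemma abs_truncId_le (v : ℝ) : |truncId r v| ≤ r := by
  rw [truncId, abs_div, abs_of_pos (bracket_pos _), div_le_iff₀ (bracket_pos _)]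
  have := abs_le_bracket (v / r)
  rwa [abs_div, abs_of_pos hr, div_le_iff₀ hr, mul_comm] at this

omit hr in
lemma inv_bracket_pow_le_one (v : ℝ) : 1 / bracket v ^ 3 ≤ 1 :=
  div_le_one_of_le₀ (one_le_pow₀ (one_le_bracket _)) (pow_nonneg (bracket_nonneg _) _)

omit hr in
lemma inv_bracket_pow_nonneg (v : ℝ) : 0 ≤ 1 / bracket v ^ 3 :=
  div_nonneg zero_le_one (pow_nonneg (bracket_nonneg _) _)

lemma abs_truncId_sub_le (v w : ℝ) : |truncId r v - truncId r w| ≤ |v - w| := by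
  have := abs_sub_le_of_deriv_le (contDiff_truncId (r := r)) (L := 1) (fun v => by
    rw [(hasDerivAt_truncId hr v).deriv, abs_of_nonneg (inv_bracket_pow_nonneg _)]
    exact inv_bracket_pow_le_one _) v w
  rwa [one_mul] at this

lemma monotone_truncId : Monotone (truncId r) :=
  monotone_of_deriv_nonneg (contDiff_truncId.differentiable one_ne_zero) fun v => by
    rw [(hasDerivAt_truncId hr v).deriv]
    exact inv_bracket_pow_nonneg _

/-- As `truncId r` is increasing, both differences have the same sign, so the absolute value can be
moved onto the truncated difference. There it enters through x|x|, which is C¹, and the kink on the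
diagonal disappears. -/
lemma pairEnergy_eq (v w : ℝ) : pairEnergy r v w =
    (v - w) * ((truncId r v - truncId r w) * |truncId r v - truncId r w|) := by
  rw [pairEnergy]
  rcases le_total v w with h | h
  · rw [abs_of_nonpos (sub_nonpos.2 h), abs_of_nonpos (sub_nonpos.2 (monotone_truncId hr h))]
    ring
  · rw [abs_of_nonneg (sub_nonneg.2 h), abs_of_nonneg (sub_nonneg.2 (monotone_truncId hr h))]
    ring

lemma contDiff_pairEnergy (w : ℝ) : ContDiff ℝ 1 fun v => pairEnergy r v w := by
  simp only [pairEnergy_eq hr]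
  exact (contDiff_id.sub contDiff_const).mul
    (contDiff_mul_abs_self.comp (contDiff_truncId.sub contDiff_const))

omit hr in
lemma continuous_pairEnergy : Continuous fun z : ℝ × ℝ => pairEnergy r z.1 z.2 := by
  have := continuous_truncId (r := r)
  unfold pairEnergy
  fun_prop

omit hr in
lemma pairEnergy_nonneg (v w : ℝ) : 0 ≤ pairEnergy r v w :=
  mul_nonneg (abs_nonneg _) (sq_nonneg _)

omit hr in
lemma pairEnergy_comm (v w : ℝ) : pairEnergy r v w = pairEnergy r w v := by
  rw [pairEnergy, pairEnergy, abs_sub_comm]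
  ring

lemma abs_truncId_sub_le_const (v w : ℝ) : |truncId r v - truncId r w| ≤ 2 * r := by
  rw [two_mul]
  exact (abs_sub _ _).trans (add_le_add (abs_truncId_le hr _) (abs_truncId_le hr _))

lemma pairEnergy_le (v w : ℝ) : pairEnergy r v w ≤ 4 * r ^ 2 * (bracket v + bracket w) := by
  rw [pairEnergy, mul_comm, ← sq_abs]
  refine mul_le_mul ?_ ((abs_sub _ _).trans (add_le_add (abs_le_bracket _) (abs_le_bracket _)))
    (abs_nonneg _) (by positivity)
  calc _ ≤ (2 * r) ^ 2 := pow_le_pow_left₀ (abs_nonneg _) (abs_truncId_sub_le_const hr v w) 2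
    _ = _ := by ring

/-- The dangerous term is v times the derivative of `truncId r`. That derivative is the inverse cube
of `bracket (v / r)`, so the product equals `truncId r v` divided by the square of the bracket and
is at most r in absolute value. The bound is thus uniform in v and linear in `bracket w`. -/
lemma abs_deriv_pairEnergy_le (w v : ℝ) :
    |deriv (fun v => pairEnergy r v w) v| ≤ (8 * r ^ 2 + 4 * r) * bracket w := by
  have hb := one_le_bracket (v / r)
  have hd : HasDerivAt (fun v => pairEnergy r v w)
      (1 * ((truncId r v - truncId r w) * |truncId r v - truncId r w|) +
        (v - w) * (2 * |truncId r v - truncId r w| * (1 / bracket (v / r) ^ 3))) v := by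
    simp only [pairEnergy_eq hr]
    exact ((hasDerivAt_id v).sub_const w).mul ((hasDerivAt_mul_abs_self _).comp v
      ((hasDerivAt_truncId hr v).sub_const _))
  rw [hd.deriv, one_mul]
  have hΔ := abs_truncId_sub_le_const hr v w
  have h1 : |(v - w) * (1 / bracket (v / r) ^ 3)| ≤ r + bracket w := by
    rw [sub_mul]
    refine (abs_sub _ _).trans (add_le_add ?_ ?_)
    · have : v * (1 / bracket (v / r) ^ 3) = truncId r v * (1 / bracket (v / r) ^ 2) := by
        rw [truncId]
        field_simp
      rw [this, abs_mul]
      refine (mul_le_of_le_one_right (abs_nonneg _) ?_).trans (abs_truncId_le hr v)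
      rw [abs_of_nonneg (by positivity)]
      exact div_le_one_of_le₀ (one_le_pow₀ hb) (by positivity)
    · rw [abs_mul, abs_of_nonneg (inv_bracket_pow_nonneg _)]
      exact (mul_le_of_le_one_right (abs_nonneg _) (inv_bracket_pow_le_one _)).trans
        (abs_le_bracket w)
  have h2 : |(truncId r v - truncId r w) * (|truncId r v - truncId r w|)| ≤ 4 * r ^ 2 := by
    rw [abs_mul, abs_abs]
    nlinarith [mul_le_mul hΔ hΔ (abs_nonneg _) (by positivity)]
  have h3 : |(v - w) * (2 * |truncId r v - truncId r w| * (1 / bracket (v / r) ^ 3))| ≤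
      4 * r * (r + bracket w) := by
    rw [show (v - w) * (2 * |truncId r v - truncId r w| * (1 / bracket (v / r) ^ 3)) =
      2 * |truncId r v - truncId r w| * ((v - w) * (1 / bracket (v / r) ^ 3)) by ring, abs_mul]
    refine mul_le_mul ?_ h1 (abs_nonneg _) (by positivity)
    rw [abs_of_nonneg (by positivity)]
    linarith
  refine ((abs_add_le _ _).trans (add_le_add h2 h3)).trans ?_
  nlinarith [mul_le_mul_of_nonneg_left (one_le_bracket w) (sq_nonneg r)]

end Trunc

/-! ### Stability of the truncated dissipation -/

section TruncDissipation

variable {e r : ℝ} (hr : 0 < r)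

include hr in
lemma integrable_pairEnergy {μ ν : ProbabilityMeasure ℝ} (hμ : Integrable bracket (μ : Measure ℝ))
    (hν : Integrable bracket (ν : Measure ℝ)) :
    Integrable (fun z : ℝ × ℝ => pairEnergy r z.1 z.2) ((μ : Measure ℝ).prod (ν : Measure ℝ)) := by
  refine Integrable.mono' (((hμ.comp_fst _).add (hν.comp_snd _)).const_mul (4 * r ^ 2))
    continuous_pairEnergy.aestronglyMeasurable (ae_of_all _ fun z => ?_)
  rw [Real.norm_eq_abs, abs_of_nonneg (pairEnergy_nonneg _ _)]
  exact pairEnergy_le hr _ _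

lemma truncDissipation_nonneg (he1 : e < 1) (f : ProbabilityMeasure ℝ) :
    0 ≤ truncDissipation e r f :=
  mul_nonneg (by linarith) (integral_nonneg fun _ => pairEnergy_nonneg _ _)

include hr in
lemma gradEnergy_truncEnergy (he1 : e < 1) {f : ProbabilityMeasure ℝ}
    (hf : Integrable bracket (f : Measure ℝ)) :
    gradEnergy e (truncEnergy r) f = ENNReal.ofReal (truncDissipation e r f) := by
  rw [truncDissipation, ← integral_const_mul, ofReal_integral_eq_lintegral_ofReal
    ((integrable_pairEnergy hr hf hf).const_mul _)
    (ae_of_all _ fun z => mul_nonneg (by linarith) (pairEnergy_nonneg _ _)),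
    gradEnergy_eq_lintegral_prod, deriv_truncEnergy hr]
  refine lintegral_congr fun z => ?_
  rw [← ENNReal.ofReal_mul (sq_nonneg _), pairEnergy]
  congr 1
  ring

lemma integral_pairEnergy_comm (μ ν : ProbabilityMeasure ℝ) :
    ∫ z, pairEnergy r z.1 z.2 ∂((μ : Measure ℝ).prod (ν : Measure ℝ)) =
      ∫ z, pairEnergy r z.1 z.2 ∂((ν : Measure ℝ).prod (μ : Measure ℝ)) := by
  rw [← integral_prod_swap]
  simp only [Prod.fst_swap, Prod.snd_swap, pairEnergy_comm]

include hr in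
-- By Fubini, freeze w and apply H to the pair integrand as a function of v, with derivative bound
-- proportional to `bracket w`; then integrate over ρ.
lemma abs_integral_pairEnergy_sub_le {μ ν ρ : ProbabilityMeasure ℝ}
    (hμ : Integrable bracket (μ : Measure ℝ)) (hν : Integrable bracket (ν : Measure ℝ))
    (hρ : Integrable bracket (ρ : Measure ℝ)) {a : ℝ}
    (H : ∀ ψ : ℝ → ℝ, ContDiff ℝ 1 ψ → ∀ L > 0, (∀ v, |deriv ψ v| ≤ L) →
      |∫ v, ψ v ∂(ν : Measure ℝ) - ∫ v, ψ v ∂(μ : Measure ℝ)| ≤ L * a) :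
    |∫ z, pairEnergy r z.1 z.2 ∂((ν : Measure ℝ).prod (ρ : Measure ℝ)) -
      ∫ z, pairEnergy r z.1 z.2 ∂((μ : Measure ℝ).prod (ρ : Measure ℝ))| ≤
      (8 * r ^ 2 + 4 * r) * (∫ v, bracket v ∂(ρ : Measure ℝ)) * a := by
  have hνρ := integrable_pairEnergy hr hν hρ
  have hμρ := integrable_pairEnergy hr hμ hρ
  rw [integral_prod_symm _ hνρ, integral_prod_symm _ hμρ,
    ← integral_sub hνρ.integral_prod_right hμρ.integral_prod_right]
  rw [← Real.norm_eq_abs]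
  refine (norm_integral_le_of_norm_le (hρ.const_mul ((8 * r ^ 2 + 4 * r) * a))
    (ae_of_all _ fun w => ?_)).trans_eq ?_
  · refine (H _ (contDiff_pairEnergy hr w) ((8 * r ^ 2 + 4 * r) * bracket w)
      (mul_pos (by positivity) (bracket_pos w)) (abs_deriv_pairEnergy_le hr w)).trans_eq ?_
    ring
  · rw [integral_const_mul]
    ring

include hr in
lemma abs_truncDissipation_sub_le (he0 : 0 ≤ e) (he1 : e < 1) {μ ν : ProbabilityMeasure ℝ}
    (hμ : Integrable bracket (μ : Measure ℝ)) (hν : Integrable bracket (ν : Measure ℝ)) {a : ℝ}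
    (H : ∀ ψ : ℝ → ℝ, ContDiff ℝ 1 ψ → ∀ L > 0, (∀ v, |deriv ψ v| ≤ L) →
      |∫ v, ψ v ∂(ν : Measure ℝ) - ∫ v, ψ v ∂(μ : Measure ℝ)| ≤ L * a) :
    |truncDissipation e r ν - truncDissipation e r μ| ≤ (8 * r ^ 2 + 4 * r) *
      (∫ v, bracket v ∂(μ : Measure ℝ) + ∫ v, bracket v ∂(ν : Measure ℝ)) * a := by
  -- One factor of the product is exchanged at a time, passing from ν ⊗ ν through μ ⊗ ν to μ ⊗ μ.
  have h1 := abs_integral_pairEnergy_sub_le hr hμ hν hν H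
  have h2 := abs_integral_pairEnergy_sub_le hr hμ hν hμ H
  rw [integral_pairEnergy_comm ν μ] at h2
  rw [truncDissipation, truncDissipation, ← mul_sub, abs_mul, abs_of_nonneg (by linarith)]
  refine (mul_le_of_le_one_left (abs_nonneg _) (by linarith)).trans ?_
  refine (abs_sub_le _ _ _).trans ((add_le_add h1 h2).trans_eq ?_)
  ring

end TruncDissipation

/-! ### Estimates in terms of the transportation cost -/

section Distance

variable {e : ℝ} (he0 : 0 ≤ e) (he1 : e < 1) {μ ν : ProbabilityMeasure ℝ}
  (hμ : Integrable bracket (μ : Measure ℝ))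
include he0 he1 hμ

omit he0 he1 hμ in
-- An estimate for every path of action at most c² passes to the infimum by letting c decrease to
-- the distance. All such c are positive, so distance zero needs no separate treatment.
lemma le_of_forall_gt_toReal_dA (hd : dA e μ ν ≠ ⊤) {x : ℝ} {g : ℝ → ℝ} (hg : Continuous g)
    (H : ∀ (c : ℝ) (f : ℝ → ProbabilityMeasure ℝ) (U : ℝ → SignedMeasure OffDiag), 0 < c →
      IsRegularSol e 1 f U → f 0 = μ → f 1 = ν →
      ∫⁻ t in Ioo (0 : ℝ) 1, action e (f t) (U t) ≤ ENNReal.ofReal (c ^ 2) → x ≤ g c) :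
    x ≤ g (dA e μ ν).toReal := by
  refine ge_of_tendsto ((hg.tendsto _).mono_left nhdsWithin_le_nhds :
    Tendsto g (𝓝[>] (dA e μ ν).toReal) _) ?_
  filter_upwards [self_mem_nhdsWithin] with c hc
  have hc0 : 0 < c := ENNReal.toReal_nonneg.trans_lt hc
  obtain ⟨f, U, h, h0, h1, hA⟩ := exists_path_of_dA_lt (c := c) hc0.le
    ((ENNReal.lt_ofReal_iff_toReal_lt hd).2 hc)
  exact H c f U hc0 h h0 h1 hA.le

lemma integrable_bracket_of_dA_ne_top (hd : dA e μ ν ≠ ⊤) :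
    Integrable bracket (ν : Measure ℝ) := by
  obtain ⟨f, U, h, rfl, rfl, hA⟩ := exists_path_of_dA_lt (c := (dA e μ ν).toReal + 1)
    (by positivity) ((ENNReal.lt_ofReal_iff_toReal_lt hd).2 (lt_add_one _))
  exact (h.integral_bracket_le he1 hμ hA.le he0 ⟨zero_le_one, le_rfl⟩).1

lemma integral_bracket_le_dA (hd : dA e μ ν ≠ ⊤) :
    ∫ v, bracket v ∂(ν : Measure ℝ) ≤
      2 * ∫ v, bracket v ∂(μ : Measure ℝ) + 2 * (dA e μ ν).toReal ^ 2 := by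
  refine le_of_forall_gt_toReal_dA hd
    (g := fun c => 2 * ∫ v, bracket v ∂(μ : Measure ℝ) + 2 * c ^ 2) (by fun_prop)
    fun c f U hc h h0 h1 hA => ?_
  subst h0 h1
  exact (h.integral_bracket_le he1 hμ hA he0 ⟨zero_le_one, le_rfl⟩).2

lemma abs_integral_sub_le_dA (hd : dA e μ ν ≠ ⊤) {ψ : ℝ → ℝ} (hψ : ContDiff ℝ 1 ψ) {L : ℝ}
    (hL0 : 0 < L) (hL : ∀ v, |deriv ψ v| ≤ L) :
    |∫ v, ψ v ∂(ν : Measure ℝ) - ∫ v, ψ v ∂(μ : Measure ℝ)| ≤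
      L * (√(2 * (2 * ∫ v, bracket v ∂(μ : Measure ℝ) + 2 * (dA e μ ν).toReal ^ 2)) *
        (dA e μ ν).toReal) := by
  refine le_of_forall_gt_toReal_dA hd (g := fun c =>
    L * (√(2 * (2 * ∫ v, bracket v ∂(μ : Measure ℝ) + 2 * c ^ 2)) * c)) (by fun_prop)
    fun c f U hc h h0 h1 hA => ?_
  subst h0 h1
  rw [← mul_assoc]
  exact h.abs_integral_sub_le_of_deriv_le he1 hμ hA he0 hc ⟨zero_le_one, le_rfl⟩ hψ hL0 hL

/-- The change of the truncated energy is controlled by distance times truncated dissipation. -/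
lemma abs_integral_truncEnergy_sub_le_dA {r : ℝ} (hr : 0 < r) (hd : dA e μ ν ≠ ⊤) :
    |∫ v, truncEnergy r v ∂(ν : Measure ℝ) - ∫ v, truncEnergy r v ∂(μ : Measure ℝ)| ≤
      √(truncDissipation e r μ + (8 * r ^ 2 + 4 * r) *
        (∫ v, bracket v ∂(μ : Measure ℝ) +
          (2 * ∫ v, bracket v ∂(μ : Measure ℝ) + 2 * (dA e μ ν).toReal ^ 2)) *
        (√(2 * (2 * ∫ v, bracket v ∂(μ : Measure ℝ) + 2 * (dA e μ ν).toReal ^ 2)) *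
          (dA e μ ν).toReal)) * (dA e μ ν).toReal := by
  refine le_of_forall_gt_toReal_dA hd (g := fun c =>
    √(truncDissipation e r μ + (8 * r ^ 2 + 4 * r) *
        (∫ v, bracket v ∂(μ : Measure ℝ) + (2 * ∫ v, bracket v ∂(μ : Measure ℝ) + 2 * c ^ 2)) *
        (√(2 * (2 * ∫ v, bracket v ∂(μ : Measure ℝ) + 2 * c ^ 2)) * c)) * c) (by fun_prop)
    fun c f U hc h h0 h1 hA => ?_
  subst h0 h1
  have hq : 0 ≤ truncDissipation e r (f 0) := truncDissipation_nonneg he1 _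
  -- Strict positivity of the first moment keeps the radicand positive even when the truncated
  -- dissipation vanishes, as the choice δ = c/k requires.
  have hN : 0 < ∫ v, bracket v ∂(f 0 : Measure ℝ) := by
    have := integral_mono (integrable_const (1 : ℝ)) hμ one_le_bracket
    rw [integral_const, probReal_univ, one_smul] at this
    linarith
  refine h.abs_integral_sub_le_mul he1 hμ hA hc ⟨zero_le_one, le_rfl⟩ contDiff_truncEnergy
    (L := r) (fun v => ?_) (Real.sqrt_pos.2 (by positivity)) fun t ht => ?_
  · rw [deriv_truncEnergy hr]
    exact abs_truncId_le hr v
  · obtain ⟨hb1, hb2⟩ := h.integral_bracket_le he1 hμ hA he0 ht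
    rw [gradEnergy_truncEnergy hr he1 hb1, Real.sq_sqrt (by positivity)]
    refine ENNReal.ofReal_le_ofReal ?_
    -- At every time of the path the truncated dissipation is compared with its value at μ, so that
    -- the final constant involves the endpoint μ only.
    have := (le_abs_self _).trans (abs_truncDissipation_sub_le hr he0 he1 hμ hb1
      fun ψ hψ L hL0 hL => (h.abs_integral_sub_le_of_deriv_le he1 hμ hA he0 hc ht hψ hL0 hL).trans_eq
        (mul_assoc _ _ _))
    rw [sub_le_iff_le_add'] at this
    refine this.trans ?_
    gcongr

end Distance

/-! ### Removal of the truncation -/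

section Limits

lemma tendsto_bracket_div (v : ℝ) :
    Tendsto (fun n : ℕ => bracket (v / (n + 1))) atTop (𝓝 1) := by
  have h1 : Tendsto (fun n : ℕ => v / ((n : ℝ) + 1)) atTop (𝓝 0) :=
    tendsto_const_nhds.div_atTop
      (tendsto_atTop_add_const_right _ _ tendsto_natCast_atTop_atTop)
  have h2 := (continuous_bracket.tendsto 0).comp h1
  have h3 : bracket 0 = 1 := by simp [bracket]
  rwa [h3] at h2

lemma tendsto_truncId (v : ℝ) : Tendsto (fun n : ℕ => truncId (n + 1) v) atTop (𝓝 v) := by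
  have := (tendsto_const_nhds (x := v)).div (tendsto_bracket_div v) one_ne_zero
  rwa [div_one] at this

/-- Multiplying by the conjugate `bracket (v / r) + 1` removes the cancellation; the upper bound
v²/2 and the limit r → ∞ become visible. -/
lemma truncEnergy_eq {r : ℝ} (hr : 0 < r) (v : ℝ) :
    truncEnergy r v = v ^ 2 / (bracket (v / r) + 1) := by
  have h1 := sq_bracket (v / r)
  have h2 : bracket (v / r) + 1 ≠ 0 := by linarith [bracket_pos (v / r)]
  rw [truncEnergy, eq_div_iff h2]
  field_simp at h1 ⊢
  linear_combination h1

lemma truncEnergy_nonneg (r v : ℝ) : 0 ≤ truncEnergy r v :=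
  mul_nonneg (sq_nonneg _) (sub_nonneg.2 (one_le_bracket _))

lemma truncEnergy_le {r : ℝ} (hr : 0 < r) (v : ℝ) : truncEnergy r v ≤ 2⁻¹ * v ^ 2 := by
  rw [truncEnergy_eq hr, inv_mul_eq_div]
  have := one_le_bracket (v / r)
  exact div_le_div_of_nonneg_left (sq_nonneg v) two_pos (by linarith)

lemma tendsto_truncEnergy (v : ℝ) :
    Tendsto (fun n : ℕ => truncEnergy (n + 1) v) atTop (𝓝 (2⁻¹ * v ^ 2)) := by
  have h := (tendsto_const_nhds (x := v ^ 2)).div ((tendsto_bracket_div v).add_const 1)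
    (by norm_num)
  rw [show v ^ 2 / ((1 : ℝ) + 1) = 2⁻¹ * v ^ 2 by ring] at h
  exact h.congr fun n => (truncEnergy_eq (by positivity) v).symm

variable {f : ProbabilityMeasure ℝ}

lemma energy_eq_lintegral (f : ProbabilityMeasure ℝ) :
    energy f = ∫⁻ v, ENNReal.ofReal (2⁻¹ * v ^ 2) ∂(f : Measure ℝ) := by
  rw [energy, ← lintegral_const_mul' _ _ (by simp)]
  refine lintegral_congr fun v => ?_
  rw [ENNReal.ofReal_mul (by norm_num), ENNReal.ofReal_inv_of_pos two_pos, ENNReal.ofReal_ofNat]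

variable (hf : Integrable bracket (f : Measure ℝ))
include hf

lemma ofReal_integral_truncEnergy {r : ℝ} (hr : 0 < r) :
    ENNReal.ofReal (∫ v, truncEnergy r v ∂(f : Measure ℝ)) =
      ∫⁻ v, ENNReal.ofReal (truncEnergy r v) ∂(f : Measure ℝ) :=
  ofReal_integral_eq_lintegral_ofReal (integrable_of_deriv_le contDiff_truncEnergy
    (L := r) (fun v => by rw [deriv_truncEnergy hr]; exact abs_truncId_le hr v) hf)
    (ae_of_all _ (truncEnergy_nonneg r))

lemma ofReal_integral_truncEnergy_le {r : ℝ} (hr : 0 < r) :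
    ENNReal.ofReal (∫ v, truncEnergy r v ∂(f : Measure ℝ)) ≤ energy f := by
  rw [ofReal_integral_truncEnergy hf hr, energy_eq_lintegral]
  exact lintegral_mono fun v => ENNReal.ofReal_le_ofReal (truncEnergy_le hr v)

lemma energy_le_of_forall_trunc {a : ℝ≥0∞}
    (h : ∀ n : ℕ, ENNReal.ofReal (∫ v, truncEnergy (n + 1) v ∂(f : Measure ℝ)) ≤ a) :
    energy f ≤ a := by
  calc energy f = ∫⁻ v, liminf (fun n : ℕ => ENNReal.ofReal (truncEnergy (n + 1) v)) atTop
        ∂(f : Measure ℝ) := by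
        rw [energy_eq_lintegral]
        refine lintegral_congr fun v => ?_
        exact (ENNReal.tendsto_ofReal (tendsto_truncEnergy v)).liminf_eq.symm
    _ ≤ liminf (fun n : ℕ => ∫⁻ v, ENNReal.ofReal (truncEnergy (n + 1) v) ∂(f : Measure ℝ))
        atTop := lintegral_liminf_le fun n =>
          contDiff_truncEnergy.continuous.measurable.ennreal_ofReal
    _ ≤ a := by
        refine liminf_le_of_le (by isBoundedDefault) fun x hx => ?_
        obtain ⟨n, hn⟩ := hx.exists
        refine hn.trans ?_
        rw [← ofReal_integral_truncEnergy hf (by positivity)]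
        exact h n

variable {e : ℝ} (he1 : e < 1)
include he1

omit hf he1 in
lemma dissipation_eq_lintegral : dissipation e f = ∫⁻ z : ℝ × ℝ,
    ENNReal.ofReal ((1 - e) / 4 * (|z.1 - z.2| * (z.1 - z.2) ^ 2))
      ∂((f : Measure ℝ).prod (f : Measure ℝ)) := by
  rw [← lintegral_prodOffDiag (F := fun z : ℝ × ℝ =>
    ENNReal.ofReal ((1 - e) / 4 * (|z.1 - z.2| * (z.1 - z.2) ^ 2))) f fun v => by simp]
  refine lintegral_congr fun p => ?_
  rw [sigma, sq_abs]
  congr 1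
  ring

lemma ofReal_truncDissipation {r : ℝ} (hr : 0 < r) :
    ENNReal.ofReal (truncDissipation e r f) = ∫⁻ z : ℝ × ℝ,
      ENNReal.ofReal ((1 - e) / 4 * pairEnergy r z.1 z.2)
        ∂((f : Measure ℝ).prod (f : Measure ℝ)) := by
  rw [truncDissipation, ← integral_const_mul]
  exact ofReal_integral_eq_lintegral_ofReal ((integrable_pairEnergy hr hf hf).const_mul _)
    (ae_of_all _ fun z => mul_nonneg (by linarith) (pairEnergy_nonneg _ _))

lemma ofReal_truncDissipation_le {r : ℝ} (hr : 0 < r) :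
    ENNReal.ofReal (truncDissipation e r f) ≤ dissipation e f := by
  rw [ofReal_truncDissipation hf he1 hr, dissipation_eq_lintegral]
  refine lintegral_mono fun z => ENNReal.ofReal_le_ofReal ?_
  refine mul_le_mul_of_nonneg_left ?_ (by linarith)
  exact mul_le_mul_of_nonneg_left (sq_le_sq.2 (abs_truncId_sub_le hr _ _)) (abs_nonneg _)

/-- One inequality is Fatou, the other holds because `truncId r` is 1-Lipschitz, so every truncated
dissipation is below the full one. The formula transfers measurability in time from the truncated
dissipations. -/
lemma dissipation_eq_liminf : dissipation e f =
    liminf (fun n : ℕ => ENNReal.ofReal (truncDissipation e (n + 1) f)) atTop := by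
  refine le_antisymm ?_ ?_
  · calc dissipation e f = ∫⁻ z : ℝ × ℝ, liminf (fun n : ℕ =>
          ENNReal.ofReal ((1 - e) / 4 * pairEnergy (n + 1) z.1 z.2)) atTop
          ∂((f : Measure ℝ).prod (f : Measure ℝ)) := by
          rw [dissipation_eq_lintegral]
          refine lintegral_congr fun z => ?_
          exact (ENNReal.tendsto_ofReal ((((tendsto_truncId z.1).sub
            (tendsto_truncId z.2)).pow 2).const_mul _ |>.const_mul _)).liminf_eq.symm
      _ ≤ liminf (fun n : ℕ => ∫⁻ z : ℝ × ℝ,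
          ENNReal.ofReal ((1 - e) / 4 * pairEnergy (n + 1) z.1 z.2)
          ∂((f : Measure ℝ).prod (f : Measure ℝ))) atTop :=
          lintegral_liminf_le fun n =>
            (continuous_pairEnergy.measurable.const_mul _).ennreal_ofReal
      _ = _ := by
          congr 1
          ext n
          exact (ofReal_truncDissipation hf he1 (by positivity)).symm
  · refine liminf_le_of_le (by isBoundedDefault) fun x hx => ?_
    obtain ⟨n, hn⟩ := hx.exists
    exact hn.trans (ofReal_truncDissipation_le hf he1 (by positivity))

end Limits

lemma abs_intervalIntegral_le {m : ℝ → ℝ} (hm : ∀ t, 0 ≤ m t) {T : ℝ} (hT : 0 < T)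
    (hmi : IntegrableOn m (Icc 0 T)) {s t : ℝ} (hs : s ∈ Icc 0 T) (ht : t ∈ Icc 0 T) :
    |∫ r in s..t, m r| ≤ ∫ r in (0 : ℝ)..T, m r := by
  rw [abs_integral_le_integral_of_le hm]
  exact intervalIntegral.integral_mono_interval (le_min hs.1 ht.1) min_le_max
    (max_le hs.2 ht.2) (ae_of_all _ hm)
    (intervalIntegrable_of_mem hmi ⟨le_rfl, hT.le⟩ ⟨hT.le, le_rfl⟩)

lemma integrable_bracket_of_mem_P2cm {f : ProbabilityMeasure ℝ} (hf : f ∈ P2cm) :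
    Integrable bracket (f : Measure ℝ) := by
  refine Integrable.mono' ((integrable_const (1 : ℝ)).add hf.1)
    continuous_bracket.aestronglyMeasurable (ae_of_all _ fun v => ?_)
  rw [Real.norm_eq_abs, abs_of_nonneg (bracket_nonneg v)]
  simp only [Pi.add_apply]
  rw [← sq_bracket]
  nlinarith [one_le_bracket v]

/-! ### The chain rule along an absolutely continuous curve -/

section Curve

variable {e : ℝ} (he0 : 0 ≤ e) (he1 : e < 1) {T : ℝ} (hT : 0 < T) {m : ℝ → ℝ}
  (hm : ∀ t, 0 ≤ m t) (hmi : IntegrableOn m (Icc 0 T)) {f : ℝ → ProbabilityMeasure ℝ}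
  (hd : ∀ s t, 0 ≤ s → s ≤ t → t ≤ T → dA e (f s) (f t) ≤ ENNReal.ofReal (∫ r in s..t, m r))
  (h0 : Integrable bracket (f 0 : Measure ℝ))
include he0 he1 hT hm hmi hd h0

lemma exists_moment_bound_curve : ∃ N : ℝ, 0 ≤ N ∧ ∀ t ∈ Icc 0 T,
    Integrable bracket (f t : Measure ℝ) ∧ ∫ v, bracket v ∂(f t : Measure ℝ) ≤ N := by
  have hN0 : 0 ≤ ∫ v, bracket v ∂(f 0 : Measure ℝ) := integral_nonneg bracket_nonneg
  refine ⟨2 * ∫ v, bracket v ∂(f 0 : Measure ℝ) + 2 * (∫ r in (0 : ℝ)..T, m r) ^ 2,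
    by positivity, fun t ht => ?_⟩
  have h00 : (0 : ℝ) ∈ Icc 0 T := ⟨le_rfl, hT.le⟩
  obtain ⟨h1, h2⟩ := toReal_dist_le (dA_comm he1) hm hd h00 ht
  refine ⟨integrable_bracket_of_dA_ne_top he0 he1 h0 h1,
    (integral_bracket_le_dA he0 he1 h0 h1).trans ?_⟩
  have h3 := h2.trans (abs_intervalIntegral_le hm hT hmi h00 ht)
  gcongr

/-- Along the curve, test functions with bounded derivative vary at most like `∫ m`. -/
lemma exists_lipschitz_curve : ∃ A : ℝ, 0 ≤ A ∧ ∀ s ∈ Icc 0 T, ∀ t ∈ Icc 0 T, ∀ ψ : ℝ → ℝ,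
    ContDiff ℝ 1 ψ → ∀ L > 0, (∀ v, |deriv ψ v| ≤ L) →
    |∫ v, ψ v ∂(f s : Measure ℝ) - ∫ v, ψ v ∂(f t : Measure ℝ)| ≤
      L * (A * |∫ r in s..t, m r|) := by
  obtain ⟨N, hN0, hN⟩ := exists_moment_bound_curve he0 he1 hT hm hmi hd h0
  refine ⟨√(2 * (2 * N + 2 * (∫ r in (0 : ℝ)..T, m r) ^ 2)), Real.sqrt_nonneg _,
    fun s hs t ht ψ hψ L hL0 hL => ?_⟩
  obtain ⟨h1, h2⟩ := toReal_dist_le (dA_comm he1) hm hd hs ht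
  have h3 := h2.trans (abs_intervalIntegral_le hm hT hmi hs ht)
  have h4 := (hN s hs).2
  rw [abs_sub_comm]
  refine (abs_integral_sub_le_dA he0 he1 (hN s hs).1 h1 hψ hL0 hL).trans ?_
  gcongr

lemma continuousOn_truncDissipation {r : ℝ} (hr : 0 < r) :
    ContinuousOn (fun t => truncDissipation e r (f t)) (Icc 0 T) := by
  obtain ⟨N, hN0, hN⟩ := exists_moment_bound_curve he0 he1 hT hm hmi hd h0
  obtain ⟨A, hA0, hA⟩ := exists_lipschitz_curve he0 he1 hT hm hmi hd h0
  have := (absolutelyContinuous_of_le_integral hT hmi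
    (g := fun t => truncDissipation e r (f t)) (C := (8 * r ^ 2 + 4 * r) * (N + N) * A)
    fun s hs t ht => ?_).continuousOn
  · rwa [uIcc_of_le hT.le] at this
  · refine (abs_truncDissipation_sub_le hr he0 he1 (hN t ht).1 (hN s hs).1
      (hA s hs t ht)).trans ?_
    rw [← mul_assoc]
    have h1 := (hN t ht).2
    have h2 := (hN s hs).2
    gcongr

lemma measurable_dissipation_curve :
    Measurable fun t : Icc (0 : ℝ) T => dissipation e (f t) := by
  obtain ⟨N, hN0, hN⟩ := exists_moment_bound_curve he0 he1 hT hm hmi hd h0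
  have h1 : (fun t : Icc (0 : ℝ) T => dissipation e (f t)) = fun t : Icc (0 : ℝ) T =>
      liminf (fun n : ℕ => ENNReal.ofReal (truncDissipation e (n + 1) (f t))) atTop :=
    funext fun t => dissipation_eq_liminf (hN t t.2).1 he1
  rw [h1]
  exact Measurable.liminf fun n => (continuousOn_iff_continuous_domRestrict.1
    (continuousOn_truncDissipation he0 he1 hT hm hmi hd h0
      (by positivity : (0 : ℝ) < n + 1))).measurable.ennreal_ofReal

omit he0 hT hm hmi hd h0 in
lemma tendsto_toReal_diffQuot {t : ℝ}
    (hlim : Tendsto (diffQuot (dA e) f t) (𝓝[≠] 0) (𝓝 (metricDeriv (dA e) f t)))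
    (hfin : metricDeriv (dA e) f t ≠ ⊤) :
    Tendsto (fun h => (dA e (f t) (f (t + h))).toReal / |h|) (𝓝[≠] 0)
      (𝓝 (metricDeriv (dA e) f t).toReal) := by
  refine ((ENNReal.tendsto_toReal hfin).comp hlim).congr fun h => ?_
  rw [Function.comp_apply, diffQuot, ENNReal.toReal_div, ENNReal.toReal_ofReal (abs_nonneg _),
    dA_comm he1]

/-- The chain rule estimate for the truncated energy along the curve. -/
lemma abs_deriv_truncEnergy_curve_le {r : ℝ} (hr : 0 < r) {t : ℝ} (ht : t ∈ Ioo 0 T)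
    (hlim : Tendsto (diffQuot (dA e) f t) (𝓝[≠] 0) (𝓝 (metricDeriv (dA e) f t)))
    (hfin : metricDeriv (dA e) f t ≠ ⊤) {G' : ℝ}
    (hG : HasDerivAt (fun t => ∫ v, truncEnergy r v ∂(f t : Measure ℝ)) G' t) :
    |G'| ≤ √(truncDissipation e r (f t)) * (metricDeriv (dA e) f t).toReal := by
  obtain ⟨N, hN0, hN⟩ := exists_moment_bound_curve he0 he1 hT hm hmi hd h0
  have htI := Ioo_subset_Icc_self ht
  set d : ℝ → ℝ := fun h => (dA e (f t) (f (t + h))).toReal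
  have hq : Tendsto (fun h => d h / |h|) (𝓝[≠] 0) (𝓝 (metricDeriv (dA e) f t).toReal) :=
    tendsto_toReal_diffQuot he1 hlim hfin
  have hd0 : Tendsto d (𝓝[≠] 0) (𝓝 0) := by
    have h1 : Tendsto (fun h : ℝ => |h|) (𝓝[≠] 0) (𝓝 0) :=
      tendsto_nhdsWithin_of_tendsto_nhds (by simpa using (continuous_abs.tendsto (0 : ℝ)))
    have h2 := hq.mul h1
    rw [mul_zero] at h2
    refine h2.congr' ?_
    filter_upwards [self_mem_nhdsWithin] with h hh
    exact div_mul_cancel₀ _ (abs_ne_zero.2 hh)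
  -- The factor in the distance estimate, as a function of the distance c. It is continuous, and at
  -- c = 0 only the truncated dissipation at time t survives.
  let S : ℝ → ℝ := fun c => √(truncDissipation e r (f t) + (8 * r ^ 2 + 4 * r) *
    (∫ v, bracket v ∂(f t : Measure ℝ) + (2 * ∫ v, bracket v ∂(f t : Measure ℝ) + 2 * c ^ 2)) *
    (√(2 * (2 * ∫ v, bracket v ∂(f t : Measure ℝ) + 2 * c ^ 2)) * c))
  have hS : Continuous S := by fun_prop
  have hS0 : S 0 = √(truncDissipation e r (f t)) := by simp [S]
  have hSl : Tendsto (fun h => S (d h)) (𝓝[≠] 0) (𝓝 (√(truncDissipation e r (f t)))) := by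
    rw [← hS0]
    exact (hS.tendsto 0).comp hd0
  refine le_of_tendsto_of_tendsto (tendsto_abs_slope hG) (hSl.mul hq) ?_
  filter_upwards [eventually_add_mem_Icc ht] with h hh
  rw [← mul_div_assoc]
  refine div_le_div_of_nonneg_right ?_ (abs_nonneg _)
  exact abs_integral_truncEnergy_sub_le_dA he0 he1 (hN t htI).1 hr
    (toReal_dist_le (dA_comm he1) hm hd htI hh.1).1

/-- The truncated energy is absolutely continuous, hence the integral of its derivative. Bounding
D_r by the full dissipation makes the right-hand side independent of r, so the limit r → ∞ concerns
only the left-hand side. -/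
lemma ofReal_abs_truncEnergy_sub_le {r : ℝ} (hr : 0 < r) {s t : ℝ} (hs : 0 ≤ s) (hst : s ≤ t)
    (ht : t ≤ T) :
    ENNReal.ofReal |∫ v, truncEnergy r v ∂(f t : Measure ℝ) -
        ∫ v, truncEnergy r v ∂(f s : Measure ℝ)| ≤
      ∫⁻ x in Ioo s t, dissipation e (f x) ^ (1 / 2 : ℝ) * metricDeriv (dA e) f x := by
  obtain ⟨N, hN0, hN⟩ := exists_moment_bound_curve he0 he1 hT hm hmi hd h0
  obtain ⟨A, hA0, hA⟩ := exists_lipschitz_curve he0 he1 hT hm hmi hd h0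
  set G : ℝ → ℝ := fun t => ∫ v, truncEnergy r v ∂(f t : Measure ℝ)
  have hac : AbsolutelyContinuousOnInterval G 0 T :=
    absolutelyContinuous_of_le_integral hT hmi (C := r * A) fun s hs t ht =>
      (hA s hs t ht _ contDiff_truncEnergy r hr fun v => by
        rw [deriv_truncEnergy hr]
        exact abs_truncId_le hr v).trans_eq (mul_assoc _ _ _).symm
  have hsub : uIcc s t ⊆ uIcc 0 T := by
    rw [uIcc_of_le hst, uIcc_of_le hT.le]
    exact Icc_subset_Icc hs ht
  have hsubo : Ioo s t ⊆ Ioo 0 T := Ioo_subset_Ioo hs ht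
  have hmd := ae_restrict_of_ae_restrict_of_subset hsubo
    (ae_tendsto_diffQuot (dA_comm he1) (dA_triangle he1) hT hm hmi hd)
  rw [← (hac.mono hsub).integral_deriv_eq_sub, intervalIntegral.integral_of_le hst,
    integral_Ioc_eq_integral_Ioo, ← Real.enorm_eq_ofReal_abs]
  refine (enorm_integral_le_lintegral_enorm _).trans (lintegral_mono_ae ?_)
  filter_upwards [hmd, ae_restrict_of_ae hac.ae_differentiableAt,
    ae_restrict_mem measurableSet_Ioo] with x hx hdiff hxm
  have hxI := hsubo hxm
  have hxI' := Ioo_subset_Icc_self hxI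
  have hfin := ne_top_of_le_ne_top ENNReal.ofReal_ne_top hx.2
  have hG := (hdiff (by rwa [uIcc_of_le hT.le])).hasDerivAt
  rw [Real.enorm_eq_ofReal_abs]
  refine (ENNReal.ofReal_le_ofReal (abs_deriv_truncEnergy_curve_le he0 he1 hT hm hmi hd h0 hr hxI
    hx.1 hfin hG)).trans ?_
  rw [ENNReal.ofReal_mul (Real.sqrt_nonneg _), ENNReal.ofReal_toReal hfin]
  gcongr
  rw [Real.sqrt_eq_rpow, ← ENNReal.ofReal_rpow_of_nonneg (truncDissipation_nonneg he1 _)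
    (by norm_num)]
  gcongr
  exact ofReal_truncDissipation_le (hN x hxI').1 he1 hr

/-- The truncated energy is below the full one on the right, and Fatou recovers the full one on the
left. Both energies and the integral may be infinite, so the inequalities are kept additive. -/
lemma energy_le_add_lintegral {s t : ℝ} (hs : 0 ≤ s) (hst : s ≤ t) (ht : t ≤ T) :
    energy (f t) ≤ energy (f s) +
        ∫⁻ x in Ioo s t, dissipation e (f x) ^ (1 / 2 : ℝ) * metricDeriv (dA e) f x ∧
      energy (f s) ≤ energy (f t) +
        ∫⁻ x in Ioo s t, dissipation e (f x) ^ (1 / 2 : ℝ) * metricDeriv (dA e) f x := by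
  obtain ⟨N, hN0, hN⟩ := exists_moment_bound_curve he0 he1 hT hm hmi hd h0
  have hsI : s ∈ Icc 0 T := ⟨hs, hst.trans ht⟩
  have htI : t ∈ Icc 0 T := ⟨hs.trans hst, ht⟩
  have key : ∀ {x y : ℝ} {I : ℝ≥0∞}, ENNReal.ofReal |x - y| ≤ I →
      ENNReal.ofReal x ≤ ENNReal.ofReal y + I := fun {x y I} h => by
    calc ENNReal.ofReal x = ENNReal.ofReal (y + (x - y)) := by rw [add_sub_cancel]
      _ ≤ ENNReal.ofReal y + ENNReal.ofReal (x - y) := ENNReal.ofReal_add_le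
      _ ≤ ENNReal.ofReal y + I := by
        gcongr
        exact (ENNReal.ofReal_le_ofReal (le_abs_self _)).trans h
  constructor
  · refine energy_le_of_forall_trunc (hN t htI).1 fun n => ?_
    refine (key (ofReal_abs_truncEnergy_sub_le he0 he1 hT hm hmi hd h0 (by positivity)
      hs hst ht)).trans ?_
    gcongr
    exact ofReal_integral_truncEnergy_le (hN s hsI).1 (by positivity)
  · refine energy_le_of_forall_trunc (hN s hsI).1 fun n => ?_
    have := ofReal_abs_truncEnergy_sub_le he0 he1 hT hm hmi hd h0
      (by positivity : (0 : ℝ) < n + 1) hs hst ht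
    rw [abs_sub_comm] at this
    refine (key this).trans ?_
    gcongr
    exact ofReal_integral_truncEnergy_le (hN t htI).1 (by positivity)

end Curve

end CollisionMetric

theorem mainTheorem5 (e : ℝ) (he0 : 0 ≤ e) (he1 : e < 1) (T : ℝ) (hT : 0 < T)
    (p : ℝ≥0∞) (hp : 1 ≤ p) (f : ℝ → ProbabilityMeasure ℝ)
    (hf : CollisionMetric.IsAbsCont (CollisionMetric.dA e) p T f)
    (hf0 : f 0 ∈ CollisionMetric.P2cm) :
    -- the metric derivative exists as a limit at almost every time
    (∀ᵐ t ∂(volume.restrict (Ioo 0 T)),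
      Tendsto (CollisionMetric.diffQuot (CollisionMetric.dA e) f t) (𝓝[≠] 0)
        (𝓝 (CollisionMetric.metricDeriv (CollisionMetric.dA e) f t))) ∧
    -- the square root of the dissipation is a Borel function along the curve
    (Measurable fun r : Icc (0 : ℝ) T => CollisionMetric.dissipation e (f r) ^ (1 / 2 : ℝ)) ∧
    -- the upper gradient inequality, as an inequality in `[0, ∞]`
    ∀ s t : ℝ, 0 ≤ s → s ≤ t → t ≤ T →
      CollisionMetric.energy (f t) ≤ CollisionMetric.energy (f s) +
          ∫⁻ r in Ioo s t, CollisionMetric.dissipation e (f r) ^ (1 / 2 : ℝ) *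
            CollisionMetric.metricDeriv (CollisionMetric.dA e) f r ∧
      CollisionMetric.energy (f s) ≤ CollisionMetric.energy (f t) +
          ∫⁻ r in Ioo s t, CollisionMetric.dissipation e (f r) ^ (1 / 2 : ℝ) *
            CollisionMetric.metricDeriv (CollisionMetric.dA e) f r := by
  obtain ⟨m, hm, hmp, hd⟩ := hf
  -- On a bounded interval L^p embeds in L¹, so all exponents p ≥ 1 reduce to p = 1.
  have hmi : IntegrableOn m (Icc 0 T) := hmp.integrable hp
  have h0 := CollisionMetric.integrable_bracket_of_mem_P2cm hf0
  refine ⟨?_, ?_, fun s t hs hst ht =>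
    CollisionMetric.energy_le_add_lintegral he0 he1 hT hm hmi hd h0 hs hst ht⟩
  · exact (CollisionMetric.ae_tendsto_diffQuot (CollisionMetric.dA_comm he1)
      (CollisionMetric.dA_triangle he1) hT hm hmi hd).mono fun t ht => ht.1
  · exact (CollisionMetric.measurable_dissipation_curve he0 he1 hT hm hmi hd h0).pow_const _
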